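/- **Setting.** Let $Q$ and $V$ be second countable locally compact groups, $V$ abelian (written additively), with a continuous action of $Q$ on $V$ by automorphisms. Let $0\to V\to G\xrightarrow{p} Q\to 1$ be an extension of (second countable) locally compact groups inducing this action, let $\sigma\colon Q\to G$ be a Borel section of $p$, and let $\beta\colon Q\times Q\to V$ be the Borel $2$-cocycle defined by $\beta(q_1,q_2)=\sigma(q_1)\sigma(q_2)\sigma(q_1q_2)^{-1}$. Every $g\in G$ is uniquely $g=v\,\sigma(q)$ with $q\in Q$, $v\in V$; thus $G$ is identified, as a Borel group, with $Q\times V$ with the product $(q_1,v_1)(q_2,v_2)=(q_1q_2,\,v_1+q_1v_2+\beta(q_1,q_2))$. Let $\hat V$ be the dual group with pairing $e^{i\langle\xi,v\rangle}$ and the dual action $e^{i\langle q^\flat\xi,v\rangle}=e^{i\langle\xi,q^{-1}v\rangle}$. Fix left Haar measures on $Q$, $\hat V$ and $G$. Let $\eta\colon Q\to\hat V$ be a continuous $1$-cocycle, $\eta(q_1q_2)=\eta(q_1)+q_1^\flat\eta(q_2)$. Assume that * $\eta$ is *essentially bijective*: it is a measure class isomorphism from $Q$ to $\hat V$, i.e.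 it is nonsingular and has a nonsingular Borel almost everywhere inverse; * $(\eta,\beta)$ is *compatible*: for $\psi(q_1,q_2,q_3):=e^{i\langle\eta(q_1^{-1}),\beta(q_2,q_3)\rangle}$ there is a Borel map $b\colon Q\times Q\to\mathbb T$ with $$\psi(q_1,q_2,q_3)=\frac{b(q_2,q_3)\,b(q_1,q_2q_3)}{b(q_1,q_2)\,b(q_1q_2,q_3)}\quad\text{for all } q_1,q_2,q_3\in Q.$$ Fix any such $b$ and define operators on $L^2(Q)$ by $$(\pi(q,v)\varphi)(q_0)=e^{-i\langle\eta(q_0),v\rangle}\,b(q_0^{-1},q)\,\varphi(q^{-1}q_0).$$ **Theorem.** The pair $(B(L^2(Q)),\operatorname{Ad}\pi)$ is a $G$-Galois object. Explicitly: 1. $\pi$ is a Borel irreducible projective unitary representation of $G$ on $L^2(Q)$ (in the sense that its matrix coefficients are Borel, $\pi(g)\pi(h)\in\mathbb T\,\pi(gh)$, and its commutant is $\mathbb C1$). 2. $\pi$ is square-integrable: it has a Duflo–Moore operator, that is, a positive nonsingular self-adjoint operator $D$ on $L^2(Q)$ such that, for all $\varphi_1,\varphi_2\in L^2(Q)$,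 $$\int_G|\langle\varphi_1,\pi(g)\varphi_2\rangle|^2\,dg=\|\varphi_1\|^2\,\|D^{1/2}\varphi_2\|^2,$$ where $\|D^{1/2}\varphi_2\|=\infty$ if $\varphi_2$ is not in the domain of $D^{1/2}$, and $0\cdot\infty=0$. 3. Let $\tilde\varphi=\operatorname{Tr}(D^{1/2}\,\cdot\,D^{1/2})$ be the corresponding weight on $\mathcal N=B(L^2(Q))$, $\mathfrak N_{\tilde\varphi}=\{T\in\mathcal N:\tilde\varphi(T^*T)<\infty\}$, and let $\tilde\Lambda\colon\mathfrak N_{\tilde\varphi}\to L^2(\mathcal N,\tilde\varphi)$ be its GNS map. Then there is a unitary operator $$\mathcal G\colon L^2(\mathcal N,\tilde\varphi)\otimes L^2(\mathcal N,\tilde\varphi)\to L^2(G;L^2(\mathcal N,\tilde\varphi))$$ (the Galois map) such that, for all $S,T\in\mathfrak N_{\tilde\varphi}$, $$\mathcal G\big(\tilde\Lambda(S)\otimes\tilde\Lambda(T)\big)(g)=\tilde\Lambda(\pi(g)S\pi(g)^*T)\quad\text{for almost all } g\in G.$$ -/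

import Mathlib

open MeasureTheory
open scoped ENNReal TensorProduct

universe u

noncomputable section

namespace GaloisObj

/-! ### Measure class isomorphisms -/

/-- A Borel map `f : X → Y` is a measure class isomorphism if it is nonsingular and has a
nonsingular Borel almost everywhere inverse. -/
def IsMeasureClassIso {X Y : Type*} [MeasurableSpace X] [MeasurableSpace Y]
    (μ : Measure X) (ν : Measure Y) (f : X → Y) : Prop :=
  Measure.QuasiMeasurePreserving f μ ν ∧
    ∃ g : Y → X, Measure.QuasiMeasurePreserving g ν μ ∧
      (∀ᵐ x ∂μ, g (f x) = x) ∧ (∀ᵐ y ∂ν, f (g y) = y)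

/-! ### Cocycles and extensions

The abelian group `V` is written multiplicatively; `PontryaginDual V` is its dual group, and
`ξ v` (a point of the circle) is the duality pairing. -/

section Cocycles

variable {Q V : Type*} [Group Q] [CommGroup V] [TopologicalSpace V]
  [MulDistribMulAction Q V]

/-- The automorphism `v ↦ q • v` of `V`, as a continuous homomorphism. -/
def actHom [ContinuousConstSMul Q V] (q : Q) : V →ₜ* V where
  toMonoidHom := MulDistribMulAction.toMonoidHom V q
  continuous_toFun := continuous_const_smul q

/-- The dual action of `Q` on the dual group: `(q ♭ ξ)(v) = ξ (q⁻¹ • v)`. -/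
def dualAct [ContinuousConstSMul Q V] (q : Q) (ξ : PontryaginDual V) : PontryaginDual V :=
  PontryaginDual.map (actHom q⁻¹) ξ

/-- Continuous 1-cocycles `η : Q → V̂` with respect to the dual action. -/
structure IsOneCocycle [TopologicalSpace Q] [ContinuousConstSMul Q V]
    (η : Q → PontryaginDual V) : Prop where
  continuous : Continuous η
  map_mul : ∀ q₁ q₂, η (q₁ * q₂) = η q₁ * dualAct q₁ (η q₂)

/-- The circle valued 3-cocycle `ψ(q₁, q₂, q₃) = ⟨η(q₁⁻¹), β(q₂, q₃)⟩`. -/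
def psi (η : Q → PontryaginDual V) (β : Q → Q → V) (q₁ q₂ q₃ : Q) : Circle :=
  η q₁⁻¹ (β q₂ q₃)

/-- The coboundary of a circle valued 2-cochain on `Q` (trivial action on the circle). -/
def coboundary (b : Q → Q → Circle) (q₁ q₂ q₃ : Q) : Circle :=
  b q₂ q₃ * b q₁ (q₂ * q₃) / (b q₁ q₂ * b (q₁ * q₂) q₃)

/-- `b` is a Borel 2-cochain with `ψ = ∂b`. -/
structure IsTrivialization [MeasurableSpace Q] (η : Q → PontryaginDual V) (β : Q → Q → V)
    (b : Q → Q → Circle) : Prop where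
  measurable : Measurable fun p : Q × Q => (b p.1 p.2 : ℂ)
  eq_coboundary : ∀ q₁ q₂ q₃, psi η β q₁ q₂ q₃ = coboundary b q₁ q₂ q₃

/-- `(η, β)` is compatible if `ψ` is trivial in the Moore cohomology group `H³(Q; 𝕋)`
(the cohomology of Borel cochains). -/
def Compatible [MeasurableSpace Q] (η : Q → PontryaginDual V) (β : Q → Q → V) : Prop :=
  ∃ b : Q → Q → Circle, IsTrivialization η β b

variable {G : Type*} [Group G]

/-- A short exact sequence `1 → V → G → Q → 1` is an extension of topological groups, inducing
the given action of `Q` on `V`. -/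
structure IsTopExtension [TopologicalSpace Q] [TopologicalSpace G]
    (S : GroupExtension V G Q) : Prop where
  isEmbedding_inl : Topology.IsEmbedding S.inl
  continuous_rightHom : Continuous S.rightHom
  isOpenMap_rightHom : IsOpenMap S.rightHom
  inl_smul : ∀ (g : G) (v : V), S.inl (S.rightHom g • v) = g * S.inl v * g⁻¹

/-- `β` is the Borel 2-cocycle of the extension defined by the Borel section `σ`. -/
structure IsRepresentative [MeasurableSpace Q] [MeasurableSpace V] [MeasurableSpace G]
    (S : GroupExtension V G Q) (σ : S.Section) (β : Q → Q → V) : Prop where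
  measurable_section : Measurable σ
  measurable_cocycle : Measurable (Function.uncurry β)
  inl_cocycle : ∀ q₁ q₂, S.inl (β q₁ q₂) = σ q₁ * σ q₂ * (σ (q₁ * q₂))⁻¹

/-- Every `g : G` is `S.inl v * σ q` for unique `(q, v) ∈ Q × V`, where `q = S.rightHom g`.
This identifies `G` with `Q × V` with the product
`(q₁, v₁) (q₂, v₂) = (q₁ q₂, v₁ (q₁ • v₂) β(q₁, q₂))`. The present function is `g ↦ v`. -/
def vPart (S : GroupExtension V G Q) (σ : S.Section) (g : G) : V :=
  (MonoidHom.ofInjective S.inl_injective).symm ⟨g * (σ (S.rightHom g))⁻¹, by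
    rw [S.range_inl_eq_ker_rightHom, MonoidHom.mem_ker]; simp⟩

lemma inl_vPart_mul (S : GroupExtension V G Q) (σ : S.Section) (g : G) :
    S.inl (vPart S σ g) * σ (S.rightHom g) = g := by
  have h : S.inl (vPart S σ g) = g * (σ (S.rightHom g))⁻¹ := by
    have := congrArg Subtype.val ((MonoidHom.ofInjective S.inl_injective).apply_symm_apply
      ⟨g * (σ (S.rightHom g))⁻¹, by
        rw [S.range_inl_eq_ker_rightHom, MonoidHom.mem_ker]; simp⟩)
    exact this
  simp [h]

end Cocycles

/-! ### The projective representation on `L²(Q)` -/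

section Representation

variable {Q V : Type*} [Group Q] [TopologicalSpace Q] [IsTopologicalGroup Q]
  [SecondCountableTopology Q] [MeasurableSpace Q] [BorelSpace Q]
  [CommGroup V] [TopologicalSpace V]

/-- The function `q₀ ↦ conj ⟨η(q₀), v⟩ b(q₀⁻¹, q) φ(q⁻¹ q₀)`. -/
def piFun (η : Q → PontryaginDual V) (b : Q → Q → Circle) (q : Q) (v : V) (φ : Q → ℂ)
    (q₀ : Q) : ℂ :=
  starRingEnd ℂ (η q₀ v : ℂ) * (b q₀⁻¹ q : ℂ) * φ (q⁻¹ * q₀)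

lemma measurable_eval {η : Q → PontryaginDual V} (hη : Continuous η) (v : V) :
    Measurable fun q₀ => (η q₀ v : ℂ) := by
  have h : Continuous fun ξ : PontryaginDual V => ξ v := by
    have h1 : Continuous fun ξ : PontryaginDual V =>
        (ContinuousMonoidHom.toContinuousMap (A := V) (B := Circle) ξ) :=
      (ContinuousMonoidHom.isInducing_toContinuousMap V Circle).continuous
    exact (continuous_eval_const (F := C(V, Circle)) v).comp h1
  exact (continuous_subtype_val.comp (h.comp hη)).measurable

lemma norm_piFun (η : Q → PontryaginDual V) (b : Q → Q → Circle) (q : Q) (v : V) (φ : Q → ℂ)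
    (q₀ : Q) : ‖piFun η b q v φ q₀‖ = ‖φ (q⁻¹ * q₀)‖ := by
  simp only [piFun, norm_mul, RCLike.norm_conj, Circle.norm_coe, one_mul]

lemma memLp_piFun (μ : Measure Q) [μ.IsMulLeftInvariant] {η : Q → PontryaginDual V}
    (hη : Continuous η) {b : Q → Q → Circle} (hb : Measurable fun p : Q × Q => (b p.1 p.2 : ℂ))
    (q : Q) (v : V) {φ : Q → ℂ} (hφ : MemLp φ 2 μ) : MemLp (piFun η b q v φ) 2 μ := by
  have hφ' : MemLp (fun q₀ => φ (q⁻¹ * q₀)) 2 μ :=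
    hφ.comp_measurePreserving (measurePreserving_mul_left μ q⁻¹)
  refine hφ'.of_le ?_ (Filter.Eventually.of_forall fun q₀ => (norm_piFun η b q v φ q₀).le)
  refine AEStronglyMeasurable.mul (Measurable.aestronglyMeasurable ?_) hφ'.1
  refine (Complex.continuous_conj.measurable.comp (measurable_eval hη v)).mul ?_
  exact hb.comp (measurable_inv.prodMk measurable_const)

/-- The operator `(π(q, v) φ)(q₀) = conj ⟨η(q₀), v⟩ b(q₀⁻¹, q) φ(q⁻¹ q₀)` on `L²(Q)`. -/
def piOp (μ : Measure Q) [μ.IsMulLeftInvariant] {η : Q → PontryaginDual V}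
    (hη : Continuous η) {b : Q → Q → Circle} (hb : Measurable fun p : Q × Q => (b p.1 p.2 : ℂ))
    (q : Q) (v : V) : Lp ℂ 2 μ →L[ℂ] Lp ℂ 2 μ :=
  LinearMap.mkContinuous
    { toFun := fun φ => (memLp_piFun μ hη hb q v (Lp.memLp φ)).toLp _
      map_add' := fun φ φ' => by
        rw [← MemLp.toLp_add]
        refine MemLp.toLp_congr _ _ ?_
        have h := (measurePreserving_mul_left μ q⁻¹).quasiMeasurePreserving.ae
          (Lp.coeFn_add φ φ')
        filter_upwards [h] with q₀ h₀
        rw [Pi.add_apply] at h₀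
        rw [Pi.add_apply]
        simp only [piFun, h₀, mul_add]
      map_smul' := fun c φ => by
        rw [RingHom.id_apply, ← MemLp.toLp_const_smul]
        refine MemLp.toLp_congr _ _ ?_
        have h := (measurePreserving_mul_left μ q⁻¹).quasiMeasurePreserving.ae
          (Lp.coeFn_smul c φ)
        filter_upwards [h] with q₀ h₀
        simp only [Pi.smul_apply, smul_eq_mul] at h₀
        simp only [piFun, h₀, Pi.smul_apply, smul_eq_mul]
        ring }
    1 fun φ => by
      have hφ' : MemLp (fun q₀ => φ (q⁻¹ * q₀)) 2 μ :=
        (Lp.memLp φ).comp_measurePreserving (measurePreserving_mul_left μ q⁻¹)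
      have h : eLpNorm (piFun η b q v φ) 2 μ = eLpNorm φ 2 μ := by
        rw [← eLpNorm_comp_measurePreserving (Lp.aestronglyMeasurable φ)
          (measurePreserving_mul_left μ q⁻¹)]
        exact eLpNorm_congr_norm_ae
          (Filter.Eventually.of_forall fun q₀ => norm_piFun η b q v φ q₀)
      simp only [LinearMap.coe_mk, AddHom.coe_mk, Lp.norm_toLp, h, one_mul]
      exact le_of_eq rfl

lemma piOp_apply_ae (μ : Measure Q) [μ.IsMulLeftInvariant] {η : Q → PontryaginDual V}
    (hη : Continuous η) {b : Q → Q → Circle} (hb : Measurable fun p : Q × Q => (b p.1 p.2 : ℂ))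
    (q : Q) (v : V) (φ : Lp ℂ 2 μ) : piOp μ hη hb q v φ =ᵐ[μ] piFun η b q v φ :=
  (memLp_piFun μ hη hb q v (Lp.memLp φ)).coeFn_toLp

/-- The map `g ↦ π(g)`, under the identification of `G` with `Q × V`. -/
def piRep {G : Type*} [Group G] (S : GroupExtension V G Q) (σ : S.Section)
    (μ : Measure Q) [μ.IsMulLeftInvariant] {η : Q → PontryaginDual V}
    (hη : Continuous η) {b : Q → Q → Circle} (hb : Measurable fun p : Q × Q => (b p.1 p.2 : ℂ))
    (g : G) : Lp ℂ 2 μ →L[ℂ] Lp ℂ 2 μ :=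
  piOp μ hη hb (S.rightHom g) (vPart S σ g)

end Representation

/-! ### Unbounded operators, weights and GNS representations -/

section Weights

variable {H : Type*} [NormedAddCommGroup H] [InnerProductSpace ℂ H] [CompleteSpace H]

/-- Positive self-adjoint (in general unbounded) operators. -/
structure IsPosSelfAdjoint (A : H →ₗ.[ℂ] H) : Prop where
  dense_domain : Dense (A.domain : Set H)
  isSelfAdjoint : IsSelfAdjoint A
  nonneg : ∀ x : A.domain, 0 ≤ (inner ℂ (x : H) (A x)).re

/-- `C = D^{1/2}`: `C` is positive self-adjoint and `C ∘ C = D`, including domains. -/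
structure IsPosSqrt (C D : H →ₗ.[ℂ] H) : Prop where
  isPosSelfAdjoint : IsPosSelfAdjoint C
  mem_graph_iff : ∀ x z : H, (x, z) ∈ D.graph ↔ ∃ y, (x, y) ∈ C.graph ∧ (y, z) ∈ C.graph

open Classical in
/-- `‖C x‖²`, understood as `∞` if `x` is not in the domain of `C`. -/
def formNormSq (C : H →ₗ.[ℂ] H) (x : H) : ℝ≥0∞ :=
  if h : x ∈ C.domain then ‖C ⟨x, h⟩‖ₑ ^ 2 else ∞

/-- The value of the weight `Tr(C · C)` at a positive bounded operator `T`: the trace of the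
positive quadratic form `x ↦ ⟪C x, T (C x)⟫` on the domain of `C`, that is, the supremum of its
partial traces `∑ x ∈ s, ⟪C x, T (C x)⟫` over the finite orthonormal families `s` in the domain. -/
def traceWeight (C : H →ₗ.[ℂ] H) (T : H →L[ℂ] H) : ℝ≥0∞ :=
  ⨆ (s : Finset C.domain) (_ : Orthonormal ℂ fun x : s => ((x : C.domain) : H)),
    ∑ x ∈ s, ENNReal.ofReal (inner ℂ (C x) (T (C x))).re

lemma ofReal_inner_star_mul (T : H →L[ℂ] H) (y : H) :
    ENNReal.ofReal (inner ℂ y ((star T * T) y)).re = ‖T y‖ₑ ^ 2 := by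
  have h : inner ℂ y ((star T * T) y) = inner ℂ (T y) (T y) := by
    rw [ContinuousLinearMap.star_eq_adjoint, mul_apply_eq_comp,
      ContinuousLinearMap.adjoint_inner_right]
  rw [h, ← ofReal_norm, ← ENNReal.ofReal_pow (norm_nonneg _)]
  congr 1
  exact (norm_sq_eq_re_inner (𝕜 := ℂ) (T y)).symm

lemma traceWeight_star_mul (C : H →ₗ.[ℂ] H) (T : H →L[ℂ] H) :
    traceWeight C (star T * T) =
      ⨆ (s : Finset C.domain) (_ : Orthonormal ℂ fun x : s => ((x : C.domain) : H)),
        ∑ x ∈ s, ‖T (C x)‖ₑ ^ 2 := by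
  simp only [traceWeight, ofReal_inner_star_mul]

lemma traceWeight_mul_le (C : H →ₗ.[ℂ] H) (R T : H →L[ℂ] H) :
    traceWeight C (star (R * T) * (R * T)) ≤ ‖R‖ₑ ^ 2 * traceWeight C (star T * T) := by
  rw [traceWeight_star_mul, traceWeight_star_mul]
  refine iSup₂_le fun s hs => ?_
  refine le_trans ?_ (mul_le_mul_right (le_iSup₂_of_le s hs le_rfl) _)
  rw [Finset.mul_sum]
  refine Finset.sum_le_sum fun x _ => ?_
  rw [← mul_pow]
  exact pow_le_pow_left' (R.le_opENorm (T (C x))) 2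

lemma traceWeight_add_le (C : H →ₗ.[ℂ] H) (S T : H →L[ℂ] H) :
    traceWeight C (star (S + T) * (S + T)) ≤
      2 * traceWeight C (star S * S) + 2 * traceWeight C (star T * T) := by
  simp only [traceWeight_star_mul]
  refine iSup₂_le fun s hs => ?_
  refine le_trans ?_ (add_le_add (mul_le_mul_right (le_iSup₂_of_le s hs le_rfl) _)
    (mul_le_mul_right (le_iSup₂_of_le s hs le_rfl) _))
  rw [Finset.mul_sum, Finset.mul_sum, ← Finset.sum_add_distrib]
  refine Finset.sum_le_sum fun x _ => ?_
  have h1 : ‖(S + T) (C x)‖ₑ ≤ ‖S (C x)‖ₑ + ‖T (C x)‖ₑ := enorm_add_le _ _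
  refine (pow_le_pow_left' h1 2).trans ?_
  have h2 := ENNReal.rpow_add_le_mul_rpow_add_rpow ‖S (C x)‖ₑ ‖T (C x)‖ₑ
    (p := 2) (by norm_num)
  norm_num at h2
  rw [← mul_add]
  exact h2

/-- The left ideal `𝔑 = {T : φ̃(T* T) < ∞}` of the weight `φ̃ = Tr(C · C)`. -/
def nIdeal (C : H →ₗ.[ℂ] H) : Submodule ℂ (H →L[ℂ] H) where
  carrier := {T | traceWeight C (star T * T) < ∞}
  zero_mem' := by simp [traceWeight]
  add_mem' := fun {S T} hS hT =>
    (traceWeight_add_le C S T).trans_lt (ENNReal.add_lt_top.2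
      ⟨ENNReal.mul_lt_top (by simp) hS, ENNReal.mul_lt_top (by simp) hT⟩)
  smul_mem' := fun c T hT => by
    have h := traceWeight_mul_le C (c • 1) T
    simp only [smul_mul_assoc, one_mul] at h
    exact h.trans_lt (ENNReal.mul_lt_top (by simp) hT)

lemma mul_mem_nIdeal (C : H →ₗ.[ℂ] H) (R : H →L[ℂ] H) {T : H →L[ℂ] H} (hT : T ∈ nIdeal C) :
    R * T ∈ nIdeal C :=
  (traceWeight_mul_le C R T).trans_lt (ENNReal.mul_lt_top (by simp) hT)

/-- `Λ : 𝔑 → K` is the GNS map of the weight `φ̃ = Tr(C · C)`, and `K = L²(B(H), φ̃)`: it is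
linear, has dense range, and `‖Λ T‖² = φ̃(T* T)`, equivalently, by polarization,
`⟪Λ S, Λ T⟫ = φ̃(S* T)`. These properties determine `(K, Λ)` up to a unique unitary. -/
structure IsGNS (C : H →ₗ.[ℂ] H) {K : Type*} [NormedAddCommGroup K] [InnerProductSpace ℂ K]
    (Λ : nIdeal C →ₗ[ℂ] K) : Prop where
  enorm_sq : ∀ T : nIdeal C,
    ‖Λ T‖ₑ ^ 2 = traceWeight C (star (T : H →L[ℂ] H) * (T : H →L[ℂ] H))
  denseRange : DenseRange Λ

end Weights

/-! ### Projective representations and Galois objects -/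

section Galois

variable {G : Type*} [Group G] [MeasurableSpace G]

/-- A (Borel) projective unitary representation that is irreducible (its commutant is trivial). -/
structure IsIrreducibleProjRep {H : Type*} [NormedAddCommGroup H] [InnerProductSpace ℂ H]
    [CompleteSpace H] (π : G → H →L[ℂ] H) : Prop where
  mem_unitary : ∀ g, π g ∈ unitary (H →L[ℂ] H)
  measurable_coeff : ∀ x y : H, Measurable fun g => inner ℂ x (π g y)
  mul : ∀ g h, ∃ z : Circle, π g * π h = (z : ℂ) • π (g * h)
  irreducible : ∀ T : H →L[ℂ] H, (∀ g, T * π g = π g * T) → ∃ c : ℂ, T = c • 1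

/-- `D` is the Duflo-Moore operator of `π` with respect to the Haar measure `μ`, with
`C = D^{1/2}`: the positive nonsingular self-adjoint operator such that
`∫ |⟪x, π(g) y⟫|² dg = ‖x‖² ‖D^{1/2} y‖²`. -/
structure IsDufloMoore {H : Type*} [NormedAddCommGroup H] [InnerProductSpace ℂ H]
    [CompleteSpace H] (μ : Measure G) (π : G → H →L[ℂ] H) (D C : H →ₗ.[ℂ] H) : Prop where
  isPosSelfAdjoint : IsPosSelfAdjoint D
  nonsingular : ∀ x : D.domain, D x = 0 → x = 0
  isPosSqrt : IsPosSqrt C D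
  lintegral_coeff : ∀ x y : H,
    ∫⁻ g, ‖inner ℂ x (π g y)‖ₑ ^ 2 ∂μ = ‖x‖ₑ ^ 2 * formNormSq C y

/-- The unitary `𝒢` (from the Hilbert space tensor product `K ⊗ K` onto `L²(G; K)`) is the Galois
map of `(B(H), Ad π)`: `𝒢(Λ S ⊗ Λ T)(g) = Λ(π(g) S π(g)* T)` for almost all `g`. -/
def IsGaloisMap {H : Type*} [NormedAddCommGroup H] [InnerProductSpace ℂ H]
    [CompleteSpace H] (μ : Measure G) (π : G → H →L[ℂ] H) (C : H →ₗ.[ℂ] H)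
    {K : Type*} [NormedAddCommGroup K] [InnerProductSpace ℂ K] (Λ : nIdeal C →ₗ[ℂ] K)
    (𝒢 : UniformSpace.Completion (K ⊗[ℂ] K) ≃ₗᵢ[ℂ] Lp K 2 μ) : Prop :=
  ∀ S T : nIdeal C,
    𝒢 ((Λ S ⊗ₜ[ℂ] Λ T : K ⊗[ℂ] K) : UniformSpace.Completion (K ⊗[ℂ] K)) =ᵐ[μ]
      fun g => Λ ⟨π g * (S : H →L[ℂ] H) * star (π g) * (T : H →L[ℂ] H),
        mul_mem_nIdeal C _ T.2⟩

/-- `(B(H), Ad π)` is a `G`-Galois object (`μ` is a left Haar measure on `G`): `π` is an irreducible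
projective unitary representation, it is square-integrable with Duflo-Moore operator `D`, and the
Galois map on the GNS space `K = L²(B(H), φ̃)` of the weight `φ̃ = Tr(D^{1/2} · D^{1/2})` exists
as a unitary operator. The operators `D`, `C = D^{1/2}` are unique and `(K, Λ)` is unique up to
unitary equivalence, so that the existential quantifiers over them express no choice. -/
structure IsGaloisObject {H : Type u} [NormedAddCommGroup H] [InnerProductSpace ℂ H]
    [CompleteSpace H] (μ : Measure G) (π : G → H →L[ℂ] H) : Prop where
  isIrreducibleProjRep : IsIrreducibleProjRep π
  galois : ∃ D C : H →ₗ.[ℂ] H, IsDufloMoore μ π D C ∧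
    ∃ (K : Type u) (_ : NormedAddCommGroup K) (_ : InnerProductSpace ℂ K) (_ : CompleteSpace K)
      (Λ : nIdeal C →ₗ[ℂ] K), IsGNS C Λ ∧
      ∃ 𝒢 : UniformSpace.Completion (K ⊗[ℂ] K) ≃ₗᵢ[ℂ] Lp K 2 μ, IsGaloisMap μ π C Λ 𝒢

end Galois

end GaloisObj

end

/-! In the coordinates `Q × V` of `G`, a matrix coefficient of `π` is, for fixed `q`, a Fourier
integral in `v`: the function `conj x(q₀) b(q₀⁻¹, q) y(q⁻¹ q₀)` of `q₀` is integrated against the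
characters `conj η(q₀)(v)` (`inner_piOp`). That `π` is projective is the cocycle identity of `η`
together with `ψ = ∂b` (`piFun_piFun`).

The cocycle identity also says that `η` intertwines left translation on `Q` with the affine maps `ξ
↦ η(q) · q♭ξ` of the dual. These scale Haar measure of the dual by the modulus `δ(q)` of the action
on `V` (`map_dualAct`), so under `η` that Haar measure becomes a multiple of `δ⁻¹ dq`
(`exists_lintegral_dual_eq`). Plancherel on `V` thus becomes a formula between `V` and `Q`, used in
both directions (`exists_plancherel_cocycle`, `lintegral_cofourier`). Haar measure of `G` is a
multiple `κ δ(q)⁻¹ dq dv`. Plancherel in `v` and the substitution `q ↦ q⁻¹ q₀` then give the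
orthogonality relations, with `D` equal to multiplication by `κ c⁻¹ δ d`, where `c` is the
Plancherel constant and `d` the density of inversion on `Q` (`lintegral_coeff_piRep`).
Irreducibility follows from these relations (`exists_eq_smul_one_of_commute`).

The GNS space of the weight is realized as `ℓ²(ι; L²(Q))` through `T ↦ (T C e i)`, with `C =
D^{1/2}` and `e` a basis in its domain. The orthogonality relations make the Galois map isometric
(`norm_galoisBilin`). Testing on rank one operators reduces density of its range to totality of the
matrix coefficients in `L²(G)` (`dense_range_galoisBilin`). For totality, the coefficients of
suitable bases form an orthonormal system for which all product functions `θ(q) h(v)` satisfy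
Parseval's identity (`tsum_enorm_integral_coeff`); product functions therefore lie in the closed
span of the coefficients, and they are total.

Plancherel for `V` is derived from spectral measures of the translation representation: Gelfand
duality and Riesz–Markov–Kakutani produce them, finite measures on the dual are determined by their
Fourier transforms (`measure_dual_ext`), and a symmetry between the spectral measures of two
functions (`IsSpectralMeasure.withDensity_comm`) yields the formula. Neither Pontryagin duality nor
surjectivity of the Plancherel transform enters. -/

section Library

open MeasureTheory WeakDual
open scoped ENNReal NNReal TensorProduct ComplexOrder

set_option linter.unusedSectionVars false

noncomputable section

namespace GaloisObj

/-! ### The dual group -/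

section DualGroup

variable {V : Type*} [CommGroup V] [TopologicalSpace V] [IsTopologicalGroup V]
  [LocallyCompactSpace V] [SecondCountableTopology V]

/-- The dual is closed in `C(V, Circle)`, which is Polish because `V` is second countable and
locally compact. Polishness lets a separating algebra of bounded functions determine finite Borel
measures. -/
instance : PolishSpace (PontryaginDual V) := by
  have h : Topology.IsClosedEmbedding
      (ContinuousMonoidHom.toContinuousMap : (V →ₜ* Circle) → C(V, Circle)) :=
    ContinuousMonoidHom.isClosedEmbedding_toContinuousMap V Circle
  have : (uniformity Circle).IsCountablyGenerated :=
    inferInstanceAs (uniformity (Metric.sphere (0 : ℂ) 1)).IsCountablyGenerated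
  exact (h.polishSpace : PolishSpace (V →ₜ* Circle))

lemma continuous_dual_eval :
    Continuous fun p : PontryaginDual V × V => p.1 p.2 := by
  have h1 : Continuous fun ξ : PontryaginDual V =>
      (ContinuousMonoidHom.toContinuousMap (A := V) (B := Circle) ξ) :=
    (ContinuousMonoidHom.isInducing_toContinuousMap V Circle).continuous
  exact (h1.comp continuous_fst).eval continuous_snd

lemma continuous_dual_eval_coe :
    Continuous fun p : PontryaginDual V × V => (p.1 p.2 : ℂ) :=
  continuous_subtype_val.comp continuous_dual_eval

lemma continuous_eval_coe (v : V) : Continuous fun ξ : PontryaginDual V => (ξ v : ℂ) :=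
  continuous_dual_eval_coe.comp (Continuous.prodMk_left v)

/-- The character of the dual group defined by a point `v : V`, as a bounded function. -/
def evalBdd (v : V) : BoundedContinuousFunction (PontryaginDual V) ℂ :=
  BoundedContinuousFunction.ofNormedAddCommGroup (fun ξ => (ξ v : ℂ)) (continuous_eval_coe v) 1
    fun _ => (Circle.norm_coe _).le

/-- Finite measures on the dual group are determined by their Fourier transforms. -/
theorem measure_dual_ext [MeasurableSpace (PontryaginDual V)] [BorelSpace (PontryaginDual V)]
    {μ ν : Measure (PontryaginDual V)} [IsFiniteMeasure μ] [IsFiniteMeasure ν]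
    (h : ∀ v : V, ∫ ξ, (ξ v : ℂ) ∂μ = ∫ ξ, (ξ v : ℂ) ∂ν) : μ = ν := by
  let _ := TopologicalSpace.upgradeIsCompletelyMetrizable (PontryaginDual V)
  -- Products and conjugates of evaluations at points of `V` are again evaluations, at `v * w` and
  -- `v⁻¹`, so their span is already a star algebra. It separates characters trivially.
  let S : Submodule ℂ (BoundedContinuousFunction (PontryaginDual V) ℂ) :=
    Submodule.span ℂ (Set.range evalBdd)
  let A : StarSubalgebra ℂ (BoundedContinuousFunction (PontryaginDual V) ℂ) :=
    { Submodule.toSubalgebra S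
        (Submodule.subset_span ⟨1, by ext ξ; simp [evalBdd]⟩)
        (fun f g hf hg => by
          have h1 : f * g ∈ S * S := Submodule.mul_mem_mul hf hg
          rw [Submodule.span_mul_span] at h1
          refine Submodule.span_mono ?_ h1
          rintro _ ⟨_, ⟨v, rfl⟩, _, ⟨w, rfl⟩, rfl⟩
          exact ⟨v * w, by ext ξ; simp [evalBdd]⟩) with
      star_mem' := fun {f} hf => by
        change f ∈ S at hf
        change star f ∈ S
        induction hf using Submodule.span_induction with
        | mem x hx =>
          obtain ⟨v, rfl⟩ := hx
          exact Submodule.subset_span ⟨v⁻¹, by ext ξ; simp [evalBdd, ← Circle.coe_inv_eq_conj]⟩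
        | zero => simp
        | add x y _ _ hx hy => rw [star_add]; exact S.add_mem hx hy
        | smul c x _ hx => rw [star_smul]; exact S.smul_mem _ hx }
  refine ext_of_forall_mem_subalgebra_integral_eq_of_pseudoEMetric_complete_countable
    (𝕜 := ℂ) (A := A) ?_ ?_
  · intro ξ₁ ξ₂ hne
    obtain ⟨v, hv⟩ : ∃ v, ξ₁ v ≠ ξ₂ v := by
      by_contra! hc
      exact hne (PontryaginDual.ext hc)
    have hA : evalBdd v ∈ A := Submodule.subset_span ⟨v, rfl⟩
    exact ⟨_, ⟨_, ⟨_, hA, rfl⟩, rfl⟩, fun hc => hv (Subtype.ext hc)⟩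
  · intro g hg
    change g ∈ S at hg
    induction hg using Submodule.span_induction with
    | mem x hx => obtain ⟨v, rfl⟩ := hx; exact h v
    | zero => simp
    | add x y _ _ hx hy =>
      simp only [BoundedContinuousFunction.coe_add, Pi.add_apply]
      rw [integral_add (x.integrable _) (y.integrable _),
        integral_add (x.integrable _) (y.integrable _), hx, hy]
    | smul c x _ hx =>
      simp only [BoundedContinuousFunction.coe_smul]
      rw [integral_smul, integral_smul, hx]

end DualGroup

/-! ### Positive functionals on commutative C⋆-algebras -/

section Gelfand

/-- The complexification of a real continuous function. -/
def ofRealMap {X : Type*} [TopologicalSpace X] (f : C(X, ℝ)) : C(X, ℂ) :=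
  ⟨fun x => (f x : ℂ), by fun_prop⟩

/-- Gelfand duality turns `A` into `C(X)` for the compact character space `X`. A functional positive
on the elements `star a * a` is positive on nonnegative functions, which have square roots, and the
Riesz–Markov–Kakutani theorem represents it. -/
theorem exists_measure_characterSpace {A : Type*} [CommCStarAlgebra A]
    [MeasurableSpace (characterSpace ℂ A)] [BorelSpace (characterSpace ℂ A)]
    (ω : A →ₗ[ℂ] ℂ) (hω : ∀ a, 0 ≤ ω (star a * a)) :
    ∃ ν : Measure (characterSpace ℂ A), IsFiniteMeasure ν ∧ ∀ a, ∫ χ, χ a ∂ν = ω a := by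
  let X := characterSpace ℂ A
  let e := gelfandStarTransform A
  have hpos : ∀ f : C(X, ℝ), (∀ x, 0 ≤ f x) → 0 ≤ ω (e.symm (ofRealMap f)) := by
    intro f hf
    let g : C(X, ℝ) := ⟨fun x => √(f x), by fun_prop⟩
    have h1 : ofRealMap f = star (ofRealMap g) * ofRealMap g := by
      ext x
      simp only [ofRealMap, ContinuousMap.coe_mk, ContinuousMap.mul_apply, ContinuousMap.star_apply,
        RCLike.star_def, Complex.conj_ofReal, g]
      rw [← Complex.ofReal_mul, Real.mul_self_sqrt (hf x)]
    rw [h1, map_mul, map_star]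
    exact hω _
  have hadd : ∀ f g : C(X, ℝ), ofRealMap (f + g) = ofRealMap f + ofRealMap g := by
    intro f g; ext x; simp [ofRealMap]
  have hsmul : ∀ (c : ℝ) (f : C(X, ℝ)), ofRealMap (c • f) = (c : ℂ) • ofRealMap f := by
    intro c g; ext x; simp [ofRealMap]
  -- A real function is a difference of two nonnegative ones, on which `ω` takes real values.
  have him : ∀ f : C(X, ℝ), (ω (e.symm (ofRealMap f))).im = 0 := by
    intro f
    have h1 : f + ⟨fun x => max (-(f x)) 0, by fun_prop⟩ = (⟨fun x => max (f x) 0, by fun_prop⟩ : C(X, ℝ)) := by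
      ext x
      simp only [ContinuousMap.add_apply, ContinuousMap.coe_mk]
      rcases le_total (f x) 0 with h | h
      · rw [max_eq_left (by linarith), max_eq_right h]; ring
      · rw [max_eq_right (by linarith), max_eq_left h]; ring
    have h2 := congrArg (fun f => (ω (e.symm (ofRealMap f))).im) h1
    simp only [hadd, map_add, Complex.add_im] at h2
    rw [← (Complex.le_def.1 (hpos ⟨fun x => max (f x) 0, by fun_prop⟩ fun x => le_max_right _ _)).2,
      ← (Complex.le_def.1 (hpos ⟨fun x => max (-(f x)) 0, by fun_prop⟩
        fun x => le_max_right _ _)).2] at h2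
    simpa using h2
  let Λ : CompactlySupportedContinuousMap X ℝ →ₚ[ℝ] ℝ :=
    PositiveLinearMap.mk₀
      { toFun := fun f => (ω (e.symm (ofRealMap f))).re
        map_add' := fun f g => by
          have : ((f + g : CompactlySupportedContinuousMap X ℝ) : C(X, ℝ)) = (f : C(X, ℝ)) + g := rfl
          rw [this, hadd, map_add, map_add, Complex.add_re]
        map_smul' := fun c f => by
          have : ((c • f : CompactlySupportedContinuousMap X ℝ) : C(X, ℝ)) = c • (f : C(X, ℝ)) := rfl
          rw [this, hsmul, map_smul, map_smul]
          simp }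
      (fun f hf => (Complex.le_def.1 (hpos f fun x => hf x)).1)
  refine ⟨RealRMK.rieszMeasure Λ, ?_, ?_⟩
  · infer_instance
  have key : ∀ f : C(X, ℝ), ∫ x, f x ∂(RealRMK.rieszMeasure Λ) = (ω (e.symm (ofRealMap f))).re := by
    intro f
    exact RealRMK.integral_rieszMeasure Λ ⟨f, HasCompactSupport.of_compactSpace f⟩
  intro a
  have hc : Continuous fun χ : X => χ a := (gelfandTransform ℂ A a).continuous
  let fr : C(X, ℝ) := ⟨fun χ => (χ a).re, Complex.continuous_re.comp hc⟩
  let fi : C(X, ℝ) := ⟨fun χ => (χ a).im, Complex.continuous_im.comp hc⟩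
  have ha : a = e.symm (ofRealMap fr) + Complex.I • e.symm (ofRealMap fi) := by
    rw [← map_smul, ← map_add, StarAlgEquiv.eq_symm_apply]
    ext χ
    simp [ofRealMap, fr, fi, e, mul_comm Complex.I, Complex.re_add_im]
  have hint : Integrable (fun χ : X => χ a) (RealRMK.rieszMeasure Λ) :=
    hc.integrable_of_hasCompactSupport (HasCompactSupport.of_compactSpace _)
  have h1 := key fr
  have h2 := key fi
  simp only [ContinuousMap.coe_mk, fr, fi] at h1 h2
  have h3 := integral_re_add_im hint
  rw [RCLike.re_eq_complex_re, RCLike.im_eq_complex_im] at h3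
  rw [← h3, h1, h2]
  conv_rhs => rw [ha, map_add, map_smul]
  apply Complex.ext <;> simp [him, fr, fi]

end Gelfand

/-! ### Spectral measures of unitary representations of abelian groups -/

section Spectral

variable {V : Type*} [CommGroup V] [TopologicalSpace V] [IsTopologicalGroup V]
  [LocallyCompactSpace V] [T2Space V] [SecondCountableTopology V]
  [MeasurableSpace V] [BorelSpace V]
  {H : Type*} [NormedAddCommGroup H] [InnerProductSpace ℂ H] [CompleteSpace H]

lemma norm_apply_of_mem_unitary {u : H →L[ℂ] H} (hu : u ∈ unitary (H →L[ℂ] H)) (x : H) :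
    ‖u x‖ = ‖x‖ :=
  ContinuousLinearMap.norm_map_of_mem_unitary hu x

lemma integrable_smul_unitary (μ : Measure V) {U : V →* (H →L[ℂ] H)}
    (hU : ∀ v, U v ∈ unitary (H →L[ℂ] H)) (hc : ∀ x, Continuous fun v => U v x)
    {f : V → ℂ} (hf : Integrable f μ) (x : H) : Integrable (fun v => f v • U v x) μ := by
  refine (hf.norm.mul_const ‖x‖).mono' (hf.1.smul (hc x).aestronglyMeasurable) ?_
  filter_upwards with v
  rw [norm_smul, norm_apply_of_mem_unitary (hU v)]

/-- The integrated form `f ↦ ∫ f(v) U(v) dv` of a unitary representation. -/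
def integratedRep (μ : Measure V) {U : V →* (H →L[ℂ] H)}
    (hU : ∀ v, U v ∈ unitary (H →L[ℂ] H)) (hc : ∀ x, Continuous fun v => U v x) :
    Lp ℂ 1 μ →L[ℂ] H →L[ℂ] H :=
  LinearMap.mkContinuous₂
    (LinearMap.mk₂ ℂ (fun (f : Lp ℂ 1 μ) (x : H) => ∫ v, f v • U v x ∂μ)
      (fun f g x => by
        rw [← integral_add (integrable_smul_unitary μ hU hc (L1.integrable_coeFn f) x)
          (integrable_smul_unitary μ hU hc (L1.integrable_coeFn g) x)]
        refine integral_congr_ae ?_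
        filter_upwards [Lp.coeFn_add f g] with v hv
        rw [hv, Pi.add_apply, add_smul])
      (fun c f x => by
        rw [← integral_smul]
        refine integral_congr_ae ?_
        filter_upwards [Lp.coeFn_smul c f] with v hv
        rw [hv, Pi.smul_apply, smul_assoc])
      (fun f x y => by
        rw [← integral_add (integrable_smul_unitary μ hU hc (L1.integrable_coeFn f) x)
          (integrable_smul_unitary μ hU hc (L1.integrable_coeFn f) y)]
        simp only [map_add, smul_add])
      (fun c f x => by
        rw [← integral_smul]
        simp only [map_smul, smul_comm c]))
    1 (fun f x => by
      rw [LinearMap.mk₂_apply, one_mul, L1.norm_eq_integral_norm]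
      refine (norm_integral_le_integral_norm _).trans (le_of_eq ?_)
      rw [← integral_mul_const]
      simp only [norm_smul, norm_apply_of_mem_unitary (hU _)])

lemma integratedRep_apply (μ : Measure V) {U : V →* (H →L[ℂ] H)}
    (hU : ∀ v, U v ∈ unitary (H →L[ℂ] H)) (hc : ∀ x, Continuous fun v => U v x)
    (f : Lp ℂ 1 μ) (x : H) : integratedRep μ hU hc f x = ∫ v, f v • U v x ∂μ := rfl

/-- Left invariance absorbs `U w` into a translate of `f`. Translation is norm continuous in `L¹`,
and this is where continuity of the characters in `exists_spectral_measure` comes from. -/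
lemma mul_integratedRep (μ : Measure V) [μ.IsMulLeftInvariant] {U : V →* (H →L[ℂ] H)}
    (hU : ∀ v, U v ∈ unitary (H →L[ℂ] H)) (hc : ∀ x, Continuous fun v => U v x)
    (f : Lp ℂ 1 μ) (w : V) :
    U w * integratedRep μ hU hc f = integratedRep μ hU hc (DomMulAct.mk w⁻¹ • f) := by
  ext x
  rw [mul_apply_eq_comp, integratedRep_apply, integratedRep_apply,
    ← ContinuousLinearMap.integral_comp_comm _
      (integrable_smul_unitary μ hU hc (L1.integrable_coeFn f) x)]
  rw [← integral_mul_left_eq_self (μ := μ) (fun v => _ • U v x) w]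
  refine integral_congr_ae ?_
  have h := (measurePreserving_mul_left μ w).quasiMeasurePreserving.ae
    (DomMulAct.smul_Lp_ae_eq (DomMulAct.mk w⁻¹) f)
  filter_upwards [h] with v hv
  rw [hv, map_mul, mul_apply_eq_comp, map_smul]
  simp

/-- A normalized indicator function of a small compact neighbourhood of `1` acts as an approximate
identity, by strong continuity of `U` at `1`. -/
lemma exists_integratedRep_near (μ : Measure V) [μ.IsHaarMeasure] {U : V →* (H →L[ℂ] H)}
    (hU : ∀ v, U v ∈ unitary (H →L[ℂ] H)) (hc : ∀ x, Continuous fun v => U v x)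
    (x : H) {ε : ℝ} (hε : 0 < ε) :
    ∃ f : Lp ℂ 1 μ, ‖x - integratedRep μ hU hc f x‖ ≤ ε := by
  have hN : {v | ‖x - U v x‖ < ε} ∈ nhds (1 : V) := by
    refine IsOpen.mem_nhds (isOpen_lt (by have := hc x; fun_prop) continuous_const) ?_
    simpa using hε
  obtain ⟨K, hK, hKN, hKc⟩ := local_compact_nhds hN
  have hKm : MeasurableSet K := hKc.measurableSet
  have hK0 : μ K ≠ 0 := (Measure.measure_pos_of_mem_nhds μ hK).ne'
  have hKt : μ K ≠ ∞ := hKc.measure_lt_top.ne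
  have hKr : 0 < μ.real K := ENNReal.toReal_pos hK0 hKt
  refine ⟨indicatorConstLp 1 hKm hKt ((μ.real K)⁻¹ : ℂ), ?_⟩
  have h1 : integratedRep μ hU hc (indicatorConstLp 1 hKm hKt ((μ.real K)⁻¹ : ℂ)) x =
      ∫ v in K, ((μ.real K)⁻¹ : ℂ) • U v x ∂μ := by
    rw [integratedRep_apply, ← integral_indicator hKm]
    refine integral_congr_ae ?_
    filter_upwards [indicatorConstLp_coeFn (p := 1) (hs := hKm) (hμs := hKt)
      (c := ((μ.real K)⁻¹ : ℂ))] with v hv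
    rw [hv]
    by_cases h : v ∈ K <;> simp [h]
  have h2 : x = ∫ v in K, ((μ.real K)⁻¹ : ℂ) • x ∂μ := by
    rw [setIntegral_const, ← smul_assoc, Complex.real_smul, mul_inv_cancel₀, one_smul]
    exact_mod_cast hKr.ne'
  have hi : IntegrableOn (fun v => ((μ.real K)⁻¹ : ℂ) • U v x) K μ :=
    ContinuousOn.integrableOn_compact hKc (by have := hc x; fun_prop)
  rw [h1]
  nth_rewrite 1 [h2]
  rw [← integral_sub (μ := μ.restrict K) (integrableOn_const (C := ((μ.real K)⁻¹ : ℂ) • x) hKt) hi]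
  have h3 : ∀ v ∈ K, ‖((μ.real K)⁻¹ : ℂ) • x - ((μ.real K)⁻¹ : ℂ) • U v x‖ ≤
      (μ.real K)⁻¹ * ε := by
    intro v hv
    rw [← smul_sub, norm_smul, norm_inv, Complex.norm_real, Real.norm_of_nonneg hKr.le]
    exact mul_le_mul_of_nonneg_left (hKN hv).le (inv_nonneg.2 hKr.le)
  refine (norm_setIntegral_le_of_norm_le_const hKt.lt_top h3).trans (le_of_eq ?_)
  field_simp

/-- The von Neumann algebra generated by a family of operators. -/
abbrev bicommutant (s : Set (H →L[ℂ] H)) : StarSubalgebra ℂ (H →L[ℂ] H) :=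
  StarSubalgebra.centralizer ℂ (StarSubalgebra.centralizer ℂ s : Set (H →L[ℂ] H))

instance (s : Set (H →L[ℂ] H)) : IsClosed (bicommutant s : Set (H →L[ℂ] H)) := by
  rw [StarSubalgebra.coe_centralizer]
  exact Set.isClosed_centralizer _

lemma mem_bicommutant_iff {s : Set (H →L[ℂ] H)} {a : H →L[ℂ] H} :
    a ∈ bicommutant s ↔ ∀ r ∈ StarSubalgebra.centralizer ℂ s, r * a = a * r := by
  rw [StarSubalgebra.mem_centralizer_iff]
  exact ⟨fun h r hr => (h r hr).1, fun h r hr => ⟨h r hr, h _ (star_mem hr)⟩⟩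

/-- The bicommutant of a commuting family of unitaries is a commutative C⋆-algebra. -/
abbrev commCStarAlgebraBicommutant {U : V →* (H →L[ℂ] H)}
    (hU : ∀ v, U v ∈ unitary (H →L[ℂ] H)) : CommCStarAlgebra (bicommutant (Set.range U)) :=
  { StarSubalgebra.cstarAlgebra (bicommutant (Set.range U)) with
    mul_comm := by
      have hstar : ∀ v, star (U v) = U v⁻¹ := fun v => by
        rw [eq_comm, ← mul_one (U v⁻¹), ← (Unitary.mem_iff.1 (hU v)).2, ← mul_assoc, ← map_mul]
        simp
      rintro ⟨a, ha⟩ ⟨b, hb⟩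
      rw [mem_bicommutant_iff] at ha hb
      -- The `U w` commute, so they lie in their own commutant. Every element of the bicommutant
      -- therefore commutes with them, lies in the commutant itself, and so commutes with the whole
      -- bicommutant.
      have hr : ∀ w, U w ∈ StarSubalgebra.centralizer ℂ (Set.range U) := by
        intro w
        rw [StarSubalgebra.mem_centralizer_iff]
        rintro _ ⟨v, rfl⟩
        rw [hstar, ← map_mul, ← map_mul, ← map_mul, ← map_mul, mul_comm v, mul_comm v⁻¹]
        exact ⟨rfl, rfl⟩
      refine Subtype.ext (hb a ?_)
      rw [StarSubalgebra.mem_centralizer_iff]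
      rintro _ ⟨v, rfl⟩
      rw [hstar]
      exact ⟨ha _ (hr v), ha _ (hr v⁻¹)⟩ }

lemma apply_mem_bicommutant (U : V →* (H →L[ℂ] H)) (v : V) :
    U v ∈ bicommutant (Set.range U) := by
  rw [mem_bicommutant_iff]
  intro r hr
  exact ((StarSubalgebra.mem_centralizer_iff ℂ).1 hr _ ⟨v, rfl⟩).1.symm

lemma integratedRep_mem_bicommutant (μ : Measure V) {U : V →* (H →L[ℂ] H)}
    (hU : ∀ v, U v ∈ unitary (H →L[ℂ] H)) (hc : ∀ x, Continuous fun v => U v x)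
    (f : Lp ℂ 1 μ) : integratedRep μ hU hc f ∈ bicommutant (Set.range U) := by
  rw [mem_bicommutant_iff]
  intro r hr
  ext x
  rw [mul_apply_eq_comp, mul_apply_eq_comp, integratedRep_apply, integratedRep_apply,
    ← ContinuousLinearMap.integral_comp_comm _
      (integrable_smul_unitary μ hU hc (L1.integrable_coeFn f) x)]
  congr 1
  ext v
  rw [map_smul, ← mul_apply_eq_comp, ← mul_apply_eq_comp,
    ((StarSubalgebra.mem_centralizer_iff ℂ).1 hr _ ⟨v, rfl⟩).1]

/-- The vector state of `x` on the commutative bicommutant of `U` is a measure on the characters of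
that algebra. A character `χ` that does not kill the integrated form restricts to a continuous
character `v ↦ χ (U v)` of `V`, and the measure is pushed forward along this restriction. -/
theorem exists_spectral_measure [MeasurableSpace (PontryaginDual V)]
    [BorelSpace (PontryaginDual V)] (U : V →* (H →L[ℂ] H))
    (hU : ∀ v, U v ∈ unitary (H →L[ℂ] H)) (hc : ∀ x, Continuous fun v => U v x) (x : H) :
    ∃ ν : Measure (PontryaginDual V), IsFiniteMeasure ν ∧
      ∀ v, ∫ ξ, (ξ v : ℂ) ∂ν = inner ℂ x (U v x) := by
  let μ : Measure V := Measure.haar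
  let _ : CommCStarAlgebra (bicommutant (Set.range U)) := commCStarAlgebraBicommutant hU
  have : Fact ((1 : ℝ≥0∞) ≠ ∞) := ⟨ENNReal.one_ne_top⟩
  let A : Type _ := bicommutant (Set.range U)
  let X : Type _ := characterSpace ℂ A
  borelize X
  let u : V → A := fun v => ⟨U v, apply_mem_bicommutant U v⟩
  let W : Lp ℂ 1 μ → A := fun f => ⟨integratedRep μ hU hc f, integratedRep_mem_bicommutant μ hU hc f⟩
  have hWc : Continuous W := (integratedRep μ hU hc).continuous.subtype_mk _
  have huW : ∀ v f, u v * W f = W (DomMulAct.mk v⁻¹ • f) := fun v f =>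
    Subtype.ext (mul_integratedRep μ hU hc f v)
  have hu1 : u 1 = 1 := Subtype.ext (map_one U)
  have humul : ∀ v w, u (v * w) = u v * u w := fun v w => Subtype.ext (map_mul U v w)
  have hev : Continuous fun p : X × A => p.1 p.2 := by
    have h1 : Continuous fun a : A => gelfandTransform ℂ A a :=
      (gelfandTransform_isometry A).continuous
    exact (h1.comp continuous_snd).eval continuous_fst
  have hnorm : ∀ (χ : X) v, ‖χ (u v)‖ = 1 := by
    intro χ v
    have h1 : star (u v) * u v = 1 := Subtype.ext (Unitary.mem_iff.1 (hU v)).1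
    have h2 := congrArg χ h1
    rw [map_mul, map_star, map_one, RCLike.star_def, ← Complex.normSq_eq_conj_mul_self] at h2
    rw [← sq_eq_sq₀ (norm_nonneg _) zero_le_one, ← Complex.normSq_eq_norm_sq, one_pow]
    exact_mod_cast h2
  let O : Set X := {χ | ∃ f, χ (W f) ≠ 0}
  have hO : IsOpen O := by
    have : O = ⋃ f, {χ : X | χ (W f) ≠ 0} := by ext; simp [O]
    rw [this]
    exact isOpen_iUnion fun f => isOpen_ne_fun (hev.comp (Continuous.prodMk_left _)) continuous_const
  -- Near a point with `χ (W f) ≠ 0` one has `χ (u v) = χ (u v * W f) / χ (W f)`, and the numerator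
  -- is jointly continuous because translation is continuous in `L¹`.
  have hjoint : Continuous fun p : O × V => (p.1 : X) (u p.2) := by
    rw [continuous_iff_continuousAt]
    rintro ⟨⟨χ, f, hf⟩, v⟩
    have h1 : Continuous fun p : O × V => (p.1 : X) (W f) :=
      hev.comp ((continuous_subtype_val.comp continuous_fst).prodMk continuous_const)
    have h2 : Continuous fun p : O × V => (p.1 : X) (W (DomMulAct.mk p.2⁻¹ • f)) := by
      refine hev.comp ((continuous_subtype_val.comp continuous_fst).prodMk (hWc.comp ?_))
      have h3 : Continuous fun p : O × V => DomMulAct.mk p.2⁻¹ :=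
        (DomMulAct.continuous_mk).comp continuous_snd.inv
      exact h3.smul continuous_const
    refine (h2.continuousAt.div h1.continuousAt hf).congr ?_
    filter_upwards [h1.continuousAt.eventually_ne hf] with p hp
    change (p.1 : X) (W (DomMulAct.mk p.2⁻¹ • f)) / (p.1 : X) (W f) = _
    rw [← huW, map_mul, mul_div_cancel_right₀ _ hp]
  let c : O → PontryaginDual V := fun χ =>
    ({ toFun := fun v => ⟨(χ : X) (u v), mem_sphere_zero_iff_norm.2 (hnorm _ v)⟩
       map_one' := Subtype.ext (by simp [hu1])
       map_mul' := fun v w => Subtype.ext (by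
         change (χ : X) (u (v * w)) = (χ : X) (u v) * (χ : X) (u w)
         rw [humul, map_mul])
       continuous_toFun := Continuous.subtype_mk (hjoint.comp (Continuous.prodMk_right χ)) _ } : V →ₜ* Circle)
  have hc' : Continuous c := ContinuousMonoidHom.continuous_of_continuous_uncurry _
    (Continuous.subtype_mk hjoint _)
  classical
  let Φ : X → PontryaginDual V := fun χ => if h : χ ∈ O then c ⟨χ, h⟩ else 1
  have hΦO : ∀ χ ∈ O, ∀ v, (Φ χ v : ℂ) = χ (u v) := by
    intro χ hχ v
    simp only [Φ, dif_pos hχ]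
    rfl
  have hΦ : Measurable Φ := by
    have h1 : ContinuousOn Φ O := by
      rw [continuousOn_iff_continuous_domRestrict]
      convert hc' using 1
      ext1 χ
      simp [Φ]
    have h2 : ContinuousOn Φ Oᶜ :=
      (continuousOn_const (c := (1 : PontryaginDual V))).congr fun χ hχ => by
        simp only [Φ, dif_neg (show χ ∉ O from hχ)]
    have h3 := ContinuousOn.measurable_piecewise h1 h2 hO.measurableSet
    rwa [Set.piecewise_same] at h3
  let ω : A →ₗ[ℂ] ℂ :=
    { toFun := fun a => inner ℂ x ((a : H →L[ℂ] H) x)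
      map_add' := fun a b => inner_add_right x ((a : H →L[ℂ] H) x) ((b : H →L[ℂ] H) x)
      map_smul' := fun r a => inner_smul_right x ((a : H →L[ℂ] H) x) r }
  have hω : ∀ a : A, ω (star a * a) = (‖(a : H →L[ℂ] H) x‖ ^ 2 : ℝ) := by
    intro a
    change inner ℂ x ((star (a : H →L[ℂ] H) * (a : H →L[ℂ] H)) x) = _
    rw [ContinuousLinearMap.star_eq_adjoint, mul_apply_eq_comp,
      ContinuousLinearMap.adjoint_inner_right, inner_self_eq_norm_sq_to_K]
    simp
  obtain ⟨ν, hν, hνω⟩ := exists_measure_characterSpace ω fun a => by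
    rw [hω]; exact Complex.zero_le_real.2 (sq_nonneg _)
  -- Off `O` every `χ (1 - W f)` equals `1`, so the measure of `Oᶜ` is at most `‖x - W f x‖ ^ 2`,
  -- which an approximate identity makes arbitrarily small.
  have hnull : ν Oᶜ = 0 := by
    have h1 : ∀ ε : ℝ, 0 < ε → ν.real Oᶜ ≤ ε ^ 2 := by
      intro ε hε
      obtain ⟨f, hf⟩ := exists_integratedRep_near μ hU hc x hε
      let a : A := 1 - W f
      have h2 : ∫ χ, χ (star a * a) ∂ν = (‖(a : H →L[ℂ] H) x‖ ^ 2 : ℝ) := by rw [hνω, hω]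
      have h3 : ∀ χ : X, χ (star a * a) = ((‖χ a‖ ^ 2 : ℝ) : ℂ) := by
        intro χ
        rw [map_mul, map_star, RCLike.star_def, ← Complex.normSq_eq_conj_mul_self,
          Complex.normSq_eq_norm_sq]
      simp only [h3] at h2
      rw [integral_complex_ofReal] at h2
      have h4 : ∫ χ : X, ‖χ a‖ ^ 2 ∂ν = ‖(a : H →L[ℂ] H) x‖ ^ 2 := by exact_mod_cast h2
      have hca : Continuous fun χ : X => ‖χ a‖ ^ 2 :=
        ((hev.comp (Continuous.prodMk_left a)).norm.pow 2)
      have h5 : ∫ χ in Oᶜ, ‖χ a‖ ^ 2 ∂ν ≤ ∫ χ : X, ‖χ a‖ ^ 2 ∂ν :=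
        setIntegral_le_integral
          (hca.integrable_of_hasCompactSupport (HasCompactSupport.of_compactSpace _))
          (Filter.Eventually.of_forall fun χ => sq_nonneg _)
      have h6 : ∫ χ in Oᶜ, ‖χ a‖ ^ 2 ∂ν = ν.real Oᶜ := by
        rw [setIntegral_congr_fun (g := fun _ => (1 : ℝ)) hO.measurableSet.compl]
        · simp
        · intro χ hχ
          have h7 : χ (W f) = 0 := by
            by_contra h8
            exact hχ ⟨f, h8⟩
          simp [a, h7]
      rw [← h6]
      refine h5.trans ?_
      rw [h4]
      refine pow_le_pow_left₀ (norm_nonneg _) ?_ 2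
      exact hf
    have h2 : ν.real Oᶜ ≤ 0 := by
      refine le_of_forall_pos_le_add fun ε hε => ?_
      have := h1 (√ε) (Real.sqrt_pos.2 hε)
      rw [Real.sq_sqrt hε.le] at this
      linarith
    have h3 : ν.real Oᶜ = 0 := le_antisymm h2 measureReal_nonneg
    exact (measureReal_eq_zero_iff).1 h3
  refine ⟨ν.map Φ, inferInstance, fun v => ?_⟩
  rw [integral_map hΦ.aemeasurable
    (continuous_eval_coe v).aestronglyMeasurable]
  have h1 : ∀ᵐ χ ∂ν, χ ∈ O := by
    rw [ae_iff]; exact hnull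
  rw [integral_congr_ae (g := fun χ : X => χ (u v)) (by
    filter_upwards [h1] with χ hχ using hΦO χ hχ v), hνω]
  rfl

end Spectral

lemma mem_unitary_of_norm_map {H : Type*} [NormedAddCommGroup H] [InnerProductSpace ℂ H]
    [CompleteSpace H] {T R : H →L[ℂ] H} (hT : ∀ x, ‖T x‖ = ‖x‖) (hR : T * R = 1) :
    T ∈ unitary (H →L[ℂ] H) := by
  have h1 : star T * T = 1 := by
    rw [ContinuousLinearMap.star_eq_adjoint]
    exact (ContinuousLinearMap.norm_map_iff_adjoint_comp_self T).1 hT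
  refine Unitary.mem_iff.2 ⟨h1, ?_⟩
  calc T * star T = T * (star T * (T * R)) := by rw [hR, mul_one]
    _ = 1 := by rw [← mul_assoc (star T), h1, one_mul, hR]

/-! ### The Plancherel theorem -/

section Plancherel

variable {V : Type*} [CommGroup V] [TopologicalSpace V] [IsTopologicalGroup V]
  [LocallyCompactSpace V] [T2Space V] [SecondCountableTopology V]
  [MeasurableSpace V] [BorelSpace V]

/-- Bounded measurable integrable functions. -/
structure IsBddIntegrable {X : Type*} [MeasurableSpace X] (μ : Measure X) (h : X → ℂ) : Prop where
  measurable : Measurable h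
  bdd : ∃ C : ℝ, ∀ x, ‖h x‖ ≤ C
  integrable : Integrable h μ

lemma IsBddIntegrable.memLp {X : Type*} [MeasurableSpace X] {μ : Measure X} {h : X → ℂ}
    (hh : IsBddIntegrable μ h) : MemLp h 2 μ := by
  obtain ⟨C, hC⟩ := hh.bdd
  rw [memLp_two_iff_integrable_sq_norm hh.measurable.aestronglyMeasurable]
  refine (hh.integrable.norm.const_mul C).mono'
    (hh.measurable.norm.pow_const 2).aestronglyMeasurable ?_
  filter_upwards with x
  rw [Real.norm_of_nonneg (sq_nonneg _), sq]
  exact mul_le_mul_of_nonneg_right (hC x) (norm_nonneg _)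

/-- The translation representation on `L²(V)`. -/
def translation (μ : Measure V) [μ.IsHaarMeasure] : V →* (Lp ℂ 2 μ →L[ℂ] Lp ℂ 2 μ) where
  toFun v := LinearMap.mkContinuous
    { toFun := fun f => DomMulAct.mk v⁻¹ • f
      map_add' := fun f g => smul_add _ f g
      map_smul' := fun c f => smul_comm _ c f } 1
    (fun f => by simp only [LinearMap.coe_mk, AddHom.coe_mk, one_mul]; exact (DomMulAct.norm_smul_Lp _ f).le)
  map_one' := by ext1 f; change DomMulAct.mk (1 : V)⁻¹ • f = f; simp
  map_mul' v w := by
    ext1 f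
    change DomMulAct.mk (v * w)⁻¹ • f = DomMulAct.mk v⁻¹ • DomMulAct.mk w⁻¹ • f
    rw [← mul_smul, ← DomMulAct.mk_mul, mul_inv_rev]

lemma translation_apply (μ : Measure V) [μ.IsHaarMeasure] (v : V) (f : Lp ℂ 2 μ) :
    translation μ v f = DomMulAct.mk v⁻¹ • f := rfl

lemma translation_mem_unitary (μ : Measure V) [μ.IsHaarMeasure] (v : V) :
    translation μ v ∈ unitary (Lp ℂ 2 μ →L[ℂ] Lp ℂ 2 μ) := by
  refine mem_unitary_of_norm_map (R := translation μ v⁻¹) (fun f => ?_) ?_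
  · exact DomMulAct.norm_smul_Lp _ f
  · rw [← map_mul, mul_inv_cancel, map_one]

lemma continuous_translation (μ : Measure V) [μ.IsHaarMeasure] (f : Lp ℂ 2 μ) :
    Continuous fun v => translation μ v f := by
  have : Fact ((2 : ℝ≥0∞) ≠ ∞) := ⟨ENNReal.ofNat_ne_top⟩
  have h3 : Continuous fun v : V => DomMulAct.mk v⁻¹ :=
    (DomMulAct.continuous_mk).comp continuous_inv
  exact h3.smul continuous_const

variable [MeasurableSpace (PontryaginDual V)] [BorelSpace (PontryaginDual V)]

/-- `ν` is the spectral measure of `h` with respect to the translation representation. -/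
structure IsSpectralMeasure (μ : Measure V) (h : V → ℂ) (ν : Measure (PontryaginDual V)) :
    Prop where
  isFinite : IsFiniteMeasure ν
  integral_eval : ∀ v, ∫ ξ, (ξ v : ℂ) ∂ν = ∫ x, starRingEnd ℂ (h x) * h (v⁻¹ * x) ∂μ

/-- This is the spectral measure of the vector `h` under translation. It stands in for `‖ĥ‖² dξ`
before Plancherel is available. -/
lemma exists_isSpectralMeasure {μ : Measure V} [μ.IsHaarMeasure] {h : V → ℂ}
    (hh : IsBddIntegrable μ h) : ∃ ν, IsSpectralMeasure μ h ν := by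
  obtain ⟨ν, h1, h2⟩ := exists_spectral_measure (translation μ) (translation_mem_unitary μ)
    (continuous_translation μ) (hh.memLp.toLp h)
  refine ⟨ν, h1, fun v => ?_⟩
  rw [h2, L2.inner_def]
  refine integral_congr_ae ?_
  rw [translation_apply, DomMulAct.mk_smul_toLp]
  have h3 : MemLp (fun x => h (v⁻¹ • x)) 2 μ :=
    hh.memLp.comp_measurePreserving (measurePreserving_smul v⁻¹ μ)
  filter_upwards [hh.memLp.coeFn_toLp, h3.coeFn_toLp] with x hx hx'
  rw [hx, hx', RCLike.inner_apply, mul_comm, smul_eq_mul]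

lemma IsSpectralMeasure.measure_univ {μ : Measure V} {h : V → ℂ}
    (hh : IsBddIntegrable μ h) {ν : Measure (PontryaginDual V)} (hν : IsSpectralMeasure μ h ν) :
    ν Set.univ = ∫⁻ x, ‖h x‖ₑ ^ 2 ∂μ := by
  have := hν.isFinite
  have h1 := hν.integral_eval 1
  simp only [map_one, Circle.coe_one, integral_const, inv_one, one_mul,
    Complex.conj_mul'] at h1
  have h2 : ν.real Set.univ = ∫ x, ‖h x‖ ^ 2 ∂μ := by
    have h3 : ∫ x, ((‖h x‖ : ℂ) ^ 2) ∂μ = ((∫ x, ‖h x‖ ^ 2 ∂μ : ℝ) : ℂ) := by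
      rw [← integral_complex_ofReal]; simp
    rw [h3] at h1
    have h4 := congrArg Complex.re h1
    simpa using h4
  rw [← ofReal_measureReal (h := measure_ne_top _ _), h2, ofReal_integral_eq_lintegral_ofReal
    ((memLp_two_iff_integrable_sq_norm hh.measurable.aestronglyMeasurable).1 hh.memLp)
    (Filter.Eventually.of_forall fun x => sq_nonneg _)]
  refine lintegral_congr fun x => ?_
  rw [ENNReal.ofReal_pow (norm_nonneg _), ofReal_norm]

/-- The Fourier transform on `V`. -/
def fourier (μ : Measure V) (h : V → ℂ) (ξ : PontryaginDual V) : ℂ := ∫ x, h x * ξ x ∂μ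

lemma integrable_mul_eval {μ : Measure V} {h : V → ℂ} (hh : Integrable h μ)
    (ξ : PontryaginDual V) : Integrable (fun x => h x * ξ x) μ := by
  refine hh.mul_bdd (c := 1)
    ((continuous_subtype_val.comp (map_continuous ξ)).aestronglyMeasurable) ?_
  filter_upwards with x using (Circle.norm_coe _).le

lemma norm_fourier_le (μ : Measure V) (h : V → ℂ) (ξ : PontryaginDual V) :
    ‖fourier μ h ξ‖ ≤ ∫ x, ‖h x‖ ∂μ := by
  refine (norm_integral_le_integral_norm _).trans (le_of_eq ?_)
  simp only [norm_mul, Circle.norm_coe, mul_one]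

lemma continuous_fourier {μ : Measure V} {h : V → ℂ} (hh : Integrable h μ) :
    Continuous (fourier μ h) := by
  refine continuous_of_dominated (bound := fun x => ‖h x‖)
    (fun ξ => (integrable_mul_eval hh ξ).1) (fun ξ => ?_) hh.norm ?_
  · filter_upwards with x
    rw [norm_mul, Circle.norm_coe, mul_one]
  · filter_upwards with x
    exact continuous_const.mul (continuous_eval_coe x)

/-- The symmetrized correlation `∫∫ conj f(s) conj h(x) (∫ f(t) h(s w x t⁻¹) dt) ds dx`. -/
def correlation (μ : Measure V) (f h : V → ℂ) (w : V) : ℂ :=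
  ∫ s, ∫ x, starRingEnd ℂ (f s) * starRingEnd ℂ (h x) * ∫ t, f t * h (s * w * x * t⁻¹) ∂μ ∂μ ∂μ

lemma integral_mul_div_comm {μ : Measure V} [μ.IsHaarMeasure] (f h : V → ℂ) (y : V) :
    ∫ t, f t * h (y * t⁻¹) ∂μ = ∫ t, h t * f (y * t⁻¹) ∂μ := by
  rw [← integral_div_left_eq_self _ μ y]
  refine integral_congr_ae (Filter.Eventually.of_forall fun t => ?_)
  simp only [div_eq_mul_inv, mul_inv_rev, inv_inv]
  rw [mul_comm, mul_left_comm y t y⁻¹, mul_inv_cancel, mul_one]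

lemma integrable_conj {X : Type*} [MeasurableSpace X] {μ : Measure X} {f : X → ℂ}
    (hf : Integrable f μ) : Integrable (fun x => starRingEnd ℂ (f x)) μ :=
  (RCLike.conjLIE (K := ℂ)).toContinuousLinearEquiv.integrable_comp_iff.2 hf

/-- Exchanging the two outer integrals and using commutativity of convolution interchanges `f` and
`h`. This symmetry is what compares two spectral measures. -/
lemma correlation_comm {μ : Measure V} [μ.IsHaarMeasure] {f h : V → ℂ}
    (hf : IsBddIntegrable μ f) (hh : IsBddIntegrable μ h) (w : V) :
    correlation μ f h w = correlation μ h f w := by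
  obtain ⟨C, hC⟩ := hh.bdd
  unfold correlation
  rw [integral_integral_swap]
  · refine integral_congr_ae (Filter.Eventually.of_forall fun x => ?_)
    refine integral_congr_ae (Filter.Eventually.of_forall fun s => ?_)
    simp only
    rw [integral_mul_div_comm, mul_comm (starRingEnd ℂ (f s)), mul_right_comm s w x,
      mul_right_comm x w s, mul_comm s x]
  · have h1 : StronglyMeasurable fun p : V × V => ∫ t, f t * h (p.1 * w * p.2 * t⁻¹) ∂μ := by
      refine StronglyMeasurable.integral_prod_right'
        (f := fun q : (V × V) × V => f q.2 * h (q.1.1 * w * q.1.2 * q.2⁻¹)) ?_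
      refine Measurable.stronglyMeasurable ?_
      exact (hf.measurable.comp measurable_snd).mul (hh.measurable.comp (by fun_prop))
    refine Integrable.mul_bdd (c := ∫ t, ‖f t‖ * C ∂μ) ?_ h1.aestronglyMeasurable ?_
    · exact (integrable_conj hf.integrable).mul_prod (integrable_conj hh.integrable)
    · filter_upwards with p
      refine norm_integral_le_of_norm_le (hf.integrable.norm.mul_const C) ?_
      filter_upwards with t
      rw [norm_mul]
      exact mul_le_mul_of_nonneg_left (hC _) (norm_nonneg _)

/-- The Fourier transform of `‖f̂‖² ν_h` is a correlation. -/
lemma IsSpectralMeasure.integral_eval_mul_normSq {μ : Measure V} [μ.IsHaarMeasure] {f h : V → ℂ}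
    (hf : IsBddIntegrable μ f) (hh : IsBddIntegrable μ h) {ν : Measure (PontryaginDual V)}
    (hν : IsSpectralMeasure μ h ν) (v : V) :
    ∫ ξ, ((‖fourier μ f ξ‖ ^ 2 : ℝ) : ℂ) * ξ v ∂ν = correlation μ f h v⁻¹ := by
  have := hν.isFinite
  obtain ⟨C, hC⟩ := hh.bdd
  have hfc := integrable_conj hf.integrable
  have hhc := integrable_conj hh.integrable
  -- Expanding `‖f̂(ξ)‖²` as a double integral leaves the single character value of `ξ` at `s⁻¹ * t
  -- * v`, whose integral against `ν` is known.
  have h1 : ∀ ξ : PontryaginDual V, ((‖fourier μ f ξ‖ ^ 2 : ℝ) : ℂ) * ξ v =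
      ∫ p : V × V, starRingEnd ℂ (f p.1) * f p.2 * ξ (p.1⁻¹ * p.2 * v) ∂(μ.prod μ) := by
    intro ξ
    have h2 : starRingEnd ℂ (fourier μ f ξ) = ∫ s, starRingEnd ℂ (f s * ξ s) ∂μ := by
      rw [integral_conj]; rfl
    rw [Complex.ofReal_pow, ← Complex.conj_mul', h2, fourier, ← integral_prod_mul,
      ← integral_mul_const]
    refine integral_congr_ae (Filter.Eventually.of_forall fun p => ?_)
    simp only [map_mul, map_inv, Circle.coe_mul, Circle.coe_inv_eq_conj]
    ring
  simp only [h1]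
  rw [integral_integral_swap]
  · have h2 : ∀ p : V × V, ∫ ξ, starRingEnd ℂ (f p.1) * f p.2 * (ξ (p.1⁻¹ * p.2 * v) : ℂ) ∂ν =
        starRingEnd ℂ (f p.1) * f p.2 * ∫ ξ, (ξ (p.1⁻¹ * p.2 * v) : ℂ) ∂ν := fun p =>
      integral_const_mul _ _
    simp only [h2]
    have h3 : StronglyMeasurable fun w : V => ∫ ξ, (ξ w : ℂ) ∂ν := by
      refine StronglyMeasurable.integral_prod_right'
        (f := fun q : V × PontryaginDual V => (q.2 q.1 : ℂ)) ?_
      exact (continuous_dual_eval_coe.comp continuous_swap).stronglyMeasurable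
    rw [integral_prod]
    · unfold correlation
      refine integral_congr_ae (Filter.Eventually.of_forall fun s => ?_)
      simp only [hν.integral_eval, ← integral_const_mul]
      rw [integral_integral_swap]
      · refine integral_congr_ae (Filter.Eventually.of_forall fun x => ?_)
        refine integral_congr_ae (Filter.Eventually.of_forall fun t => ?_)
        simp only
        rw [show (s⁻¹ * t * v)⁻¹ * x = s * v⁻¹ * x * t⁻¹ by
          simp only [mul_inv_rev, inv_inv, mul_comm, mul_left_comm, mul_assoc]]
        ring
      · have h4 : Integrable (fun p : V × V => (starRingEnd ℂ (f s) * f p.1) *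
            starRingEnd ℂ (h p.2)) (μ.prod μ) :=
          (hf.integrable.const_mul (starRingEnd ℂ (f s))).mul_prod hhc
        refine (h4.mul_bdd (c := C) (g := fun p : V × V => h ((s⁻¹ * p.1 * v)⁻¹ * p.2))
          (hh.measurable.comp (by fun_prop)).aestronglyMeasurable
          (Filter.Eventually.of_forall fun p => hC _)).congr ?_
        filter_upwards with p
        simp only [Function.uncurry]
        ring
    · refine Integrable.mul_bdd (c := ν.real Set.univ) (hfc.mul_prod hf.integrable)
        (h3.comp_measurable (by fun_prop)).aestronglyMeasurable ?_
      filter_upwards with p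
      refine (norm_integral_le_of_norm_le_const (C := 1) ?_).trans (by rw [one_mul])
      filter_upwards with ξ using (Circle.norm_coe _).le
  · have h4 : Integrable (fun q : PontryaginDual V × (V × V) => (1 : ℂ) *
        (starRingEnd ℂ (f q.2.1) * f q.2.2)) (ν.prod (μ.prod μ)) :=
      (integrable_const (1 : ℂ)).mul_prod (hfc.mul_prod hf.integrable)
    refine (h4.mul_bdd (c := 1)
      (g := fun q : PontryaginDual V × (V × V) => (q.1 (q.2.1⁻¹ * q.2.2 * v) : ℂ)) ?_ ?_).congr ?_
    · exact (continuous_dual_eval_coe.comp (continuous_fst.prodMk (by fun_prop))).aestronglyMeasurable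
    · filter_upwards with q using (Circle.norm_coe _).le
    · filter_upwards with q
      simp only [Function.uncurry, one_mul]

end Plancherel

/-! ### Symmetry of spectral measures and the Plancherel formula -/

section Plancherel

variable {V : Type*} [CommGroup V] [TopologicalSpace V] [IsTopologicalGroup V]
  [LocallyCompactSpace V] [T2Space V] [SecondCountableTopology V]
  [MeasurableSpace V] [BorelSpace V]
  [MeasurableSpace (PontryaginDual V)] [BorelSpace (PontryaginDual V)]
  {μ : Measure V} [μ.IsHaarMeasure]

lemma measurable_enorm_fourier_sq {h : V → ℂ} (hh : Integrable h μ) :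
    Measurable fun ξ => ‖fourier μ h ξ‖ₑ ^ 2 :=
  (continuous_fourier hh).measurable.enorm.pow_const 2

/-- The Fourier transforms of the two measures are correlations, equal by symmetry. Heuristically
both measures are `‖f̂‖² ‖ĥ‖² dξ`. -/
lemma IsSpectralMeasure.withDensity_comm {f h : V → ℂ}
    (hf : IsBddIntegrable μ f) (hh : IsBddIntegrable μ h) {νf νh : Measure (PontryaginDual V)}
    (hνf : IsSpectralMeasure μ f νf) (hνh : IsSpectralMeasure μ h νh) :
    νh.withDensity (fun ξ => ‖fourier μ f ξ‖ₑ ^ 2) =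
      νf.withDensity (fun ξ => ‖fourier μ h ξ‖ₑ ^ 2) := by
  have hfin : ∀ {k : V → ℂ}, IsBddIntegrable μ k → ∀ ν : Measure (PontryaginDual V),
      IsFiniteMeasure ν → IsFiniteMeasure (ν.withDensity (fun ξ => ‖fourier μ k ξ‖ₑ ^ 2)) := by
    intro k hk ν hν
    refine isFiniteMeasure_withDensity (ne_of_lt ?_)
    refine (lintegral_mono (g := fun _ => ENNReal.ofReal (∫ x, ‖k x‖ ∂μ) ^ 2) fun ξ => ?_).trans_lt
      (by rw [lintegral_const]; finiteness)
    refine pow_le_pow_left' ?_ 2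
    rw [← ofReal_norm]
    exact ENNReal.ofReal_le_ofReal (norm_fourier_le μ k ξ)
  have h1 := hfin hf νh hνh.isFinite
  have h2 := hfin hh νf hνf.isFinite
  have key : ∀ {k : V → ℂ}, IsBddIntegrable μ k → ∀ (ν : Measure (PontryaginDual V)) (v : V),
      ∫ ξ, (ξ v : ℂ) ∂(ν.withDensity (fun ξ => ‖fourier μ k ξ‖ₑ ^ 2)) =
        ∫ ξ, ((‖fourier μ k ξ‖ ^ 2 : ℝ) : ℂ) * ξ v ∂ν := by
    intro k hk ν v
    rw [integral_withDensity_eq_integral_toReal_smul (measurable_enorm_fourier_sq hk.integrable)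
      (Filter.Eventually.of_forall fun ξ => by finiteness)]
    refine integral_congr_ae (Filter.Eventually.of_forall fun ξ => ?_)
    simp only [ENNReal.toReal_pow, toReal_enorm, Complex.real_smul]
  refine measure_dual_ext fun v => ?_
  rw [key hf, key hh, hνh.integral_eval_mul_normSq hf hh, hνf.integral_eval_mul_normSq hh hf,
    correlation_comm hf hh]

lemma IsBddIntegrable.mul_eval {h : V → ℂ} (hh : IsBddIntegrable μ h) (χ : PontryaginDual V) :
    IsBddIntegrable μ (fun x => h x * χ x) := by
  obtain ⟨C, hC⟩ := hh.bdd
  refine ⟨hh.measurable.mul (continuous_subtype_val.comp (map_continuous χ)).measurable,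
    ⟨C, fun x => ?_⟩, integrable_mul_eval hh.integrable χ⟩
  rw [norm_mul, Circle.norm_coe, mul_one]
  exact hC x

lemma fourier_mul_eval (h : V → ℂ) (χ ξ : PontryaginDual V) :
    fourier μ (fun x => h x * χ x) ξ = fourier μ h (ξ * χ) := by
  refine integral_congr_ae (Filter.Eventually.of_forall fun x => ?_)
  simp only
  rw [mul_assoc, ← Circle.coe_mul, mul_comm (χ x)]
  rfl

/-- Modulation by `χ` multiplies the correlation of `h` by the inverse of `χ v`, which amounts to a
translation on the dual. -/
lemma IsSpectralMeasure.mul_eval {h : V → ℂ} {ν : Measure (PontryaginDual V)}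
    (hν : IsSpectralMeasure μ h ν) (χ : PontryaginDual V) :
    IsSpectralMeasure μ (fun x => h x * χ x) (ν.map (· * χ⁻¹)) := by
  have := hν.isFinite
  refine ⟨inferInstance, fun v => ?_⟩
  rw [integral_map (measurable_mul_const _).aemeasurable
    (continuous_eval_coe v).aestronglyMeasurable]
  have h1 : ∀ ξ : PontryaginDual V, (((ξ * χ⁻¹) v : Circle) : ℂ) = ξ v * (χ v)⁻¹ := fun ξ => rfl
  simp only [h1]
  rw [integral_mul_const, hν.integral_eval, ← integral_mul_const]
  refine integral_congr_ae (Filter.Eventually.of_forall fun x => ?_)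
  simp only [map_mul, map_inv, Circle.coe_mul, Circle.coe_inv]
  have h2 : starRingEnd ℂ (χ x : ℂ) * χ x = 1 := by
    rw [← Complex.normSq_eq_conj_mul_self, Circle.normSq_coe]; simp
  linear_combination (-(starRingEnd ℂ (h x)) * h (v⁻¹ * x) * (χ v : ℂ)⁻¹) * h2

/-- Apply `withDensity_comm` to the modulations of `k` by all `χ`, which translate both `k̂` and
`νk`, and integrate over `χ`. Tonelli and invariance of Haar measure separate the factors. -/
lemma IsSpectralMeasure.lintegral_comm {k h : V → ℂ}
    (hk : IsBddIntegrable μ k) (hh : IsBddIntegrable μ h) {νk νh : Measure (PontryaginDual V)}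
    (hνk : IsSpectralMeasure μ k νk) (hνh : IsSpectralMeasure μ h νh)
    (μ' : Measure (PontryaginDual V)) [μ'.IsHaarMeasure] {φ : PontryaginDual V → ℝ≥0∞}
    (hφ : Measurable φ) :
    (∫⁻ ξ, ‖fourier μ k ξ‖ₑ ^ 2 ∂μ') * ∫⁻ ξ, φ ξ ∂νh =
      νk Set.univ * ∫⁻ ξ, ‖fourier μ h ξ‖ₑ ^ 2 * φ ξ ∂μ' := by
  have := hνk.isFinite
  have := hνh.isFinite
  have hmk := measurable_enorm_fourier_sq hk.integrable
  have hmh := measurable_enorm_fourier_sq hh.integrable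
  have h1 : ∀ χ : PontryaginDual V, ∫⁻ ξ, ‖fourier μ k (ξ * χ)‖ₑ ^ 2 * φ ξ ∂νh =
      ∫⁻ ξ, ‖fourier μ h (ξ * χ⁻¹)‖ₑ ^ 2 * φ (ξ * χ⁻¹) ∂νk := by
    intro χ
    have h2 := (hνk.mul_eval χ).withDensity_comm (hk.mul_eval χ) hh hνh
    have h3 := congrArg (fun ν => ∫⁻ ξ, φ ξ ∂ν) h2
    rw [lintegral_withDensity_eq_lintegral_mul _
        (measurable_enorm_fourier_sq (hk.mul_eval χ).integrable) hφ,
      lintegral_withDensity_eq_lintegral_mul _ hmh hφ,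
      lintegral_map (hmh.mul hφ) (measurable_mul_const _)] at h3
    simpa only [fourier_mul_eval, Pi.mul_apply] using h3
  have h2 : ∫⁻ χ, ∫⁻ ξ, ‖fourier μ k (ξ * χ)‖ₑ ^ 2 * φ ξ ∂νh ∂μ' =
      ∫⁻ χ, ∫⁻ ξ, ‖fourier μ h (ξ * χ⁻¹)‖ₑ ^ 2 * φ (ξ * χ⁻¹) ∂νk ∂μ' :=
    lintegral_congr h1
  have m1 : AEMeasurable (Function.uncurry fun χ ξ => ‖fourier μ k (ξ * χ)‖ₑ ^ 2 * φ ξ)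
      (μ'.prod νh) :=
    ((hmk.comp (by fun_prop : Measurable fun p : PontryaginDual V × PontryaginDual V =>
      p.2 * p.1)).mul (hφ.comp measurable_snd)).aemeasurable
  have m2 : AEMeasurable (Function.uncurry fun χ ξ =>
      ‖fourier μ h (ξ * χ⁻¹)‖ₑ ^ 2 * φ (ξ * χ⁻¹)) (μ'.prod νk) :=
    ((hmh.mul hφ).comp (by fun_prop : Measurable fun p : PontryaginDual V × PontryaginDual V =>
      p.2 * p.1⁻¹)).aemeasurable
  rw [lintegral_lintegral_swap m1, lintegral_lintegral_swap m2] at h2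
  have h3 : ∀ ξ, ∫⁻ χ, ‖fourier μ k (ξ * χ)‖ₑ ^ 2 * φ ξ ∂μ' =
      (∫⁻ ξ, ‖fourier μ k ξ‖ₑ ^ 2 ∂μ') * φ ξ := by
    intro ξ
    have m3 : Measurable fun χ => ‖fourier μ k (ξ * χ)‖ₑ ^ 2 := hmk.comp (measurable_const_mul ξ)
    rw [lintegral_mul_const _ m3,
      lintegral_mul_left_eq_self (fun χ => ‖fourier μ k χ‖ₑ ^ 2) ξ]
  have h4 : ∀ ξ, ∫⁻ χ, ‖fourier μ h (ξ * χ⁻¹)‖ₑ ^ 2 * φ (ξ * χ⁻¹) ∂μ' =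
      ∫⁻ ξ, ‖fourier μ h ξ‖ₑ ^ 2 * φ ξ ∂μ' := by
    intro ξ
    simp only [← div_eq_mul_inv]
    exact lintegral_div_left_eq_self (μ := μ') (fun χ => ‖fourier μ h χ‖ₑ ^ 2 * φ χ) ξ
  simp only [h3, h4] at h2
  rwa [lintegral_const_mul _ hφ, lintegral_const, mul_comm _ (νk Set.univ)] at h2

/-- **Plancherel theorem** for second countable locally compact abelian groups. -/
theorem exists_plancherel (μ : Measure V) [μ.IsHaarMeasure]
    (μ' : Measure (PontryaginDual V)) [μ'.IsHaarMeasure] :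
    ∃ c : ℝ≥0∞, c ≠ 0 ∧ c ≠ ∞ ∧ ∀ h : V → ℂ, IsBddIntegrable μ h →
      c * ∫⁻ ξ, ‖fourier μ h ξ‖ₑ ^ 2 ∂μ' = ∫⁻ x, ‖h x‖ₑ ^ 2 ∂μ := by
  obtain ⟨K, hKc, hK1⟩ := exists_compact_mem_nhds (1 : V)
  have hKm := hKc.measurableSet
  have hK0 : μ K ≠ 0 := (Measure.measure_pos_of_mem_nhds μ hK1).ne'
  have hKt : μ K ≠ ∞ := hKc.measure_lt_top.ne
  let k : V → ℂ := K.indicator fun _ => 1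
  have hk : IsBddIntegrable μ k :=
    ⟨measurable_const.indicator hKm, ⟨1, fun x => by
      by_cases h : x ∈ K <;> simp [k, h]⟩, (integrable_indicator_iff hKm).2 (integrableOn_const hKt)⟩
  obtain ⟨ν, hν⟩ := exists_isSpectralMeasure hk
  have := hν.isFinite
  have hN : ν Set.univ = μ K := by
    rw [hν.measure_univ hk, ← lintegral_indicator_one hKm]
    refine lintegral_congr fun x => ?_
    by_cases h : x ∈ K <;> simp [k, h]
  set Ck := ∫⁻ ξ, ‖fourier μ k ξ‖ₑ ^ 2 ∂μ' with hCk
  -- If the integral were infinite, testing `lintegral_comm` with indicators of compact sets would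
  -- make `ν` vanish on every compact set, although its total mass is `μ K`.
  have hCt : Ck ≠ ∞ := by
    intro hc
    have h1 : ∀ L : Set (PontryaginDual V), IsCompact L → ν L = 0 := by
      intro L hL
      have h2 := hν.lintegral_comm hk hk hν μ' (measurable_one.indicator hL.measurableSet :
        Measurable (L.indicator (1 : PontryaginDual V → ℝ≥0∞)))
      rw [← hCk, hc] at h2
      by_contra h3
      rw [lintegral_indicator_one hL.measurableSet, ENNReal.top_mul h3, hN] at h2
      have h5 : ∫⁻ ξ, ‖fourier μ k ξ‖ₑ ^ 2 * L.indicator 1 ξ ∂μ' ≤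
          ENNReal.ofReal (∫ x, ‖k x‖ ∂μ) ^ 2 * μ' L := by
        rw [← lintegral_indicator_one hL.measurableSet,
          ← lintegral_const_mul _ (measurable_one.indicator hL.measurableSet)]
        refine lintegral_mono fun ξ => ?_
        refine mul_le_mul' (pow_le_pow_left' ?_ 2) le_rfl
        rw [← ofReal_norm]
        exact ENNReal.ofReal_le_ofReal (norm_fourier_le μ k ξ)
      have h6 : μ' L ≠ ∞ := hL.measure_lt_top.ne
      have h7 : ENNReal.ofReal (∫ x, ‖k x‖ ∂μ) ^ 2 * μ' L ≠ ∞ := by finiteness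
      exact ENNReal.mul_ne_top hKt (ne_top_of_le_ne_top h7 h5) h2.symm
    apply hK0
    rw [← hN, ← iUnion_compactCovering, measure_iUnion_null_iff]
    exact fun n => h1 _ (isCompact_compactCovering _ n)
  have hC0 : Ck ≠ 0 := by
    intro hc
    rw [hCk, lintegral_eq_zero_iff (measurable_enorm_fourier_sq hk.integrable)] at hc
    have h1 : fourier μ k =ᵐ[μ'] fun _ => 0 := by
      filter_upwards [hc] with ξ hξ
      simpa using hξ
    have h2 := congrFun ((Continuous.ae_eq_iff_eq μ' (continuous_fourier hk.integrable)
      continuous_const).1 h1) 1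
    have h3 : fourier μ k 1 = μ.real K := by
      simp only [fourier, k, PontryaginDual.one_apply, Circle.coe_one, mul_one]
      rw [integral_indicator hKm]
      simp
    rw [h3] at h2
    have h4 : μ.real K = 0 := by exact_mod_cast h2
    exact (ENNReal.toReal_pos hK0 hKt).ne' h4
  -- With `φ = 1`, `lintegral_comm` reads `Ck * ‖h‖² = μ K * ∫ ‖ĥ‖²`, which dictates the constant.
  refine ⟨μ K / Ck, ENNReal.div_ne_zero.2 ⟨hK0, hCt⟩, ENNReal.div_ne_top hKt hC0, fun h hh => ?_⟩
  obtain ⟨νh, hνh⟩ := exists_isSpectralMeasure hh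
  have h1 := hν.lintegral_comm hk hh hνh μ' (measurable_const : Measurable fun _ => (1 : ℝ≥0∞))
  simp only [mul_one, lintegral_one] at h1
  rw [← hCk, hN, hνh.measure_univ hh] at h1
  rw [div_eq_mul_inv, mul_right_comm, ← h1, mul_comm Ck, mul_assoc,
    ENNReal.mul_inv_cancel hC0 hCt, mul_one]

end Plancherel

/-! ### Uniqueness of Haar measures and the modulus of an action -/

/-- Uniqueness of Haar measure for a measure not known to be locally finite. σ-finiteness rules out
the constant `∞`, under which every set would have measure `0` or `∞`. -/
lemma exists_eq_smul_haar {G : Type*} [Group G] [TopologicalSpace G] [IsTopologicalGroup G]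
    [LocallyCompactSpace G] [SecondCountableTopology G] [MeasurableSpace G] [BorelSpace G]
    (μ : Measure G) [μ.IsHaarMeasure] (ν : Measure G) [SigmaFinite ν] [ν.IsMulLeftInvariant]
    (hν : ν ≠ 0) : ∃ κ : ℝ≥0∞, κ ≠ 0 ∧ κ ≠ ∞ ∧ ν = κ • μ := by
  obtain ⟨K, hKc, hK1⟩ := exists_compact_mem_nhds (1 : G)
  have hK0 : μ K ≠ 0 := (Measure.measure_pos_of_mem_nhds μ hK1).ne'
  have hKt : μ K ≠ ∞ := hKc.measure_lt_top.ne
  have h1 := measure_eq_div_smul ν μ hK0 hKt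
  refine ⟨_, ?_, ?_, h1⟩
  · intro h2
    rw [h2, zero_smul] at h1
    exact hν h1
  · intro h2
    rw [h2] at h1
    have h3 : ν Set.univ = 0 := by
      rw [← iUnion_spanningSets ν, measure_iUnion_null_iff]
      intro n
      have h4 := measure_spanningSets_lt_top ν n
      by_contra h5
      generalize spanningSets ν n = s at h4 h5
      rw [h1, Measure.smul_apply, smul_eq_mul] at h4 h5
      have h6 : μ s ≠ 0 := fun h => h5 (by rw [h, mul_zero])
      rw [ENNReal.top_mul h6] at h4
      exact lt_irrefl _ h4
    exact hν (Measure.measure_univ_eq_zero.1 h3)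

section Modulus

variable {Q V : Type*} [Group Q] [TopologicalSpace Q] [IsTopologicalGroup Q]
  [SecondCountableTopology Q] [MeasurableSpace Q] [BorelSpace Q]
  [CommGroup V] [TopologicalSpace V] [IsTopologicalGroup V]
  [LocallyCompactSpace V] [T2Space V] [SecondCountableTopology V]
  [MeasurableSpace V] [BorelSpace V] [MulDistribMulAction Q V] [ContinuousSMul Q V]

/-- The action of `q` as an automorphism of the topological group `V`. -/
def actEquiv (V : Type*) [CommGroup V] [TopologicalSpace V] [MulDistribMulAction Q V]
    [ContinuousSMul Q V] (q : Q) : V ≃ₜ* V :=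
  { MulDistribMulAction.toMulEquiv V q with
    continuous_toFun := continuous_const_smul q
    continuous_invFun := continuous_const_smul q⁻¹ }

variable (V) in
/-- The modulus of the action of `q` on `V`. -/
def modulus (q : Q) : ℝ≥0 := mulEquivHaarChar (actEquiv V q)

lemma modulus_ne_zero (q : Q) : modulus V q ≠ 0 := (mulEquivHaarChar_pos _).ne'

variable (μ : Measure V) [μ.IsHaarMeasure]

lemma modulus_smul_map (q : Q) : modulus V q • μ.map (fun v => q • v) = μ :=
  mulEquivHaarChar_smul_map μ (actEquiv V q)

lemma measurable_const_smul_act (q : Q) : Measurable fun v : V => q • v :=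
  (continuous_const_smul q).measurable

lemma modulus_mul_lintegral (q : Q) {F : V → ℝ≥0∞} (hF : Measurable F) :
    modulus V q * ∫⁻ v, F (q • v) ∂μ = ∫⁻ v, F v ∂μ := by
  conv_rhs => rw [← modulus_smul_map μ q]
  rw [lintegral_smul_measure, lintegral_map hF (measurable_const_smul_act q)]
  rfl

lemma modulus_mul_integral (q : Q) (F : V → ℂ) :
    (modulus V q : ℂ) * ∫ v, F (q • v) ∂μ = ∫ v, F v ∂μ := by
  conv_rhs => rw [← modulus_smul_map μ q]
  rw [integral_smul_nnreal_measure]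
  have h : MeasurableEmbedding fun v : V => q • v :=
    (actEquiv V q).toHomeomorph.measurableEmbedding
  rw [h.integral_map, NNReal.smul_def, Complex.real_smul]

lemma exists_lintegral_pos : ∃ F : V → ℝ≥0∞, Measurable F ∧ ∫⁻ v, F v ∂μ ≠ 0 ∧
    ∫⁻ v, F v ∂μ ≠ ∞ := by
  obtain ⟨K, hKc, hK1⟩ := exists_compact_mem_nhds (1 : V)
  refine ⟨K.indicator 1, measurable_one.indicator hKc.measurableSet, ?_⟩
  rw [lintegral_indicator_one hKc.measurableSet]
  exact ⟨(Measure.measure_pos_of_mem_nhds μ hK1).ne', hKc.measure_lt_top.ne⟩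

lemma modulus_mul (q r : Q) : modulus V (q * r) = modulus V q * modulus V r := by
  obtain ⟨F, hF, h0, ht⟩ := exists_lintegral_pos (Measure.haar : Measure V)
  set μ : Measure V := Measure.haar
  have h1 := modulus_mul_lintegral μ (q * r) hF
  have h2 := modulus_mul_lintegral μ r (hF.comp (measurable_const_smul_act q))
  have h3 := modulus_mul_lintegral μ q hF
  simp only [mul_smul] at h1
  simp only [Function.comp_apply] at h2
  rw [← h3, ← h2, ← mul_assoc] at h1
  set I := ∫⁻ v, F (q • r • v) ∂μ
  have h4 : I ≠ 0 := by
    intro h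
    rw [h] at h2
    rw [← h3, ← h2] at h0
    simp at h0
  have h5 : I ≠ ∞ := by
    intro h
    rw [h, ENNReal.mul_top (by exact_mod_cast modulus_ne_zero r)] at h2
    rw [← h3, ← h2, ENNReal.mul_top (by exact_mod_cast modulus_ne_zero q)] at ht
    exact ht rfl
  exact_mod_cast (ENNReal.mul_left_inj h4 h5).1 h1

lemma modulus_inv (q : Q) : modulus V q⁻¹ = (modulus V q)⁻¹ := by
  have h1 : modulus V (1 : Q) = 1 := by
    have h := modulus_mul (V := V) (1 : Q) 1
    rw [one_mul] at h
    exact (mul_eq_left₀ (modulus_ne_zero (1 : Q))).1 h.symm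
  refine eq_inv_of_mul_eq_one_left ?_
  rw [← modulus_mul, inv_mul_cancel, h1]

/-- The modulus is the quotient of `∫ F` by `∫ F (q • v) dv` for a fixed test function, and the
denominator is measurable in `q` by Tonelli. -/
lemma measurable_modulus : Measurable (modulus V : Q → ℝ≥0) := by
  obtain ⟨F, hF, h0, ht⟩ := exists_lintegral_pos (Measure.haar : Measure V)
  have h1 : Measurable fun q : Q => ∫⁻ v : V, F (q • v) ∂Measure.haar := by
    refine Measurable.lintegral_prod_right' (f := fun p : Q × V => F (p.1 • p.2)) ?_
    exact hF.comp (continuous_smul.measurable)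
  have h2 : (fun q : Q => (modulus V q : ℝ≥0∞)) =
      fun q => (∫⁻ v, F v ∂Measure.haar) / ∫⁻ v : V, F (q • v) ∂Measure.haar := by
    ext1 q
    have h3 := modulus_mul_lintegral (Measure.haar : Measure V) q hF
    rw [ENNReal.eq_div_iff _ _, mul_comm]
    · exact h3
    · intro h; rw [h] at h3; simp at h3; exact h0 h3.symm
    · intro h
      rw [h, ENNReal.mul_top (by exact_mod_cast modulus_ne_zero q)] at h3
      exact ht h3.symm
  have h3 : Measurable fun q : Q => (modulus V q : ℝ≥0∞) := by
    rw [h2]; exact h1.const_div _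
  exact h3.ennreal_toNNReal

/-! ### The modulus of the dual action -/

variable [MeasurableSpace (PontryaginDual V)] [BorelSpace (PontryaginDual V)]

@[simp]
lemma dualAct_apply (q : Q) (ξ : PontryaginDual V) (v : V) :
    dualAct q ξ v = ξ (q⁻¹ • v) := rfl

lemma continuous_dualAct (q : Q) :
    Continuous (dualAct q : PontryaginDual V → PontryaginDual V) :=
  map_continuous (PontryaginDual.map (actHom q⁻¹))

/-- The dual action of `q` as an automorphism of the dual group. -/
def dualActEquiv (V : Type*) [CommGroup V] [TopologicalSpace V] [MulDistribMulAction Q V]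
    [ContinuousSMul Q V] (q : Q) : PontryaginDual V ≃ₜ* PontryaginDual V where
  toFun := dualAct q
  invFun := dualAct q⁻¹
  left_inv ξ := PontryaginDual.ext fun v => by
    change ξ (q⁻¹ • q⁻¹⁻¹ • v) = ξ v
    rw [inv_inv, inv_smul_smul]
  right_inv ξ := PontryaginDual.ext fun v => by
    change ξ (q⁻¹⁻¹ • q⁻¹ • v) = ξ v
    rw [inv_inv, smul_inv_smul]
  map_mul' ξ ζ := rfl
  continuous_toFun := map_continuous (PontryaginDual.map (actHom q⁻¹))
  continuous_invFun := map_continuous (PontryaginDual.map (actHom q⁻¹⁻¹))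

lemma IsBddIntegrable.comp_smul {μ : Measure V} [μ.IsHaarMeasure] {h : V → ℂ}
    (hh : IsBddIntegrable μ h) (q : Q) : IsBddIntegrable μ (fun v => h (q • v)) := by
  obtain ⟨C, hC⟩ := hh.bdd
  refine ⟨hh.measurable.comp (measurable_const_smul_act q), ⟨C, fun v => hC _⟩, ?_⟩
  have h1 : MeasurableEmbedding fun v : V => q • v :=
    (actEquiv V q).toHomeomorph.measurableEmbedding
  have h2 := hh.integrable
  rw [← modulus_smul_map μ q] at h2
  change Integrable h ((modulus V q : ℝ≥0∞) • μ.map (fun v => q • v)) at h2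
  rw [integrable_smul_measure (by exact_mod_cast modulus_ne_zero q) ENNReal.coe_ne_top,
    h1.integrable_map_iff] at h2
  exact h2

lemma exists_isBddIntegrable_pos (μ : Measure V) [μ.IsHaarMeasure] :
    ∃ h : V → ℂ, IsBddIntegrable μ h ∧ ∫⁻ v, ‖h v‖ₑ ^ 2 ∂μ ≠ 0 ∧ ∫⁻ v, ‖h v‖ₑ ^ 2 ∂μ ≠ ∞ := by
  obtain ⟨K, hKc, hK1⟩ := exists_compact_mem_nhds (1 : V)
  have hKm := hKc.measurableSet
  have hKt : μ K ≠ ∞ := hKc.measure_lt_top.ne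
  have h1 : ∫⁻ v, ‖K.indicator (fun _ => (1 : ℂ)) v‖ₑ ^ 2 ∂μ = μ K := by
    rw [← lintegral_indicator_one hKm]
    refine lintegral_congr fun x => ?_
    by_cases h : x ∈ K <;> simp [h]
  refine ⟨K.indicator fun _ => 1, ⟨measurable_const.indicator hKm, ⟨1, fun x => by
      by_cases h : x ∈ K <;> simp [h]⟩, (integrable_indicator_iff hKm).2 (integrableOn_const hKt)⟩,
      ?_⟩
  rw [h1]
  exact ⟨(Measure.measure_pos_of_mem_nhds μ hK1).ne', hKt⟩

lemma fourier_comp_smul (h : V → ℂ) (q : Q) (ξ : PontryaginDual V) :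
    (modulus V q : ℂ) * fourier μ (fun v => h (q • v)) ξ = fourier μ h (dualAct q ξ) := by
  unfold fourier
  rw [← modulus_mul_integral μ q (fun x => h x * (dualAct q ξ x : ℂ))]
  simp only [dualAct_apply, inv_smul_smul]

/-- Uniqueness gives some factor `a`, and Plancherel identifies it. Passing from `h` to `h (q • ·)`
divides `‖h‖²` by the modulus and replaces `ĥ` by `ĥ ∘ q♭` divided by the modulus; hence `a` times
the modulus is the square of the modulus. -/
lemma map_dualAct (μ' : Measure (PontryaginDual V)) [μ'.IsHaarMeasure] (q : Q) :
    μ'.map (dualAct q) = (modulus V q : ℝ≥0∞) • μ' := by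
  let μ : Measure V := Measure.haar
  have h1 : (μ'.map (dualActEquiv V q)).IsHaarMeasure := (dualActEquiv V q).isHaarMeasure_map μ'
  change (μ'.map (dualAct q)).IsHaarMeasure at h1
  obtain ⟨a, ha0, hat, ha⟩ := exists_eq_smul_haar μ' (μ'.map (dualAct q))
    (fun h0 => isOpen_univ.measure_ne_zero (μ'.map (dualAct q)) Set.univ_nonempty (by rw [h0]; rfl))
  obtain ⟨c, hc0, hct, hc⟩ := exists_plancherel μ μ'
  obtain ⟨h, hh, h0, ht⟩ := exists_isBddIntegrable_pos μ
  have hm := measurable_enorm_fourier_sq hh.integrable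
  have hq := modulus_ne_zero (V := V) q
  have h2 : ∫⁻ ξ, ‖fourier μ h (dualAct q ξ)‖ₑ ^ 2 ∂μ' = a * ∫⁻ ξ, ‖fourier μ h ξ‖ₑ ^ 2 ∂μ' := by
    rw [← lintegral_map hm (continuous_dualAct q).measurable, ha, lintegral_smul_measure,
      smul_eq_mul]
  simp only [← fourier_comp_smul μ h q, enorm_mul, mul_pow] at h2
  rw [lintegral_const_mul _ (measurable_enorm_fourier_sq (hh.comp_smul q).integrable)] at h2
  have h3 := congrArg (fun x => c * x) h2
  rw [mul_left_comm, mul_left_comm c, hc _ hh, hc _ (hh.comp_smul q),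
    ← modulus_mul_lintegral μ q (hh.measurable.enorm.pow_const 2), ← mul_assoc] at h3
  have h4 := modulus_mul_lintegral μ q (hh.measurable.enorm.pow_const 2)
  have h5 : ∫⁻ v, ‖h (q • v)‖ₑ ^ 2 ∂μ ≠ 0 := by
    intro h; rw [h, mul_zero] at h4; exact h0 h4.symm
  have h6 : ∫⁻ v, ‖h (q • v)‖ₑ ^ 2 ∂μ ≠ ∞ := by
    intro h
    rw [h, ENNReal.mul_top (by exact_mod_cast hq)] at h4
    exact ht h4.symm
  rw [ENNReal.mul_left_inj h5 h6] at h3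
  have h7 : ‖((modulus V q : ℝ) : ℂ)‖ₑ = modulus V q := by
    rw [← ofReal_norm, Complex.norm_real, Real.norm_of_nonneg (NNReal.coe_nonneg _),
      ENNReal.ofReal_coe_nnreal]
  rw [h7, sq, ENNReal.mul_left_inj (by exact_mod_cast hq) ENNReal.coe_ne_top] at h3
  rw [ha, h3]

end Modulus

/-! ### Haar measure and Fourier uniqueness transported to Q along η -/

section Cocycle

variable {Q V : Type*} [Group Q] [TopologicalSpace Q] [IsTopologicalGroup Q]
  [LocallyCompactSpace Q] [SecondCountableTopology Q] [MeasurableSpace Q] [BorelSpace Q]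
  [CommGroup V] [TopologicalSpace V] [IsTopologicalGroup V]
  [LocallyCompactSpace V] [T2Space V] [SecondCountableTopology V]
  [MeasurableSpace V] [BorelSpace V] [MulDistribMulAction Q V] [ContinuousSMul Q V]
  [MeasurableSpace (PontryaginDual V)] [BorelSpace (PontryaginDual V)]
  {μQ : Measure Q} [μQ.IsHaarMeasure]
  {μV' : Measure (PontryaginDual V)} [μV'.IsHaarMeasure]
  {η : Q → PontryaginDual V}

/-- Under an essentially bijective cocycle, the Haar measure of the dual group corresponds to
a multiple of the Haar measure of `Q` divided by the modulus of the action. -/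
lemma exists_lintegral_dual_eq (hη : IsOneCocycle η) (hiso : IsMeasureClassIso μQ μV' η) :
    ∃ s : ℝ≥0∞, s ≠ 0 ∧ s ≠ ∞ ∧ ∀ Φ : PontryaginDual V → ℝ≥0∞, Measurable Φ →
      ∫⁻ ξ, Φ ξ ∂μV' = s * ∫⁻ q, Φ (η q) * (modulus V q : ℝ≥0∞)⁻¹ ∂μQ := by
  obtain ⟨-, g, hg, hgη, hηg⟩ := hiso
  have hgm := hg.measurable
  have hηm : Measurable η := hη.continuous.measurable
  -- Haar measure of the dual, carried to `Q` by the almost everywhere inverse of `η`.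
  let ν := μV'.map g
  have hνη : ∀ Φ : PontryaginDual V → ℝ≥0∞, Measurable Φ → ∫⁻ q, Φ (η q) ∂ν = ∫⁻ ξ, Φ ξ ∂μV' := by
    intro Φ hΦ
    rw [show ∫⁻ q, Φ (η q) ∂ν = ∫⁻ ξ, Φ (η (g ξ)) ∂μV' from lintegral_map (hΦ.comp hηm) hgm]
    refine lintegral_congr_ae ?_
    filter_upwards [hηg] with ξ hξ
    rw [hξ]
  -- By the cocycle identity `η` intertwines left translation by `q` with `ξ ↦ η q * dualAct q ξ`.
  -- The translation part preserves Haar measure and the linear part scales it by the modulus.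
  have hνmap : ∀ q : Q, ν.map (q * ·) = (modulus V q : ℝ≥0∞) • ν := by
    intro q
    have h1 : (q * ·) ∘ g =ᵐ[μV'] g ∘ (η q * ·) ∘ dualAct q := by
      have h2 : ∀ᵐ x ∂μQ, g (η (q * x)) = q * x :=
        (measurePreserving_mul_left μQ q).quasiMeasurePreserving.ae hgη
      filter_upwards [hg.ae h2, hηg] with ξ h3 h4
      simp only [Function.comp_apply]
      rw [← h3, hη.map_mul, h4]
    rw [Measure.map_map (measurable_const_mul q) hgm]
    rw [Measure.map_congr h1,
      ← Measure.map_map hgm ((measurable_const_mul _).comp (continuous_dualAct q).measurable),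
      ← Measure.map_map (measurable_const_mul _) (continuous_dualAct q).measurable,
      map_dualAct, Measure.map_smul, Measure.map_smul, map_mul_left_eq_self]
  have hδ : Measurable fun q : Q => (modulus V q : ℝ≥0∞) := measurable_modulus.coe_nnreal_ennreal
  have hδ0 : ∀ q : Q, (modulus V q : ℝ≥0∞) ≠ 0 := fun q => by exact_mod_cast modulus_ne_zero q
  -- The modulus is multiplicative, so weighting by it cancels the scaling and gives a left
  -- invariant measure.
  let ν' := ν.withDensity fun q => (modulus V q : ℝ≥0∞)
  have hσν : SigmaFinite ν := by
    refine ⟨⟨⟨fun n => η ⁻¹' spanningSets μV' n, fun _ => trivial, fun n => ?_, ?_⟩⟩⟩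
    · have h1 := hνη ((spanningSets μV' n).indicator 1)
        (measurable_one.indicator (measurableSet_spanningSets _ n))
      rw [lintegral_indicator_one (measurableSet_spanningSets _ n)] at h1
      rw [← lintegral_indicator_one (hηm (measurableSet_spanningSets _ n))]
      exact h1.trans_lt (measure_spanningSets_lt_top μV' n)
    · rw [← Set.preimage_iUnion, iUnion_spanningSets, Set.preimage_univ]
  have hσ : SigmaFinite ν' := SigmaFinite.withDensity (modulus V)
  have hν' : ∀ Ψ : Q → ℝ≥0∞, Measurable Ψ →
      ∫⁻ a, Ψ a ∂ν' = ∫⁻ a, (modulus V a : ℝ≥0∞) * Ψ a ∂ν := fun Ψ hΨ =>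
    lintegral_withDensity_eq_lintegral_mul _ hδ hΨ
  have hinv : ν'.IsMulLeftInvariant := by
    refine ⟨fun q => ?_⟩
    refine Measure.ext_of_lintegral _ fun Φ hΦ => ?_
    rw [lintegral_map hΦ (measurable_const_mul q),
      hν' (fun a => Φ (q * a)) (hΦ.comp (measurable_const_mul q)), hν' Φ hΦ]
    have h1 := lintegral_map (μ := ν) (hδ.mul hΦ) (measurable_const_mul q)
    rw [hνmap, lintegral_smul_measure, smul_eq_mul] at h1
    simp only [Pi.mul_apply, modulus_mul, ENNReal.coe_mul, mul_assoc] at h1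
    rw [lintegral_const_mul (f := fun a => (modulus V a : ℝ≥0∞) * Φ (q * a)) _
      (hδ.mul (hΦ.comp (measurable_const_mul q))),
      ENNReal.mul_right_inj (hδ0 q) ENNReal.coe_ne_top] at h1
    exact h1.symm
  have hne : ν' ≠ 0 := by
    intro h1
    rw [withDensity_eq_zero_iff hδ.aemeasurable] at h1
    have h2 : ∀ᵐ q ∂ν, False := by
      filter_upwards [h1] with q hq using hδ0 q hq
    rw [Filter.eventually_false_iff_eq_bot, ae_eq_bot] at h2
    have h3 := hνη 1 measurable_one
    rw [h2] at h3
    simp only [Pi.one_apply, lintegral_one] at h3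
    exact isOpen_univ.measure_ne_zero μV' Set.univ_nonempty h3.symm
  obtain ⟨s, hs0, hst, hs⟩ := exists_eq_smul_haar μQ ν' hne
  refine ⟨s, hs0, hst, fun Φ hΦ => ?_⟩
  rw [← hνη Φ hΦ, ← smul_eq_mul, ← lintegral_smul_measure, ← hs,
    hν' (fun q => Φ (η q) * (modulus V q : ℝ≥0∞)⁻¹) ((hΦ.comp hηm).mul hδ.inv)]
  refine lintegral_congr fun q => ?_
  rw [mul_left_comm, ENNReal.mul_inv_cancel (hδ0 q) ENNReal.coe_ne_top, mul_one]

/-- The Plancherel theorem, transported to `Q`. -/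
lemma exists_plancherel_cocycle (μV : Measure V) [μV.IsHaarMeasure] (hη : IsOneCocycle η)
    (hiso : IsMeasureClassIso μQ μV' η) :
    ∃ c : ℝ≥0∞, c ≠ 0 ∧ c ≠ ∞ ∧ ∀ h : V → ℂ, IsBddIntegrable μV h →
      c * ∫⁻ q, ‖fourier μV h (η q)‖ₑ ^ 2 * (modulus V q : ℝ≥0∞)⁻¹ ∂μQ =
        ∫⁻ v, ‖h v‖ₑ ^ 2 ∂μV := by
  obtain ⟨c, hc0, hct, hc⟩ := exists_plancherel μV μV'
  obtain ⟨s, hs0, hst, hs⟩ := exists_lintegral_dual_eq hη hiso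
  refine ⟨c * s, mul_ne_zero hc0 hs0, ENNReal.mul_ne_top hct hst, fun h hh => ?_⟩
  rw [mul_assoc, ← hs _ (measurable_enorm_fourier_sq hh.integrable), hc h hh]

/-- An integrable function on `Q` is determined by its Fourier transform along `η`. -/
lemma ae_eq_zero_of_forall_integral_eval (hη : IsOneCocycle η)
    (hiso : IsMeasureClassIso μQ μV' η) {u : Q → ℂ} (hu : Integrable u μQ)
    (h : ∀ v : V, ∫ q, u q * η q v ∂μQ = 0) : u =ᵐ[μQ] 0 := by
  obtain ⟨-, g, hg, hgη, hηg⟩ := hiso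
  have hgm := hg.measurable
  have hηm : Measurable η := hη.continuous.measurable
  have hev : ∀ v : V, AEStronglyMeasurable (fun q => (η q v : ℂ)) μQ := fun v =>
    ((continuous_eval_coe v).comp hη.continuous).aestronglyMeasurable
  have hint : ∀ {w : Q → ℂ}, Integrable w μQ → ∀ v : V, Integrable (fun q => w q * η q v) μQ :=
    fun hw v => hw.mul_bdd (c := 1) (hev v)
      (Filter.Eventually.of_forall fun q => (Circle.norm_coe _).le)
  -- The positive and negative parts of a real `w` define finite measures whose images in the dual
  -- have equal Fourier transforms, hence coincide. The almost everywhere inverse `g` carries the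
  -- equality back to `Q`.
  have key : ∀ w : Q → ℝ, Integrable w μQ → (∀ v : V, ∫ q, (w q : ℂ) * η q v ∂μQ = 0) →
      w =ᵐ[μQ] 0 := by
    intro w hw hwv
    have hfin : ∀ x : Q → ℝ, Integrable x μQ →
        IsFiniteMeasure (μQ.withDensity fun q => ENNReal.ofReal (x q)) := fun x hx =>
      isFiniteMeasure_withDensity_ofReal hx.2
    have hm1 : AEMeasurable (fun q => ENNReal.ofReal (w q)) μQ := hw.1.aemeasurable.ennreal_ofReal
    have hm2 : AEMeasurable (fun q => ENNReal.ofReal (-w q)) μQ :=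
      hw.1.aemeasurable.neg.ennreal_ofReal
    have i1 := hfin w hw
    have i2 := hfin _ hw.neg
    simp only [Pi.neg_apply] at i2
    have h1 : (μQ.withDensity fun q => ENNReal.ofReal (w q)).map η =
        (μQ.withDensity fun q => ENNReal.ofReal (-w q)).map η := by
      refine measure_dual_ext fun v => ?_
      rw [integral_map hηm.aemeasurable (continuous_eval_coe v).aestronglyMeasurable,
        integral_map hηm.aemeasurable (continuous_eval_coe v).aestronglyMeasurable,
        integral_withDensity_eq_integral_toReal_smul₀ hm1
          (Filter.Eventually.of_forall fun q => ENNReal.ofReal_lt_top),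
        integral_withDensity_eq_integral_toReal_smul₀ hm2
          (Filter.Eventually.of_forall fun q => ENNReal.ofReal_lt_top),
        ← sub_eq_zero, ← integral_sub]
      · rw [← hwv v]
        refine integral_congr_ae (Filter.Eventually.of_forall fun q => ?_)
        simp only [ENNReal.toReal_ofReal', Complex.real_smul, ← sub_mul]
        congr 1
        rw [← Complex.ofReal_sub]
        congr 1
        exact max_zero_sub_max_neg_zero_eq_self _
      · simp only [ENNReal.toReal_ofReal', Complex.real_smul]
        exact hint hw.pos_part.ofReal v
      · simp only [ENNReal.toReal_ofReal', Complex.real_smul]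
        exact hint hw.neg_part.ofReal v
    have h2 : μQ.withDensity (fun q => ENNReal.ofReal (w q)) =
        μQ.withDensity (fun q => ENNReal.ofReal (-w q)) := by
      have h3 : ∀ x : Q → ℝ≥0∞, ((μQ.withDensity x).map η).map g = μQ.withDensity x := by
        intro x
        rw [Measure.map_map hgm hηm]
        conv_rhs => rw [← Measure.map_id (μ := μQ.withDensity x)]
        exact Measure.map_congr ((withDensity_absolutelyContinuous μQ x).ae_le hgη)
      rw [← h3, h1, h3]
    rw [withDensity_eq_iff hm1 hm2 (by
      have := i1.measure_univ_lt_top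
      rw [withDensity_apply _ MeasurableSet.univ, setLIntegral_univ] at this
      exact this.ne)] at h2
    filter_upwards [h2] with q hq
    change w q = 0
    rcases le_total 0 (w q) with h3 | h3
    · rw [ENNReal.ofReal_of_nonpos (by linarith : -w q ≤ 0)] at hq
      exact le_antisymm (ENNReal.ofReal_eq_zero.1 hq) h3
    · rw [ENNReal.ofReal_of_nonpos h3] at hq
      have := ENNReal.ofReal_eq_zero.1 hq.symm
      exact le_antisymm h3 (by linarith)
  -- Conjugation exchanges the transforms at `v` and `v⁻¹`, so the real and imaginary parts of `u`
  -- also have vanishing transforms.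
  have hconj : ∀ v : V, ∫ q, starRingEnd ℂ (u q) * η q v ∂μQ = 0 := by
    intro v
    have h1 := congrArg (starRingEnd ℂ) (h v⁻¹)
    rw [← integral_conj, map_zero] at h1
    rw [← h1]
    refine integral_congr_ae (Filter.Eventually.of_forall fun q => ?_)
    simp only [map_mul, map_inv, Circle.coe_inv_eq_conj, Complex.conj_conj]
  have hre := key (fun q => (u q).re) hu.re fun v => by
    have h1 : ∀ q, (((u q).re : ℝ) : ℂ) * η q v =
        (1 / 2 : ℂ) * (u q * η q v + starRingEnd ℂ (u q) * η q v) := by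
      intro q; rw [Complex.re_eq_add_conj]; ring
    simp only [h1]
    rw [integral_const_mul, integral_add (hint hu v) (hint (integrable_conj hu) v), h v, hconj v]
    simp
  have him := key (fun q => (u q).im) hu.im fun v => by
    have h1 : ∀ q, (((u q).im : ℝ) : ℂ) * η q v =
        (1 / (2 * Complex.I) : ℂ) * (u q * η q v - starRingEnd ℂ (u q) * η q v) := by
      intro q; rw [Complex.im_eq_sub_conj]; ring
    simp only [h1]
    rw [integral_const_mul, integral_sub (hint hu v) (hint (integrable_conj hu) v), h v, hconj v]
    simp
  filter_upwards [hre, him] with q h1 h2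
  exact Complex.ext h1 h2

end Cocycle

/-! ### Square norms as extended nonnegative integrals, and a dense subspace of L² -/

lemma lintegral_enorm_sq_lt_top_iff {X E : Type*} [MeasurableSpace X] {μ : Measure X}
    [NormedAddCommGroup E] {f : X → E} (hf : AEStronglyMeasurable f μ) :
    ∫⁻ x, ‖f x‖ₑ ^ 2 ∂μ < ∞ ↔ MemLp f 2 μ := by
  have h1 := eLpNorm_lt_top_iff_lintegral_rpow_enorm_lt_top (μ := μ) (f := f) two_ne_zero
    ENNReal.ofNat_ne_top
  simp only [ENNReal.toReal_ofNat, ENNReal.rpow_ofNat] at h1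
  exact ⟨fun h => ⟨hf, h1.2 h⟩, fun h => h1.1 h.2⟩

lemma eLpNorm_two_sq {X E : Type*} [MeasurableSpace X] (μ : Measure X)
    [NormedAddCommGroup E] (f : X → E) :
    eLpNorm f 2 μ ^ 2 = ∫⁻ x, ‖f x‖ₑ ^ 2 ∂μ := by
  rw [eLpNorm_eq_lintegral_rpow_enorm_toReal two_ne_zero ENNReal.ofNat_ne_top]
  simp only [ENNReal.toReal_ofNat, ENNReal.rpow_ofNat]
  rw [← ENNReal.rpow_natCast, ← ENNReal.rpow_mul]
  norm_num

lemma enorm_sq_Lp {X E : Type*} [MeasurableSpace X] {μ : Measure X}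
    [NormedAddCommGroup E] (f : Lp E 2 μ) : ‖f‖ₑ ^ 2 = ∫⁻ x, ‖f x‖ₑ ^ 2 ∂μ := by
  rw [Lp.enorm_def, eLpNorm_two_sq]

lemma enorm_sq_toLp {X E : Type*} [MeasurableSpace X] {μ : Measure X}
    [NormedAddCommGroup E] {f : X → E} (hf : MemLp f 2 μ) :
    ‖hf.toLp f‖ₑ ^ 2 = ∫⁻ x, ‖f x‖ₑ ^ 2 ∂μ := by
  rw [Lp.enorm_toLp, eLpNorm_two_sq]

lemma lintegral_enorm_mul_sq_le {X : Type*} [MeasurableSpace X] {μ : Measure X} {f g : X → ℝ≥0∞}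
    (hf : AEMeasurable f μ) (hg : AEMeasurable g μ) :
    (∫⁻ x, f x * g x ∂μ) ^ 2 ≤ (∫⁻ x, f x ^ 2 ∂μ) * ∫⁻ x, g x ^ 2 ∂μ := by
  have h := ENNReal.lintegral_mul_le_Lp_mul_Lq μ (Real.HolderConjugate.two_two) hf hg
  refine (pow_le_pow_left' h 2).trans (le_of_eq ?_)
  simp only [ENNReal.rpow_ofNat]
  rw [mul_pow, ← ENNReal.rpow_natCast, ← ENNReal.rpow_mul, ← ENNReal.rpow_natCast,
    ← ENNReal.rpow_mul]
  norm_num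

section BddIntegrable

variable {X : Type*} [MeasurableSpace X]

/-- The space of bounded measurable integrable functions. -/
def bddIntegrable (μ : Measure X) : Submodule ℂ (X → ℂ) where
  carrier := {h | IsBddIntegrable μ h}
  zero_mem' := ⟨measurable_zero, ⟨0, fun _ => by simp⟩, integrable_zero _ _ _⟩
  add_mem' := by
    rintro f g ⟨h1, ⟨C, hC⟩, h3⟩ ⟨k1, ⟨D, hD⟩, k3⟩
    exact ⟨h1.add k1, ⟨C + D, fun x => (norm_add_le _ _).trans (add_le_add (hC x) (hD x))⟩,
      h3.add k3⟩
  smul_mem' := by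
    rintro c f ⟨h1, ⟨C, hC⟩, h3⟩
    refine ⟨h1.const_smul c, ⟨‖c‖ * C, fun x => ?_⟩, h3.smul c⟩
    rw [Pi.smul_apply, norm_smul]
    exact mul_le_mul_of_nonneg_left (hC x) (norm_nonneg c)

/-- Bounded integrable functions as elements of `L²`. -/
def bddIntegrableToLp (μ : Measure X) : bddIntegrable μ →ₗ[ℂ] Lp ℂ 2 μ where
  toFun h := (IsBddIntegrable.memLp h.2).toLp h.1
  map_add' _ _ := rfl
  map_smul' _ _ := rfl

/-- Simple functions are dense in `L²`, and those in `L²` are bounded and integrable. -/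
lemma denseRange_bddIntegrableToLp (μ : Measure X) : DenseRange (bddIntegrableToLp μ) := by
  have : Fact ((1 : ℝ≥0∞) ≤ 2) := inferInstance
  refine (Lp.simpleFunc.denseRange (E := ℂ) (μ := μ) (p := 2) ENNReal.ofNat_ne_top).mono ?_
  rintro _ ⟨f, rfl⟩
  have h1 := Lp.simpleFunc.memLp f
  rw [SimpleFunc.memLp_iff_integrable two_ne_zero ENNReal.ofNat_ne_top] at h1
  have h2 : IsBddIntegrable μ (Lp.simpleFunc.toSimpleFunc f) :=
    ⟨SimpleFunc.measurable _, SimpleFunc.exists_forall_norm_le _, h1⟩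
  refine ⟨⟨_, h2⟩, ?_⟩
  refine Lp.ext ?_
  refine (MemLp.coeFn_toLp h2.memLp).trans ?_
  exact Lp.simpleFunc.toSimpleFunc_eq_toFun f

end BddIntegrable

/-! ### The Fourier transform from Q to V along η -/

section Cocycle

variable {Q V : Type*} [Group Q] [TopologicalSpace Q] [IsTopologicalGroup Q]
  [LocallyCompactSpace Q] [SecondCountableTopology Q] [MeasurableSpace Q] [BorelSpace Q]
  [CommGroup V] [TopologicalSpace V] [IsTopologicalGroup V]
  [LocallyCompactSpace V] [T2Space V] [SecondCountableTopology V]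
  [MeasurableSpace V] [BorelSpace V] [MulDistribMulAction Q V] [ContinuousSMul Q V]
  [MeasurableSpace (PontryaginDual V)] [BorelSpace (PontryaginDual V)]
  {μQ : Measure Q} [μQ.IsHaarMeasure] {μV : Measure V} [μV.IsHaarMeasure]
  {μV' : Measure (PontryaginDual V)} [μV'.IsHaarMeasure]
  {η : Q → PontryaginDual V}

/-- The Plancherel constant of `η`. -/
def IsPlancherelConst (μQ : Measure Q) (μV : Measure V) (η : Q → PontryaginDual V) (c : ℝ≥0∞) :
    Prop :=
  c ≠ 0 ∧ c ≠ ∞ ∧ ∀ h : V → ℂ, IsBddIntegrable μV h →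
      c * ∫⁻ q, ‖fourier μV h (η q)‖ₑ ^ 2 * (modulus V q : ℝ≥0∞)⁻¹ ∂μQ =
        ∫⁻ v, ‖h v‖ₑ ^ 2 ∂μV

/-- The Fourier transform along `η` of a function on `Q`. -/
def cofourier (μQ : Measure Q) (η : Q → PontryaginDual V) (u : Q → ℂ) (v : V) : ℂ :=
  ∫ q, u q * starRingEnd ℂ (η q v : ℂ) ∂μQ

lemma continuous_eval_cocycle (hη : IsOneCocycle η) :
    Continuous fun p : Q × V => (η p.1 p.2 : ℂ) :=
  continuous_dual_eval_coe.comp ((hη.continuous.comp continuous_fst).prodMk continuous_snd)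

lemma continuous_eval_cocycle_left (hη : IsOneCocycle η) (v : V) :
    Continuous fun q : Q => (η q v : ℂ) :=
  (continuous_eval_cocycle hη).comp (Continuous.prodMk_left v)

lemma integrable_mul_conj_eval (hη : IsOneCocycle η) {u : Q → ℂ} (hu : Integrable u μQ) (v : V) :
    Integrable (fun q => u q * starRingEnd ℂ (η q v : ℂ)) μQ :=
  hu.mul_bdd (c := 1) (continuous_star.comp (continuous_eval_cocycle_left hη v)).aestronglyMeasurable
    (Filter.Eventually.of_forall fun q => by rw [RCLike.norm_conj]; exact (Circle.norm_coe _).le)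

lemma norm_cofourier_le (u : Q → ℂ) (v : V) : ‖cofourier μQ η u v‖ ≤ ∫ q, ‖u q‖ ∂μQ := by
  refine (norm_integral_le_integral_norm _).trans (le_of_eq ?_)
  simp only [norm_mul, RCLike.norm_conj, Circle.norm_coe, mul_one]

lemma continuous_cofourier (hη : IsOneCocycle η) {u : Q → ℂ} (hu : Integrable u μQ) :
    Continuous (cofourier μQ η u) := by
  refine continuous_of_dominated (bound := fun x => ‖u x‖)
    (fun v => (integrable_mul_conj_eval hη hu v).1) (fun v => ?_) hu.norm ?_
  · filter_upwards with x
    rw [norm_mul, RCLike.norm_conj, Circle.norm_coe, mul_one]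
  · filter_upwards with x
    exact continuous_const.mul (continuous_star.comp
      ((continuous_eval_cocycle hη).comp (Continuous.prodMk_right x)))

/-- By Fubini, `cofourier` is the formal adjoint of `h ↦ fourier μV h ∘ η`. -/
lemma integral_cofourier_mul_conj (hη : IsOneCocycle η) {u : Q → ℂ} (hu : Integrable u μQ)
    {h : V → ℂ} (hh : Integrable h μV) :
    ∫ v, cofourier μQ η u v * starRingEnd ℂ (h v) ∂μV =
      ∫ q, u q * starRingEnd ℂ (fourier μV h (η q)) ∂μQ := by
  unfold cofourier fourier
  simp only [← integral_mul_const, ← integral_const_mul, ← integral_conj]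
  rw [integral_integral_swap]
  · refine integral_congr_ae (Filter.Eventually.of_forall fun q => ?_)
    refine integral_congr_ae (Filter.Eventually.of_forall fun v => ?_)
    simp only [map_mul]
    ring
  · have h1 : Integrable (fun p : V × Q => starRingEnd ℂ (h p.1) * u p.2) (μV.prod μQ) :=
      (integrable_conj hh).mul_prod hu
    have h2 : Continuous fun p : V × Q => starRingEnd ℂ (η p.2 p.1 : ℂ) :=
      continuous_star.comp ((continuous_eval_cocycle hη).comp continuous_swap)
    have h3 := h1.mul_bdd (c := 1) h2.aestronglyMeasurable
      (Filter.Eventually.of_forall fun q => by rw [RCLike.norm_conj]; exact (Circle.norm_coe _).le)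
    refine h3.congr (Filter.Eventually.of_forall fun p => ?_)
    simp only [Function.uncurry]
    ring

/-- An a priori bound by duality: the transform of `u` is paired with its own truncations, the
pairing is moved to `Q`, and Plancherel controls the truncations there. -/
lemma memLp_cofourier {c : ℝ≥0∞} (hη : IsOneCocycle η) (hc : IsPlancherelConst μQ μV η c)
    {u : Q → ℂ} (hu : Integrable u μQ) (hfin : ∫⁻ q, ‖u q‖ₑ ^ 2 * modulus V q ∂μQ < ∞) :
    MemLp (cofourier μQ η u) 2 μV := by
  obtain ⟨hc0, hct, hc⟩ := hc
  have hcont := continuous_cofourier hη hu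
  rw [← lintegral_enorm_sq_lt_top_iff hcont.aestronglyMeasurable]
  set A := ∫⁻ q, ‖u q‖ₑ ^ 2 * modulus V q ∂μQ
  -- On a set of finite measure the quantity `X` below is finite, so it can be cancelled from `X ^ 2
  -- ≤ A * (c⁻¹ * X)`.
  suffices h : ∀ E : Set V, MeasurableSet E → μV E < ∞ →
      ∫⁻ v in E, ‖cofourier μQ η u v‖ₑ ^ 2 ∂μV ≤ A * c⁻¹ by
    refine lt_of_le_of_lt ?_ (ENNReal.mul_lt_top hfin (ENNReal.inv_lt_top.2 (pos_iff_ne_zero.2 hc0)))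
    rw [← setLIntegral_univ, ← iUnion_spanningSets μV,
      setLIntegral_iUnion_of_directed _ (monotone_spanningSets μV).directed_le]
    exact iSup_le fun n => h _ (measurableSet_spanningSets μV n) (measure_spanningSets_lt_top μV n)
  intro E hE hEt
  set h : V → ℂ := E.indicator (cofourier μQ η u)
  have hhm : Measurable h := hcont.measurable.indicator hE
  have hb : ∀ v, ‖h v‖ ≤ ∫ q, ‖u q‖ ∂μQ := fun v => by
    refine (norm_indicator_le_norm_self _ _).trans (norm_cofourier_le u v)
  have hh : IsBddIntegrable μV h := by
    refine ⟨hhm, ⟨_, hb⟩, ?_⟩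
    rw [integrable_indicator_iff hE]
    exact Measure.integrableOn_of_bounded hEt.ne hcont.aestronglyMeasurable
      (Filter.Eventually.of_forall fun v => norm_cofourier_le u v)
  set X := ∫⁻ v, ‖h v‖ₑ ^ 2 ∂μV with hX
  have hX' : X = ∫⁻ v in E, ‖cofourier μQ η u v‖ₑ ^ 2 ∂μV := by
    rw [hX, ← lintegral_indicator hE]
    refine lintegral_congr fun v => ?_
    by_cases hv : v ∈ E <;> simp [h, hv]
  have hXt : X ≠ ∞ := ((lintegral_enorm_sq_lt_top_iff hhm.aestronglyMeasurable).2 hh.memLp).ne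
  rw [← hX']
  have h1 : X = ‖∫ v, cofourier μQ η u v * starRingEnd ℂ (h v) ∂μV‖ₑ := by
    have h2 : ∀ v, cofourier μQ η u v * starRingEnd ℂ (h v) = ((‖h v‖ ^ 2 : ℝ) : ℂ) := by
      intro v
      by_cases hv : v ∈ E
      · simp [h, hv, Complex.mul_conj, Complex.normSq_eq_norm_sq]
      · simp [h, hv]
    simp only [h2]
    rw [integral_complex_ofReal, ← ofReal_norm, Complex.norm_real, Real.norm_of_nonneg
      (integral_nonneg fun v => by positivity), ofReal_integral_eq_lintegral_ofReal]
    · refine lintegral_congr fun v => ?_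
      rw [ENNReal.ofReal_pow (norm_nonneg _), ofReal_norm]
    · exact (memLp_two_iff_integrable_sq_norm hhm.aestronglyMeasurable).1 hh.memLp
    · exact Filter.Eventually.of_forall fun v => by positivity
  have hδ : Measurable fun q : Q => (modulus V q : ℝ≥0∞) := measurable_modulus.coe_nnreal_ennreal
  have hδ0 : ∀ q : Q, (modulus V q : ℝ≥0∞) ≠ 0 := fun q => by exact_mod_cast modulus_ne_zero q
  have hsq : ∀ x : ℝ≥0∞, (x ^ (1 / 2 : ℝ)) ^ 2 = x := fun x => by
    rw [← ENNReal.rpow_natCast, ← ENNReal.rpow_mul]; norm_num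
  have h3 : X ^ 2 ≤ A * (c⁻¹ * X) := by
    -- The square roots of the modulus and of its inverse are inserted so that Cauchy–Schwarz yields
    -- `A` in one factor and the Plancherel integral in the other.
    have h4 : X ≤ ∫⁻ q, (‖u q‖ₑ * (modulus V q : ℝ≥0∞) ^ (1 / 2 : ℝ)) *
        (‖fourier μV h (η q)‖ₑ * ((modulus V q : ℝ≥0∞)⁻¹) ^ (1 / 2 : ℝ)) ∂μQ := by
      rw [h1, integral_cofourier_mul_conj hη hu hh.integrable]
      refine (enorm_integral_le_lintegral_enorm _).trans (lintegral_mono fun q => ?_)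
      rw [enorm_mul, mul_mul_mul_comm, ← ENNReal.mul_rpow_of_nonneg _ _ (by norm_num),
        ENNReal.mul_inv_cancel (hδ0 q) ENNReal.coe_ne_top, ENNReal.one_rpow, mul_one,
        RCLike.enorm_conj]
    have hf : Measurable fun q => fourier μV h (η q) :=
      ((continuous_fourier hh.integrable).comp hη.continuous).measurable
    refine (pow_le_pow_left' h4 2).trans ((lintegral_enorm_mul_sq_le
      (f := fun q => ‖u q‖ₑ * (modulus V q : ℝ≥0∞) ^ (1 / 2 : ℝ))
      (g := fun q => ‖fourier μV h (η q)‖ₑ * ((modulus V q : ℝ≥0∞)⁻¹) ^ (1 / 2 : ℝ))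
      (hu.1.enorm.mul (hδ.pow_const _).aemeasurable)
      (hf.enorm.mul (hδ.inv.pow_const _)).aemeasurable).trans (le_of_eq ?_))
    simp only [mul_pow, hsq]
    rw [hX, ← hc h hh, ← mul_assoc c⁻¹, ENNReal.inv_mul_cancel hc0 hct, one_mul]
  rcases eq_or_ne X 0 with h0 | h0
  · rw [h0]; exact bot_le
  · rw [sq, ← mul_assoc] at h3
    exact (ENNReal.mul_le_mul_iff_left h0 hXt).1 h3

/-- Modulation moves `ξ` to the trivial character, where the transform of an indicator function is
the measure of the set. -/
lemma exists_fourier_ne_zero (μV : Measure V) [μV.IsHaarMeasure] (ξ : PontryaginDual V) :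
    ∃ h : V → ℂ, IsBddIntegrable μV h ∧ fourier μV h ξ ≠ 0 := by
  obtain ⟨K, hKc, hK1⟩ := exists_compact_mem_nhds (1 : V)
  have hKm := hKc.measurableSet
  have hK0 : μV K ≠ 0 := (Measure.measure_pos_of_mem_nhds μV hK1).ne'
  have hKt : μV K ≠ ∞ := hKc.measure_lt_top.ne
  have h1 : IsBddIntegrable μV (K.indicator fun _ => (1 : ℂ)) := by
    refine ⟨measurable_const.indicator hKm, ⟨1, fun x => ?_⟩, ?_⟩
    · refine (norm_indicator_le_norm_self _ _).trans (by simp)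
    · exact (integrable_indicator_iff hKm).2 (integrableOn_const hKt)
  refine ⟨_, h1.mul_eval ξ⁻¹, ?_⟩
  rw [fourier_mul_eval, mul_inv_cancel, fourier]
  have h2 : ∀ x, K.indicator (fun _ => (1 : ℂ)) x * ((1 : PontryaginDual V) x : ℂ) =
      K.indicator (fun _ => (1 : ℂ)) x := fun x => by
    change _ * ((1 : Circle) : ℂ) = _
    simp
  simp only [h2]
  rw [integral_indicator hKm, setIntegral_const]
  simp [Measure.real, ENNReal.toReal_eq_zero_iff, hK0, hKt]

lemma fourier_translate (h : V → ℂ) (w : V) (ξ : PontryaginDual V) :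
    fourier μV (fun x => h (w⁻¹ * x)) ξ = fourier μV h ξ * ξ w := by
  unfold fourier
  rw [← integral_mul_left_eq_self _ w, ← integral_mul_const]
  refine integral_congr_ae (Filter.Eventually.of_forall fun x => ?_)
  simp only [inv_mul_cancel_left, map_mul, Circle.coe_mul]
  ring

lemma IsBddIntegrable.translate {h : V → ℂ} (hh : IsBddIntegrable μV h) (w : V) :
    IsBddIntegrable μV (fun x => h (w⁻¹ * x)) := by
  obtain ⟨C, hC⟩ := hh.bdd
  exact ⟨hh.measurable.comp (measurable_const_mul _), ⟨C, fun v => hC _⟩,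
    hh.integrable.comp_mul_left w⁻¹⟩

/-- A locally square integrable function on `Q` which is orthogonal to the Fourier transforms of
all bounded integrable functions vanishes. -/
lemma ae_eq_zero_of_forall_integral_fourier (μV : Measure V) [μV.IsHaarMeasure]
    (hη : IsOneCocycle η) (hiso : IsMeasureClassIso μQ μV' η) {w : Q → ℂ}
    (hw : ∀ h : V → ℂ, IsBddIntegrable μV h →
      Integrable (fun q => w q * starRingEnd ℂ (fourier μV h (η q))) μQ)
    (h0 : ∀ h : V → ℂ, IsBddIntegrable μV h →
      ∫ q, w q * starRingEnd ℂ (fourier μV h (η q)) ∂μQ = 0) : w =ᵐ[μQ] 0 := by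
  choose h hh hne using exists_fourier_ne_zero (V := V) μV
  have hae : ∀ ξ, ∀ᵐ q ∂μQ, fourier μV (h ξ) (η q) ≠ 0 → w q = 0 := by
    intro ξ
    -- Translating `h ξ` multiplies its transform by a character value, so the hypothesis says that
    -- this integrable product has vanishing transform along `η`.
    have h1 : (fun q => w q * starRingEnd ℂ (fourier μV (h ξ) (η q))) =ᵐ[μQ] 0 := by
      refine ae_eq_zero_of_forall_integral_eval hη hiso (hw _ (hh ξ)) fun v => ?_
      rw [← h0 _ ((hh ξ).translate v⁻¹)]
      refine integral_congr_ae (Filter.Eventually.of_forall fun q => ?_)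
      simp only
      rw [fourier_translate, map_mul, map_inv, Circle.coe_inv_eq_conj, Complex.conj_conj, mul_assoc]
    filter_upwards [h1] with q hq hq'
    rcases mul_eq_zero.1 hq with h2 | h2
    · exact h2
    · exact absurd ((map_eq_zero _).1 h2) hq'
  -- By the Lindelöf property countably many nonvanishing sets cover the dual, so only countably
  -- many null sets have to be combined.
  obtain ⟨T, hTc, hT⟩ := TopologicalSpace.isOpen_iUnion_countable
    (fun ξ => {ζ | fourier μV (h ξ) ζ ≠ 0})
    (fun ξ => isOpen_ne_fun (continuous_fourier (hh ξ).integrable) continuous_const)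
  have h2 : ∀ᵐ q ∂μQ, ∀ ξ ∈ T, fourier μV (h ξ) (η q) ≠ 0 → w q = 0 :=
    (ae_ball_iff hTc).2 fun ξ _ => hae ξ
  filter_upwards [h2] with q hq
  have h3 : η q ∈ ⋃ ξ ∈ T, {ζ | fourier μV (h ξ) ζ ≠ 0} := by
    rw [hT]; exact Set.mem_iUnion.2 ⟨η q, hne (η q)⟩
  obtain ⟨ξ, hξ, h4⟩ := Set.mem_iUnion₂.1 h3
  exact hq ξ hξ h4

/-- With `ρ² = c / modulus`, Plancherel makes `h ↦ ρ * (ĥ ∘ η)` extend to an isometry `L` of `L²`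
spaces. If `k` is the image under `L` of the transform of `u`, then `u - ρ * k` is orthogonal to
every `ĥ ∘ η`, so `u = ρ * k` and the norms can be compared. Surjectivity of `L` is not needed. -/
lemma lintegral_cofourier_of_memLp {c : ℝ≥0∞} (hη : IsOneCocycle η)
    (hiso : IsMeasureClassIso μQ μV' η) (hc : IsPlancherelConst μQ μV η c)
    {u : Q → ℂ} (hu : Integrable u μQ) (hL : MemLp (cofourier μQ η u) 2 μV) :
    ∫⁻ v, ‖cofourier μQ η u v‖ₑ ^ 2 ∂μV = c⁻¹ * ∫⁻ q, ‖u q‖ₑ ^ 2 * modulus V q ∂μQ := by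
  obtain ⟨hc0, hct, hc⟩ := hc
  have hδm : Measurable fun q : Q => (modulus V q : ℝ) := measurable_modulus.coe_nnreal_real
  set ρ : Q → ℝ := fun q => √(c.toReal * (modulus V q : ℝ)⁻¹)
  have hρm : Measurable ρ := (hδm.inv.const_mul _).sqrt
  have hcpos : 0 < c.toReal := ENNReal.toReal_pos hc0 hct
  have hδpos : ∀ q : Q, 0 < (modulus V q : ℝ) := fun q =>
    NNReal.coe_pos.2 (pos_iff_ne_zero.2 (modulus_ne_zero q))
  have hρpos : ∀ q, 0 < ρ q := fun q => Real.sqrt_pos.2 (mul_pos hcpos (inv_pos.2 (hδpos q)))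
  have hρe : ∀ q, ‖(ρ q : ℂ)‖ₑ ^ 2 = c * (modulus V q : ℝ≥0∞)⁻¹ := by
    intro q
    rw [← ofReal_norm, Complex.norm_real, Real.norm_of_nonneg (hρpos q).le,
      ← ENNReal.ofReal_pow (hρpos q).le, Real.sq_sqrt (mul_pos hcpos (inv_pos.2 (hδpos q))).le,
      ENNReal.ofReal_mul hcpos.le, ENNReal.ofReal_toReal hct, ENNReal.ofReal_inv_of_pos (hδpos q),
      ENNReal.ofReal_coe_nnreal]
  have hFm : ∀ h : bddIntegrable μV,
      Measurable fun q => (ρ q : ℂ) * fourier μV h.1 (η q) := fun h =>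
    hρm.complex_ofReal.mul ((continuous_fourier h.2.integrable).comp hη.continuous).measurable
  have hFn : ∀ h : bddIntegrable μV, ∫⁻ q, ‖(ρ q : ℂ) * fourier μV h.1 (η q)‖ₑ ^ 2 ∂μQ =
      ∫⁻ v, ‖h.1 v‖ₑ ^ 2 ∂μV := by
    intro h
    rw [← hc h.1 h.2, ← lintegral_const_mul' _ _ hct]
    refine lintegral_congr fun q => ?_
    rw [enorm_mul, mul_pow, hρe]
    ring
  have hFL : ∀ h : bddIntegrable μV,
      MemLp (fun q => (ρ q : ℂ) * fourier μV h.1 (η q)) 2 μQ := fun h => by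
    rw [← lintegral_enorm_sq_lt_top_iff (hFm h).aestronglyMeasurable, hFn,
      lintegral_enorm_sq_lt_top_iff h.2.measurable.aestronglyMeasurable]
    exact IsBddIntegrable.memLp h.2
  let F : bddIntegrable μV →ₗ[ℂ] Lp ℂ 2 μQ :=
    { toFun := fun h => (hFL h).toLp _
      map_add' := fun h k => by
        rw [← MemLp.toLp_add]
        refine MemLp.toLp_congr _ _ (Filter.Eventually.of_forall fun q => ?_)
        simp only [fourier, Submodule.coe_add, Pi.add_apply, add_mul]
        rw [integral_add (integrable_mul_eval h.2.integrable _)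
          (integrable_mul_eval k.2.integrable _), mul_add]
      map_smul' := fun a h => by
        rw [RingHom.id_apply, ← MemLp.toLp_const_smul]
        refine MemLp.toLp_congr _ _ (Filter.Eventually.of_forall fun q => ?_)
        simp only [fourier, Submodule.coe_smul, Pi.smul_apply, smul_eq_mul, mul_assoc]
        rw [integral_const_mul]
        ring }
  have hFnorm : ∀ h, ‖F h‖ = ‖bddIntegrableToLp μV h‖ := by
    intro h
    have h1 : ‖F h‖ₑ ^ 2 = ‖bddIntegrableToLp μV h‖ₑ ^ 2 := by
      change ‖(hFL h).toLp _‖ₑ ^ 2 = ‖(IsBddIntegrable.memLp h.2).toLp h.1‖ₑ ^ 2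
      rw [enorm_sq_toLp, enorm_sq_toLp, hFn]
    have h2 := (ENNReal.pow_right_strictMono two_ne_zero).injective h1
    rw [← toReal_enorm, h2, toReal_enorm]
  have hd := denseRange_bddIntegrableToLp μV
  have hext : ∀ h, F.extendOfNorm (bddIntegrableToLp μV) (bddIntegrableToLp μV h) = F h :=
    LinearMap.extendOfNorm_eq hd ⟨1, fun h => by rw [hFnorm, one_mul]⟩
  set 𝓕 := F.extendOfNorm (bddIntegrableToLp μV)
  have hiso𝓕 : ∀ f, ‖𝓕 f‖ = ‖f‖ := fun f => by
    refine hd.induction (P := fun f => ‖𝓕 f‖ = ‖f‖) ?_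
      (isClosed_eq (by fun_prop) (by fun_prop)) f
    rintro _ ⟨h, rfl⟩
    rw [hext, hFnorm]
  let L : Lp ℂ 2 μV →ₗᵢ[ℂ] Lp ℂ 2 μQ := ⟨𝓕.toLinearMap, hiso𝓕⟩
  set U := hL.toLp _
  set k := L U
  have hin : ∀ h : bddIntegrable μV, ∀ᵐ q ∂μQ, k q * starRingEnd ℂ (F h q) =
      (ρ q : ℂ) * k q * starRingEnd ℂ (fourier μV h.1 (η q)) := by
    intro h
    filter_upwards [(hFL h).coeFn_toLp] with q hq
    change k q * starRingEnd ℂ ((hFL h).toLp _ q) = _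
    rw [hq, map_mul, Complex.conj_ofReal]
    ring
  have hI1 : ∀ h : bddIntegrable μV,
      Integrable (fun q => (ρ q : ℂ) * k q * starRingEnd ℂ (fourier μV h.1 (η q))) μQ := by
    intro h
    refine (L2.integrable_inner (𝕜 := ℂ) (F h) k).congr ?_
    filter_upwards [hin h] with q hq
    rw [← hq, RCLike.inner_apply]
  have hI2 : ∀ h : bddIntegrable μV,
      Integrable (fun q => u q * starRingEnd ℂ (fourier μV h.1 (η q))) μQ := by
    intro h
    refine hu.mul_bdd (c := ∫ x, ‖h.1 x‖ ∂μV) ?_ (Filter.Eventually.of_forall fun q => ?_)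
    · exact (continuous_star.comp
        ((continuous_fourier h.2.integrable).comp hη.continuous)).aestronglyMeasurable
    · rw [RCLike.norm_conj]; exact norm_fourier_le _ _ _
  have hz : (fun q => u q - ρ q * k q) =ᵐ[μQ] 0 := by
    refine ae_eq_zero_of_forall_integral_fourier μV hη hiso (fun h hh => ?_) fun h hh => ?_
    · simp only [sub_mul]
      exact (hI2 ⟨h, hh⟩).sub (hI1 ⟨h, hh⟩)
    · simp only [sub_mul]
      rw [integral_sub (hI2 ⟨h, hh⟩) (hI1 ⟨h, hh⟩), sub_eq_zero,
        ← integral_cofourier_mul_conj hη hu hh.integrable]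
      have h1 : inner ℂ (L (bddIntegrableToLp μV ⟨h, hh⟩)) (L U) =
          inner ℂ (bddIntegrableToLp μV ⟨h, hh⟩) U := L.inner_map_map _ _
      have h2 : L (bddIntegrableToLp μV ⟨h, hh⟩) = F ⟨h, hh⟩ := hext _
      rw [h2, L2.inner_def, L2.inner_def] at h1
      rw [← integral_congr_ae (hin ⟨h, hh⟩)]
      simp only [RCLike.inner_apply] at h1
      rw [h1]
      refine integral_congr_ae ?_
      filter_upwards [hL.coeFn_toLp, (IsBddIntegrable.memLp hh).coeFn_toLp] with v h3 h4
      change _ = U v * starRingEnd ℂ ((IsBddIntegrable.memLp hh).toLp h v)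
      rw [h3, h4]
  have hkU : ‖k‖ₑ = ‖U‖ₑ := by
    rw [← ofReal_norm, ← ofReal_norm]; congr 1; exact L.norm_map U
  rw [← enorm_sq_toLp hL, ← hkU, enorm_sq_Lp, ← lintegral_const_mul' _ _ (ENNReal.inv_ne_top.2 hc0)]
  refine lintegral_congr_ae ?_
  filter_upwards [hz] with q hq
  have h1 : u q = ρ q * k q := sub_eq_zero.1 hq
  have hδ0 : (modulus V q : ℝ≥0∞) ≠ 0 := by exact_mod_cast modulus_ne_zero q
  rw [h1, enorm_mul, mul_pow, hρe]
  calc ‖k q‖ₑ ^ 2 = (c⁻¹ * c) * ((modulus V q : ℝ≥0∞)⁻¹ * modulus V q) * ‖k q‖ₑ ^ 2 := by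
        rw [ENNReal.inv_mul_cancel hc0 hct, ENNReal.inv_mul_cancel hδ0 ENNReal.coe_ne_top]; simp
    _ = _ := by ring

/-- The Plancherel formula for the Fourier transform from `Q` to `V` along `η`. -/
theorem lintegral_cofourier {c : ℝ≥0∞} (hη : IsOneCocycle η)
    (hiso : IsMeasureClassIso μQ μV' η) (hc : IsPlancherelConst μQ μV η c)
    {u : Q → ℂ} (hu : Integrable u μQ) :
    ∫⁻ v, ‖cofourier μQ η u v‖ₑ ^ 2 ∂μV = c⁻¹ * ∫⁻ q, ‖u q‖ₑ ^ 2 * modulus V q ∂μQ := by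
  by_cases hL : MemLp (cofourier μQ η u) 2 μV
  · exact lintegral_cofourier_of_memLp hη hiso hc hu hL
  · have h1 : ∫⁻ v, ‖cofourier μQ η u v‖ₑ ^ 2 ∂μV = ∞ := by
      by_contra h
      exact hL ((lintegral_enorm_sq_lt_top_iff
        (continuous_cofourier hη hu).aestronglyMeasurable).1 (lt_top_iff_ne_top.2 h))
    have h2 : ∫⁻ q, ‖u q‖ₑ ^ 2 * modulus V q ∂μQ = ∞ := by
      by_contra h
      exact hL (memLp_cofourier hη hc hu (lt_top_iff_ne_top.2 h))
    rw [h1, h2, ENNReal.mul_top (ENNReal.inv_ne_zero.2 hc.2.1)]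

end Cocycle

/-- The left Haar measure is transformed by inversion with an everywhere positive density. -/
lemma exists_inv_density {Q : Type*} [Group Q] [TopologicalSpace Q] [IsTopologicalGroup Q]
    [LocallyCompactSpace Q] [SecondCountableTopology Q] [MeasurableSpace Q] [BorelSpace Q]
    (μ : Measure Q) [μ.IsHaarMeasure] :
    ∃ d : Q → ℝ≥0, Measurable d ∧ (∀ q, d q ≠ 0) ∧ ∀ F : Q → ℝ≥0∞, Measurable F →
      ∫⁻ q, F q⁻¹ ∂μ = ∫⁻ q, d q * F q ∂μ := by
  have h1 := Measure.withDensity_rnDeriv_eq _ _ (inv_absolutelyContinuous μ)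
  have h2 : ∀ᵐ q ∂μ, 0 < μ.inv.rnDeriv μ q := Measure.rnDeriv_pos' (absolutelyContinuous_inv μ)
  have h3 := Measure.rnDeriv_lt_top μ.inv μ
  have hm : Measurable fun q => (μ.inv.rnDeriv μ q).toNNReal :=
    (Measure.measurable_rnDeriv _ _).ennreal_toNNReal
  -- The Radon–Nikodym derivative is positive and finite only almost everywhere; the value `1` on
  -- the exceptional set makes `d` vanish nowhere.
  refine ⟨fun q => if (μ.inv.rnDeriv μ q).toNNReal = 0 then 1 else (μ.inv.rnDeriv μ q).toNNReal,
    Measurable.ite (hm (measurableSet_singleton 0)) measurable_const hm, fun q => ?_,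
    fun F hF => ?_⟩
  · dsimp only
    split_ifs with h
    · exact one_ne_zero
    · exact h
  · have h4 : ∫⁻ q, F q⁻¹ ∂μ = ∫⁻ q, F q ∂μ.inv := by
      rw [Measure.inv, lintegral_map hF measurable_inv]
    rw [h4]
    conv_lhs => rw [← h1]
    rw [lintegral_withDensity_eq_lintegral_mul _ (Measure.measurable_rnDeriv _ _) hF]
    refine lintegral_congr_ae ?_
    filter_upwards [h2, h3] with q h5 h6
    have h7 : (μ.inv.rnDeriv μ q).toNNReal ≠ 0 := by
      simp [ENNReal.toNNReal_eq_zero_iff, h5.ne', h6.ne]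
    simp only [Pi.mul_apply, h7, if_false, ENNReal.coe_toNNReal h6.ne]

/-! ### Borel coordinates and Haar measure of the extension -/

section Extension

variable {Q V G : Type*} [Group Q] [TopologicalSpace Q] [IsTopologicalGroup Q]
  [LocallyCompactSpace Q] [T2Space Q]
  [SecondCountableTopology Q] [MeasurableSpace Q] [BorelSpace Q]
  [CommGroup V] [TopologicalSpace V] [IsTopologicalGroup V]
  [LocallyCompactSpace V] [T2Space V] [SecondCountableTopology V]
  [MeasurableSpace V] [BorelSpace V] [MulDistribMulAction Q V] [ContinuousSMul Q V]
  [Group G] [TopologicalSpace G] [IsTopologicalGroup G] [LocallyCompactSpace G] [T2Space G]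
  [SecondCountableTopology G] [MeasurableSpace G] [BorelSpace G]
  {S : GroupExtension V G Q} {σ : S.Section} {β : Q → Q → V}

lemma rightHom_inl_mul (S : GroupExtension V G Q) (v : V) (g : G) :
    S.rightHom (S.inl v * g) = S.rightHom g := by
  rw [map_mul, S.rightHom_inl, one_mul]

lemma vPart_inl_mul (S : GroupExtension V G Q) (σ : S.Section) (v : V) (q : Q) :
    vPart S σ (S.inl v * σ q) = v := by
  apply S.inl_injective
  have h := inl_vPart_mul S σ (S.inl v * σ q)
  rwa [rightHom_inl_mul, GroupExtension.Section.rightHom_section, mul_left_inj] at h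

/-- The image is the kernel of the continuous map `S.rightHom`, hence closed. -/
lemma measurableEmbedding_inl (hS : IsTopExtension S) : MeasurableEmbedding S.inl := by
  refine Topology.IsClosedEmbedding.measurableEmbedding ⟨hS.isEmbedding_inl, ?_⟩
  have h : Set.range S.inl = S.rightHom ⁻¹' {1} := by
    ext g
    exact SetLike.ext_iff.1 S.range_inl_eq_ker_rightHom g
  rw [h]
  exact isClosed_singleton.preimage hS.continuous_rightHom

/-- Measurability may be tested after the measurable embedding `S.inl`, where the map becomes `g *
(σ (S.rightHom g))⁻¹`. -/
lemma measurable_vPart (hS : IsTopExtension S) (hσ : Measurable σ) : Measurable (vPart S σ) := by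
  rw [← (measurableEmbedding_inl hS).measurable_comp_iff]
  have h : S.inl ∘ vPart S σ = fun g => g * (σ (S.rightHom g))⁻¹ := by
    funext g
    rw [Function.comp_apply, eq_mul_inv_iff_mul_eq, inl_vPart_mul]
  rw [h]
  exact measurable_id.mul (hσ.comp hS.continuous_rightHom.measurable).inv

/-- The identification of `G` with `Q × V` as a Borel space. -/
def extensionEquiv (hS : IsTopExtension S) (hσ : Measurable σ) : Q × V ≃ᵐ G where
  toFun p := S.inl p.2 * σ p.1
  invFun g := (S.rightHom g, vPart S σ g)
  left_inv p := by
    ext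
    · simp only [rightHom_inl_mul, GroupExtension.Section.rightHom_section]
    · exact vPart_inl_mul S σ p.2 p.1
  right_inv g := inl_vPart_mul S σ g
  measurable_toFun := ((measurableEmbedding_inl hS).measurable.comp measurable_snd).mul
    (hσ.comp measurable_fst)
  measurable_invFun := hS.continuous_rightHom.measurable.prodMk (measurable_vPart hS hσ)

lemma extension_mul (hS : IsTopExtension S) (hβ : IsRepresentative S σ β) (q₁ q : Q) (v₁ v : V) :
    S.inl v₁ * σ q₁ * (S.inl v * σ q) = S.inl (v₁ * (q₁ • v) * β q₁ q) * σ (q₁ * q) := by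
  have h1 := hS.inl_smul (σ q₁) v
  rw [GroupExtension.Section.rightHom_section] at h1
  rw [map_mul, map_mul, h1, hβ.inl_cocycle]
  group

/-- The Haar measure of `G` in the coordinates of `Q × V`. -/
lemma exists_lintegral_extension (hS : IsTopExtension S) (hβ : IsRepresentative S σ β)
    (μQ : Measure Q) [μQ.IsHaarMeasure] (μV : Measure V) [μV.IsHaarMeasure]
    (μG : Measure G) [μG.IsHaarMeasure] :
    ∃ κ : ℝ≥0∞, κ ≠ 0 ∧ κ ≠ ∞ ∧
      μG = κ • ((μQ.withDensity fun q => (modulus V q : ℝ≥0∞)⁻¹).prod μV).map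
        (extensionEquiv hS hβ.measurable_section) := by
  set Φ := extensionEquiv hS hβ.measurable_section
  have hδ : Measurable fun q : Q => (modulus V q : ℝ≥0∞)⁻¹ :=
    measurable_modulus.coe_nnreal_ennreal.inv
  have hδ0 : ∀ q : Q, (modulus V q : ℝ≥0∞) ≠ 0 := fun q => by exact_mod_cast modulus_ne_zero q
  set μ' := μQ.withDensity fun q => (modulus V q : ℝ≥0∞)⁻¹
  have hσ' : SigmaFinite μ' := by
    have h : μ' = μQ.withDensity fun q => (((modulus V q)⁻¹ : ℝ≥0) : ℝ≥0∞) := by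
      simp only [μ', ENNReal.coe_inv (modulus_ne_zero _)]
    rw [h]; exact SigmaFinite.withDensity _
  set ν := (μ'.prod μV).map Φ
  have hν : ∀ F : G → ℝ≥0∞, Measurable F →
      ∫⁻ g, F g ∂ν = ∫⁻ q, (modulus V q : ℝ≥0∞)⁻¹ * ∫⁻ v, F (Φ (q, v)) ∂μV ∂μQ := by
    intro F hF
    rw [lintegral_map hF Φ.measurable, lintegral_prod (fun p => F (Φ p)) (hF.comp Φ.measurable).aemeasurable]
    exact lintegral_withDensity_eq_lintegral_mul _ hδ
      ((hF.comp Φ.measurable).lintegral_prod_right')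
  have hσ : SigmaFinite ν := Φ.sigmaFinite_map
  -- Left multiplication by `(q₁, v₁)` translates `q` by `q₁` and sends `v` to `v₁ * (q₁ • v) * β q₁
  -- q`. The modulus of `q₁` arising in the integral over `V` is compensated by the density in `q`.
  have hinv : ν.IsMulLeftInvariant := by
    refine ⟨fun g₁ => ?_⟩
    refine Measure.ext_of_lintegral _ fun F hF => ?_
    rw [lintegral_map hF (measurable_const_mul g₁), hν (fun g => F (g₁ * g))
      (hF.comp (measurable_const_mul g₁)), hν F hF]
    obtain ⟨⟨q₁, v₁⟩, rfl⟩ := Φ.surjective g₁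
    conv_rhs => rw [← lintegral_mul_left_eq_self _ q₁]
    refine lintegral_congr fun q => ?_
    have h1 : ∀ v, Φ (q₁, v₁) * Φ (q, v) = Φ (q₁ * q, v₁ * (q₁ • v) * β q₁ q) := fun v =>
      extension_mul hS hβ q₁ q v₁ v
    simp only [h1]
    have hF1 : Measurable fun v : V => F (Φ (q₁ * q, v)) :=
      hF.comp (Φ.measurable.comp measurable_prodMk_left)
    have hF2 : Measurable fun v : V => F (Φ (q₁ * q, v₁ * v * β q₁ q)) :=
      hF1.comp ((measurable_id.const_mul v₁).mul_const _)
    have h2 := modulus_mul_lintegral μV q₁ hF2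
    rw [show ∫⁻ v, F (Φ (q₁ * q, v₁ * v * β q₁ q)) ∂μV = ∫⁻ v, F (Φ (q₁ * q, v)) ∂μV by
      have h3 := lintegral_mul_right_eq_self (μ := μV)
        (fun v => F (Φ (q₁ * q, v₁ * v))) (β q₁ q)
      simp only [← mul_assoc] at h3
      rw [h3]
      exact lintegral_mul_left_eq_self (μ := μV) (fun v => F (Φ (q₁ * q, v))) v₁] at h2
    rw [modulus_mul, ENNReal.coe_mul, ENNReal.mul_inv (Or.inl (hδ0 _)) (Or.inl ENNReal.coe_ne_top),
      ← h2]
    calc (modulus V q : ℝ≥0∞)⁻¹ * ∫⁻ v, F (Φ (q₁ * q, v₁ * q₁ • v * β q₁ q)) ∂μV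
        = ((modulus V q₁ : ℝ≥0∞)⁻¹ * modulus V q₁) *
          ((modulus V q : ℝ≥0∞)⁻¹ * ∫⁻ v, F (Φ (q₁ * q, v₁ * q₁ • v * β q₁ q)) ∂μV) := by
          rw [ENNReal.inv_mul_cancel (hδ0 _) ENNReal.coe_ne_top, one_mul]
      _ = _ := by ring
  have hne : ν ≠ 0 := by
    intro h
    have h1 := hν 1 measurable_one
    rw [h] at h1
    simp only [Pi.one_apply, lintegral_one, Measure.coe_zero, Pi.zero_apply] at h1
    have h2 := (lintegral_eq_zero_iff (hδ.mul measurable_const)).1 h1.symm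
    have h3 : ∀ᵐ q ∂μQ, False := by
      filter_upwards [h2] with q hq
      refine mul_ne_zero (ENNReal.inv_ne_zero.2 ENNReal.coe_ne_top)
        (isOpen_univ.measure_ne_zero μV Set.univ_nonempty) hq
    rw [Filter.eventually_false_iff_eq_bot, ae_eq_bot] at h3
    exact isOpen_univ.measure_ne_zero μQ Set.univ_nonempty (by rw [h3]; rfl)
  obtain ⟨κ, h0, ht, h⟩ := exists_eq_smul_haar μG ν hne
  refine ⟨κ⁻¹, ENNReal.inv_ne_zero.2 ht, ENNReal.inv_ne_top.2 h0, ?_⟩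
  rw [h, smul_smul, ENNReal.inv_mul_cancel h0 ht, one_smul]

end Extension

/-! ### Multiplication operators on L² -/

section MulOp

variable {X : Type*} [MeasurableSpace X] {μ : Measure X}

/-- The (unbounded) operator of multiplication by a real measurable function on `L²`. -/
def mulOp (μ : Measure X) (r : X → ℝ) : Lp ℂ 2 μ →ₗ.[ℂ] Lp ℂ 2 μ where
  domain :=
    { carrier := {f | MemLp (fun x => (r x : ℂ) * f x) 2 μ}
      zero_mem' := by
        refine (MemLp.zero (ε := ℂ)).ae_eq ?_
        filter_upwards [Lp.coeFn_zero ℂ 2 μ] with x hx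
        change (0 : ℂ) = (r x : ℂ) * (0 : Lp ℂ 2 μ) x
        rw [hx, Pi.zero_apply, mul_zero]
      add_mem' := fun {f g} hf hg => by
        refine (hf.add hg).ae_eq ?_
        filter_upwards [Lp.coeFn_add f g] with x hx
        simp only [hx, Pi.add_apply, mul_add]
      smul_mem' := fun c f hf => by
        refine (hf.const_smul c).ae_eq ?_
        filter_upwards [Lp.coeFn_smul c f] with x hx
        simp only [hx, Pi.smul_apply, smul_eq_mul]
        ring }
  toFun :=
    { toFun := fun f => MemLp.toLp _ f.2
      map_add' := fun f g => by
        rw [← MemLp.toLp_add]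
        refine MemLp.toLp_congr _ _ ?_
        filter_upwards [Lp.coeFn_add f.1 g.1] with x hx
        simp only [Submodule.coe_add, hx, Pi.add_apply, mul_add]
      map_smul' := fun c f => by
        rw [RingHom.id_apply, ← MemLp.toLp_const_smul]
        refine MemLp.toLp_congr _ _ ?_
        filter_upwards [Lp.coeFn_smul c f.1] with x hx
        simp only [Submodule.coe_smul, hx, Pi.smul_apply, smul_eq_mul]
        ring }

lemma mulOp_apply_ae {r : X → ℝ} (f : (mulOp μ r).domain) :
    mulOp μ r f =ᵐ[μ] fun x => (r x : ℂ) * (f : Lp ℂ 2 μ) x :=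
  MemLp.coeFn_toLp f.2

lemma mem_graph_mulOp {r : X → ℝ} {f g : Lp ℂ 2 μ} :
    (f, g) ∈ (mulOp μ r).graph ↔ g =ᵐ[μ] fun x => (r x : ℂ) * f x := by
  rw [LinearPMap.mem_graph_iff]
  constructor
  · rintro ⟨y, rfl, h⟩
    rw [← show mulOp μ r y = g from h]
    exact mulOp_apply_ae y
  · intro h
    have h1 : f ∈ (mulOp μ r).domain := (Lp.memLp g).ae_eq h
    refine ⟨⟨f, h1⟩, rfl, Lp.ext ?_⟩
    exact (mulOp_apply_ae ⟨f, h1⟩).trans h.symm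

lemma formNormSq_mulOp {r : X → ℝ} (hr : Measurable r) (f : Lp ℂ 2 μ) :
    formNormSq (mulOp μ r) f = ∫⁻ x, ‖r x‖ₑ ^ 2 * ‖f x‖ₑ ^ 2 ∂μ := by
  have h1 : ∫⁻ x, ‖r x‖ₑ ^ 2 * ‖f x‖ₑ ^ 2 ∂μ = ∫⁻ x, ‖(r x : ℂ) * f x‖ₑ ^ 2 ∂μ := by
    refine lintegral_congr fun x => ?_
    rw [enorm_mul, mul_pow, ← ofReal_norm (r x : ℂ), Complex.norm_real, ofReal_norm]
  have hm : AEStronglyMeasurable (fun x => (r x : ℂ) * f x) μ :=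
    hr.complex_ofReal.aestronglyMeasurable.mul (Lp.aestronglyMeasurable f)
  unfold formNormSq
  split_ifs with h
  · rw [h1, enorm_sq_Lp]
    refine lintegral_congr_ae ?_
    filter_upwards [mulOp_apply_ae ⟨f, h⟩] with x hx
    rw [hx]
  · rw [h1]
    by_contra h2
    exact h ((lintegral_enorm_sq_lt_top_iff hm).1 (lt_top_iff_ne_top.2 (Ne.symm h2)))

/-- Test with the truncation of `z - r * y` to `{|r| ≤ n}`, which lies in the domain: its square
norm is zero. With `y = 0` this yields density of the domain; in general it shows that the adjoint
is contained in the operator. -/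
lemma ae_eq_mul_of_forall_inner {r : X → ℝ} (hr : Measurable r) {y z : Lp ℂ 2 μ}
    (h : ∀ x : (mulOp μ r).domain, inner ℂ z (x : Lp ℂ 2 μ) = inner ℂ y (mulOp μ r x)) :
    z =ᵐ[μ] fun x => (r x : ℂ) * y x := by
  have hE : ∀ n : ℕ, MeasurableSet {x | |r x| ≤ n} := fun n =>
    measurableSet_le hr.abs measurable_const
  have key : ∀ n : ℕ, ∀ᵐ x ∂μ, |r x| ≤ n → z x = r x * y x := by
    intro n
    set E := {x | |r x| ≤ n}
    have hbd : ∀ g : X → ℂ, MemLp g 2 μ → MemLp (E.indicator fun x => (r x : ℂ) * g x) 2 μ := by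
      intro g hg
      refine (hg.const_mul (n : ℂ)).of_le
        ((hr.complex_ofReal.aestronglyMeasurable.mul hg.1).indicator (hE n))
        (Filter.Eventually.of_forall fun x => ?_)
      by_cases hx : x ∈ E
      · rw [Set.indicator_of_mem hx, norm_mul, norm_mul, Complex.norm_real, Real.norm_eq_abs]
        refine mul_le_mul_of_nonneg_right ?_ (norm_nonneg _)
        simpa using (show |r x| ≤ n from hx)
      · rw [Set.indicator_of_notMem hx, norm_zero]
        positivity
    have hw : MemLp (E.indicator fun x => z x - r x * y x) 2 μ := by
      have h1 := ((Lp.memLp z).indicator (hE n)).sub (hbd _ (Lp.memLp y))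
      rw [← Set.indicator_sub'] at h1
      exact h1
    set w := hw.toLp _
    have hwae : w =ᵐ[μ] E.indicator fun x => z x - r x * y x := hw.coeFn_toLp
    have hwd : w ∈ (mulOp μ r).domain := by
      refine (hbd _ hw).ae_eq ?_
      filter_upwards [hwae] with x hx
      rw [hx]
      by_cases hxE : x ∈ E <;> simp [hxE]
    have h1 := h ⟨w, hwd⟩
    rw [← sub_eq_zero, L2.inner_def, L2.inner_def, ← integral_sub (L2.integrable_inner _ _)
      (L2.integrable_inner _ _)] at h1
    have h2 : (inner ℂ w w : ℂ) = 0 := by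
      rw [← h1, L2.inner_def]
      refine integral_congr_ae ?_
      filter_upwards [hwae, mulOp_apply_ae ⟨w, hwd⟩] with x h3 h4
      rw [h4]
      simp only [RCLike.inner_apply]
      rw [h3]
      by_cases hxE : x ∈ E
      · simp only [Set.indicator_of_mem hxE, map_sub, map_mul, Complex.conj_ofReal]
        ring
      · simp only [Set.indicator_of_notMem hxE]
        simp
    rw [inner_self_eq_zero] at h2
    have h5 : w =ᵐ[μ] 0 := by rw [h2]; exact Lp.coeFn_zero _ _ _
    filter_upwards [hwae, h5] with x h3 h4 hx
    rw [h3, Set.indicator_of_mem (show x ∈ E from hx)] at h4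
    exact sub_eq_zero.1 h4
  filter_upwards [ae_all_iff.2 key] with x hx
  obtain ⟨n, hn⟩ := exists_nat_ge |r x|
  exact hx n hn

lemma dense_domain_mulOp {r : X → ℝ} (hr : Measurable r) :
    Dense ((mulOp μ r).domain : Set (Lp ℂ 2 μ)) := by
  rw [Submodule.dense_iff_topologicalClosure_eq_top, Submodule.topologicalClosure_eq_top_iff,
    Submodule.eq_bot_iff]
  intro z hz
  have h := ae_eq_mul_of_forall_inner (y := 0) (z := z) hr fun x => by
    rw [inner_zero_left, ← inner_conj_symm, hz x x.2, map_zero]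
  refine Lp.ext ?_
  filter_upwards [h, Lp.coeFn_zero ℂ 2 μ] with x h1 h2
  rw [h1, h2]
  simp

lemma isFormalAdjoint_mulOp {r : X → ℝ} : (mulOp μ r).IsFormalAdjoint (mulOp μ r) := by
  intro f g
  rw [L2.inner_def, L2.inner_def]
  refine integral_congr_ae ?_
  filter_upwards [mulOp_apply_ae f, mulOp_apply_ae g] with x h1 h2
  rw [h1, h2]
  simp only [RCLike.inner_apply, map_mul, Complex.conj_ofReal]
  ring

lemma isPosSelfAdjoint_mulOp {r : X → ℝ} (hr : Measurable r) (h0 : ∀ x, 0 ≤ r x) :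
    IsPosSelfAdjoint (mulOp μ r) where
  dense_domain := dense_domain_mulOp hr
  isSelfAdjoint := by
    rw [LinearPMap.isSelfAdjoint_def]
    refine le_antisymm (LinearPMap.le_of_le_graph ?_)
      (isFormalAdjoint_mulOp.le_adjoint (dense_domain_mulOp hr))
    rintro ⟨y, z⟩ hyz
    rw [mem_graph_mulOp]
    obtain ⟨y', rfl, rfl⟩ := (LinearPMap.mem_graph_iff _).1 hyz
    exact ae_eq_mul_of_forall_inner hr fun x =>
      LinearPMap.adjoint_isFormalAdjoint (dense_domain_mulOp hr) y' x
  nonneg f := by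
    rw [L2.inner_def, ← RCLike.re_eq_complex_re, ← integral_re (L2.integrable_inner _ _)]
    refine integral_nonneg_of_ae ?_
    filter_upwards [mulOp_apply_ae f] with x h1
    rw [h1]
    simp only [RCLike.inner_apply, Pi.zero_apply]
    rw [mul_assoc, Complex.mul_conj, ← Complex.ofReal_mul]
    exact mul_nonneg (h0 x) (Complex.normSq_nonneg _)

lemma isPosSqrt_mulOp {r : X → ℝ} (hr : Measurable r) (h0 : ∀ x, 0 ≤ r x) :
    IsPosSqrt (mulOp μ r) (mulOp μ fun x => r x ^ 2) where
  isPosSelfAdjoint := isPosSelfAdjoint_mulOp hr h0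
  mem_graph_iff f g := by
    simp only [mem_graph_mulOp]
    constructor
    · intro h
      -- The domain of multiplication by `r ^ 2` lies in that of `r` because `r ≤ 1 + r ^ 2`.
      have h1 : MemLp (fun x => (r x : ℂ) * f x) 2 μ := by
        refine ((Lp.memLp f).norm.add (Lp.memLp g).norm).of_le
          (hr.complex_ofReal.aestronglyMeasurable.mul (Lp.aestronglyMeasurable f)) ?_
        filter_upwards [h] with x hx
        rw [Pi.add_apply, hx, norm_mul, norm_mul, Complex.norm_real, Complex.norm_real, norm_pow,
          Real.norm_of_nonneg (add_nonneg (norm_nonneg _) (by positivity)),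
          Real.norm_of_nonneg (h0 x)]
        nlinarith [norm_nonneg (f x), mul_nonneg (norm_nonneg (f x)) (sq_nonneg (r x - 1)),
          mul_nonneg (norm_nonneg (f x)) (sq_nonneg (r x))]
      refine ⟨h1.toLp _, h1.coeFn_toLp, ?_⟩
      filter_upwards [h, h1.coeFn_toLp] with x h2 h3
      rw [h2, h3]
      push_cast
      ring
    · rintro ⟨y, h1, h2⟩
      filter_upwards [h1, h2] with x h3 h4
      rw [h4, h3]
      push_cast
      ring

lemma mulOp_injective {r : X → ℝ} (h0 : ∀ x, r x ≠ 0) (f : (mulOp μ r).domain)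
    (h : mulOp μ r f = 0) : f = 0 := by
  refine Subtype.ext (Lp.ext ?_)
  have h1 := mulOp_apply_ae f
  rw [h] at h1
  filter_upwards [h1, Lp.coeFn_zero ℂ 2 μ] with x h2 h3
  rw [h3] at h2
  rw [Submodule.coe_zero, h3]
  exact (mul_eq_zero.1 h2.symm).resolve_left (by exact_mod_cast h0 x)

end MulOp

/-! ### Hilbert bases inside dense subspaces, and Parseval sums -/

section Bases

variable {H : Type*} [NormedAddCommGroup H] [InnerProductSpace ℂ H] [CompleteSpace H]

/-- A dense subspace of a separable Hilbert space contains a countable Hilbert basis. -/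
lemma exists_hilbertBasis_mem [SecondCountableTopology H] (p : Submodule ℂ H)
    (hp : Dense (p : Set H)) :
    ∃ (s : Set H) (e : HilbertBasis s ℂ H), s.Countable ∧ ∀ i, e i ∈ p := by
  -- Gram–Schmidt applied to a dense sequence of `p` stays inside `p`; the zero vectors it produces
  -- are discarded below.
  let f : ℕ → H := fun n => (TopologicalSpace.denseSeq p n : H)
  have hf : DenseRange f := by
    have h1 : DenseRange ((↑) : p → H) := by
      rw [DenseRange, Subtype.range_coe]; exact hp
    exact h1.comp (TopologicalSpace.denseRange_denseSeq p) continuous_subtype_val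
  set g := InnerProductSpace.gramSchmidtNormed ℂ f
  have hspan : Submodule.span ℂ (Set.range g) = Submodule.span ℂ (Set.range f) := by
    rw [InnerProductSpace.span_gramSchmidtNormed_range, InnerProductSpace.span_gramSchmidt]
  have hgp : ∀ n, g n ∈ p := by
    intro n
    have h1 : Submodule.span ℂ (Set.range f) ≤ p :=
      Submodule.span_le.2 (by rintro _ ⟨n, rfl⟩; exact (TopologicalSpace.denseSeq p n).2)
    exact h1 (hspan ▸ Submodule.subset_span ⟨n, rfl⟩)
  have ho := (InnerProductSpace.gramSchmidtNormed_orthonormal' (𝕜 := ℂ) f).toSubtypeRange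
  set s : Set H := Set.range fun i : {i | g i ≠ 0} => g i
  have hs : Submodule.span ℂ (Set.range f) ≤ Submodule.span ℂ s := by
    rw [← hspan]
    refine Submodule.span_le.2 ?_
    rintro _ ⟨n, rfl⟩
    by_cases h0 : g n = 0
    · rw [h0]; exact Submodule.zero_mem _
    · exact Submodule.subset_span ⟨⟨n, h0⟩, rfl⟩
  have hd : ⊤ ≤ (Submodule.span ℂ (Set.range ((↑) : s → H))).topologicalClosure := by
    rw [Subtype.range_coe, top_le_iff, ← Submodule.dense_iff_topologicalClosure_eq_top]
    refine Dense.mono (fun x hx => hs hx) ?_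
    exact hf.mono Submodule.subset_span
  refine ⟨s, HilbertBasis.mk ho hd, Set.countable_range _, fun i => ?_⟩
  rw [HilbertBasis.coe_mk]
  obtain ⟨_, ⟨n, rfl⟩⟩ := i
  exact hgp n

lemma HilbertBasis.tsum_enorm_inner_sq {ι : Type*} (e : HilbertBasis ι ℂ H) (x : H) :
    ∑' i, ‖(inner ℂ (e i) x : ℂ)‖ₑ ^ 2 = ‖x‖ₑ ^ 2 := by
  have h1 := (e.hasSum_inner_mul_inner x x).mapL Complex.reCLM
  have h2 : ∀ i, Complex.reCLM (inner ℂ x (e i) * inner ℂ (e i) x) =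
      ‖(inner ℂ (e i) x : ℂ)‖ ^ 2 := by
    intro i
    rw [← inner_conj_symm, Complex.reCLM_apply, Complex.conj_mul', ← Complex.ofReal_pow,
      Complex.ofReal_re]
  simp only [h2] at h1
  have h3 : Complex.reCLM (inner ℂ x x) = ‖x‖ ^ 2 := (norm_sq_eq_re_inner (𝕜 := ℂ) x).symm
  rw [h3] at h1
  have h4 := ENNReal.ofReal_tsum_of_nonneg (fun i => by positivity) h1.summable
  rw [h1.tsum_eq] at h4
  simp only [ENNReal.ofReal_pow (norm_nonneg _), ofReal_norm] at h4
  exact h4.symm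

lemma enorm_sq_lp {ι : Type*} (k : lp (fun _ : ι => H) 2) :
    ‖k‖ₑ ^ 2 = ∑' i, ‖k i‖ₑ ^ 2 := by
  have h1 := lp.hasSum_norm (p := 2) (by norm_num) k
  simp only [ENNReal.toReal_ofNat, Real.rpow_ofNat] at h1
  have h4 := ENNReal.ofReal_tsum_of_nonneg (fun i => by positivity) h1.summable
  rw [h1.tsum_eq] at h4
  simp only [ENNReal.ofReal_pow (norm_nonneg _), ofReal_norm] at h4
  exact h4

lemma memℓp_two_of_tsum_ne_top {ι : Type*} {k : ι → H} (h : ∑' i, ‖k i‖ₑ ^ 2 ≠ ∞) :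
    Memℓp k 2 := by
  refine memℓp_gen ?_
  have h1 := ENNReal.summable_toReal h
  simpa using h1

lemma Orthonormal.sum_enorm_inner_sq_le {ι : Type*} {v : ι → H} (hv : Orthonormal ℂ v)
    (s : Finset ι) (x : H) : ∑ i ∈ s, ‖(inner ℂ (v i) x : ℂ)‖ₑ ^ 2 ≤ ‖x‖ₑ ^ 2 := by
  have h := ENNReal.ofReal_le_ofReal (hv.sum_inner_products_le (s := s) x)
  rw [ENNReal.ofReal_sum_of_nonneg (fun i _ => by positivity)] at h
  simpa only [ENNReal.ofReal_pow (norm_nonneg _), ofReal_norm] using h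

lemma enorm_inner_symm (x y : H) : ‖(inner ℂ x y : ℂ)‖ₑ = ‖(inner ℂ y x : ℂ)‖ₑ := by
  rw [← ofReal_norm, ← ofReal_norm, norm_inner_symm]

lemma enorm_inner_le (x y : H) : ‖(inner ℂ x y : ℂ)‖ₑ ≤ ‖x‖ₑ * ‖y‖ₑ := by
  rw [← ofReal_norm, ← ofReal_norm, ← ofReal_norm, ← ENNReal.ofReal_mul (norm_nonneg _)]
  exact ENNReal.ofReal_le_ofReal (norm_inner_le_norm x y)

end Bases

/-! ### The weight Tr(C · C) and its GNS representation -/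

section Weights

variable {H : Type*} [NormedAddCommGroup H] [InnerProductSpace ℂ H] [CompleteSpace H]
  {C : H →ₗ.[ℂ] H}

lemma IsPosSelfAdjoint.inner_map (hC : IsPosSelfAdjoint C) (x y : C.domain) :
    inner ℂ (C x) (y : H) = inner ℂ (x : H) (C y) := by
  have h := LinearPMap.adjoint_isFormalAdjoint hC.dense_domain
  rw [LinearPMap.isSelfAdjoint_def.1 hC.isSelfAdjoint] at h
  exact h x y

/-- The bound puts `y` in the domain of the adjoint, and the adjoint is `C`. -/
lemma IsPosSelfAdjoint.mem_domain_of_bound (hC : IsPosSelfAdjoint C) {y : H} {M : ℝ}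
    (h : ∀ x : C.domain, ‖(inner ℂ y (C x) : ℂ)‖ ≤ M * ‖(x : H)‖) : y ∈ C.domain := by
  have h1 : y ∈ (LinearPMap.adjoint C).domain := by
    rw [LinearPMap.mem_adjoint_domain_iff]
    exact AddMonoidHomClass.continuous_of_bound _ M h
  rwa [LinearPMap.isSelfAdjoint_def.1 hC.isSelfAdjoint] at h1

/-- The operator `D^{1/2}` of a Duflo-Moore pair has trivial kernel; in the form needed for density
arguments: a vector orthogonal to the range of `C` vanishes. -/
lemma IsPosSelfAdjoint.eq_zero_of_forall_inner (hC : IsPosSelfAdjoint C)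
    (h0 : ∀ x : C.domain, C x = 0 → (x : H) = 0) {z : H}
    (hz : ∀ x : C.domain, (inner ℂ z (C x) : ℂ) = 0) : z = 0 := by
  have h1 : z ∈ C.domain := hC.mem_domain_of_bound (M := 0) fun x => by rw [hz]; simp
  refine h0 ⟨z, h1⟩ ?_
  refine hC.dense_domain.eq_zero_of_inner_left (𝕜 := ℂ) fun x hx => ?_
  rw [hC.inner_map ⟨z, h1⟩ ⟨x, hx⟩]
  exact hz ⟨x, hx⟩

lemma IsPosSqrt.eq_zero {D : H →ₗ.[ℂ] H} (h : IsPosSqrt C D)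
    (hD : ∀ x : D.domain, D x = 0 → x = 0) (x : C.domain) (hx : C x = 0) : (x : H) = 0 := by
  have h1 : ((x : H), (0 : H)) ∈ D.graph := by
    rw [h.mem_graph_iff]
    refine ⟨0, ?_, C.graph.zero_mem⟩
    have := C.mem_graph x
    rwa [hx] at this
  obtain ⟨y, hy, h2⟩ := (LinearPMap.mem_graph_iff _).1 h1
  rw [← show (y : H) = x from hy, hD y h2, Submodule.coe_zero]

lemma enorm_sq_le_traceWeight {T : H →L[ℂ] H} (x : C.domain) (hx : ‖(x : H)‖ = 1) :
    ‖T (C x)‖ₑ ^ 2 ≤ traceWeight C (star T * T) := by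
  rw [traceWeight_star_mul]
  refine le_iSup₂_of_le {x} ?_ (by simp)
  rw [orthonormal_iff_ite]
  intro i j
  have hi : (i : C.domain) = x := Finset.mem_singleton.1 i.2
  have hj : (j : C.domain) = x := Finset.mem_singleton.1 j.2
  rw [if_pos (Subtype.ext (hi.trans hj.symm)), hi, hj, inner_self_eq_norm_sq_to_K, hx]
  simp

/-- Testing the weight on single unit vectors bounds `T C` on the domain of `C`. -/
lemma exists_bound_of_mem_nIdeal {T : H →L[ℂ] H} (hT : T ∈ nIdeal C) :
    ∃ M : ℝ, ∀ x : C.domain, ‖T (C x)‖ ≤ M * ‖(x : H)‖ := by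
  have hT' : traceWeight C (star T * T) ≠ ∞ := ne_of_lt hT
  refine ⟨√(traceWeight C (star T * T)).toReal, fun x => ?_⟩
  rcases eq_or_ne x 0 with rfl | hx
  · simp [LinearPMap.map_zero]
  have hx0 : ‖(x : H)‖ ≠ 0 := by simpa using hx
  set u : C.domain := ((‖(x : H)‖⁻¹ : ℝ) : ℂ) • x
  have hu : ‖(u : H)‖ = 1 := by
    simp only [u, Submodule.coe_smul, norm_smul, Complex.norm_real, norm_inv, norm_norm]
    exact inv_mul_cancel₀ hx0
  have h1 := ENNReal.toReal_mono hT' (enorm_sq_le_traceWeight (T := T) u hu)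
  rw [ENNReal.toReal_pow, toReal_enorm] at h1
  have h2 := Real.le_sqrt_of_sq_le h1
  have h3 : x = ((‖(x : H)‖ : ℝ) : ℂ) • u := by
    rw [smul_smul, ← Complex.ofReal_mul, mul_inv_cancel₀ hx0, Complex.ofReal_one, one_smul]
  conv_lhs => rw [h3]
  rw [LinearPMap.map_smul, map_smul, norm_smul, Complex.norm_real, norm_norm, mul_comm]
  exact mul_le_mul_of_nonneg_right h2 (norm_nonneg _)

/-- Since `T C` is bounded, so is `x ↦ ⟪star T y, C x⟫`. Thus `C T*` is everywhere defined, and it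
serves as the adjoint of `T C`. -/
lemma star_apply_mem_domain (hC : IsPosSelfAdjoint C) {T : H →L[ℂ] H} (hT : T ∈ nIdeal C)
    (y : H) : star T y ∈ C.domain := by
  obtain ⟨M, hM⟩ := exists_bound_of_mem_nIdeal hT
  refine hC.mem_domain_of_bound (M := ‖y‖ * M) fun x => ?_
  rw [ContinuousLinearMap.star_eq_adjoint, ContinuousLinearMap.adjoint_inner_left, mul_assoc]
  exact (norm_inner_le_norm _ _).trans (mul_le_mul_of_nonneg_left (hM x) (norm_nonneg y))

lemma inner_map_star (hC : IsPosSelfAdjoint C) {T : H →L[ℂ] H} (hT : T ∈ nIdeal C)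
    (y : H) (x : C.domain) :
    inner ℂ (C ⟨star T y, star_apply_mem_domain hC hT y⟩) (x : H) = inner ℂ y (T (C x)) := by
  rw [hC.inner_map]
  exact ContinuousLinearMap.adjoint_inner_left T (C x) y

lemma formNormSq_of_mem {x : H} (hx : x ∈ C.domain) :
    formNormSq C x = ‖C ⟨x, hx⟩‖ₑ ^ 2 := by
  rw [formNormSq, dif_pos hx]

variable {ι : Type*} (e : HilbertBasis ι ℂ H)

/-- Both sides are the double sum of `|⟪e j, T C e i⟫|²`, taken in the two orders. -/
lemma tsum_enorm_sq_eq (hC : IsPosSelfAdjoint C) (he : ∀ i, e i ∈ C.domain) {T : H →L[ℂ] H}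
    (hT : T ∈ nIdeal C) :
    ∑' i, ‖T (C ⟨e i, he i⟩)‖ₑ ^ 2 = ∑' j, formNormSq C (star T (e j)) := by
  have h1 : ∀ i, ‖T (C ⟨e i, he i⟩)‖ₑ ^ 2 =
      ∑' j, ‖(inner ℂ (e j) (T (C ⟨e i, he i⟩)) : ℂ)‖ₑ ^ 2 := fun i =>
    (HilbertBasis.tsum_enorm_inner_sq e _).symm
  simp only [h1]
  rw [ENNReal.tsum_comm]
  refine tsum_congr fun j => ?_
  rw [formNormSq_of_mem (star_apply_mem_domain hC hT _), ← HilbertBasis.tsum_enorm_inner_sq e]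
  refine tsum_congr fun i => ?_
  rw [← inner_map_star hC hT (e j) ⟨e i, he i⟩, enorm_inner_symm]

/-- The weight is the squared Hilbert–Schmidt norm of `T C`, computed through its adjoint. Bessel's
inequality bounds every partial trace by the sum over `e`, and finite subfamilies of `e` give the
reverse bound. -/
lemma traceWeight_eq_tsum_formNormSq (hC : IsPosSelfAdjoint C) (he : ∀ i, e i ∈ C.domain)
    {T : H →L[ℂ] H} (hT : T ∈ nIdeal C) :
    traceWeight C (star T * T) = ∑' j, formNormSq C (star T (e j)) := by
  classical
  refine le_antisymm ?_ ?_
  · rw [traceWeight_star_mul]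
    refine iSup₂_le fun s hs => ?_
    have h1 : ∀ x : C.domain, ‖T (C x)‖ₑ ^ 2 =
        ∑' j, ‖(inner ℂ (x : H) (C ⟨star T (e j), star_apply_mem_domain hC hT _⟩) : ℂ)‖ₑ ^ 2 := by
      intro x
      rw [← HilbertBasis.tsum_enorm_inner_sq e]
      refine tsum_congr fun j => ?_
      rw [← inner_map_star hC hT (e j) x, enorm_inner_symm]
    simp only [h1]
    rw [← Summable.tsum_finsetSum fun _ _ => ENNReal.summable]
    refine ENNReal.tsum_le_tsum fun j => ?_
    rw [formNormSq_of_mem (star_apply_mem_domain hC hT _)]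
    have h2 := Orthonormal.sum_enorm_inner_sq_le hs Finset.univ
      (C ⟨star T (e j), star_apply_mem_domain hC hT _⟩)
    rwa [Finset.sum_coe_sort s fun x : C.domain =>
      ‖(inner ℂ (x : H) (C ⟨star T (e j), star_apply_mem_domain hC hT _⟩) : ℂ)‖ₑ ^ 2] at h2
  · rw [← tsum_enorm_sq_eq e hC he hT, ENNReal.tsum_eq_iSup_sum]
    refine iSup_le fun t => ?_
    rw [traceWeight_star_mul]
    have hinj : Function.Injective fun i => (⟨e i, he i⟩ : C.domain) := fun i j hij =>
      e.orthonormal.linearIndependent.injective (congrArg Subtype.val hij)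
    refine le_iSup₂_of_le (t.map ⟨_, hinj⟩) ?_ (by rw [Finset.sum_map]; rfl)
    rw [orthonormal_iff_ite]
    rintro ⟨a, ha⟩ ⟨b, hb⟩
    obtain ⟨i, -, rfl⟩ := Finset.mem_map.1 ha
    obtain ⟨j, -, rfl⟩ := Finset.mem_map.1 hb
    have h := orthonormal_iff_ite.1 e.orthonormal i j
    by_cases hij : i = j
    · subst hij
      simpa using h
    · rw [if_neg hij] at h
      rw [if_neg fun h' => hij (hinj (Subtype.ext_iff.1 h'))]
      exact h

lemma traceWeight_eq_tsum (hC : IsPosSelfAdjoint C) (he : ∀ i, e i ∈ C.domain)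
    {T : H →L[ℂ] H} (hT : T ∈ nIdeal C) :
    traceWeight C (star T * T) = ∑' i, ‖T (C ⟨e i, he i⟩)‖ₑ ^ 2 := by
  rw [traceWeight_eq_tsum_formNormSq e hC he hT, tsum_enorm_sq_eq e hC he hT]

/-- Composed with `C`, the operator is `x ↦ ⟪C b, x⟫ a`, so Bessel's inequality bounds all partial
traces by `‖C b‖² ‖a‖²`. -/
lemma rankOne_mem_nIdeal (hC : IsPosSelfAdjoint C) (a : H) {b : H} (hb : b ∈ C.domain) :
    InnerProductSpace.rankOne ℂ a b ∈ nIdeal C := by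
  change traceWeight C _ < ∞
  rw [traceWeight_star_mul]
  refine lt_of_le_of_lt (b := ‖C ⟨b, hb⟩‖ₑ ^ 2 * ‖a‖ₑ ^ 2) (iSup₂_le fun s hs => ?_)
    (ENNReal.mul_lt_top (by simp) (by simp))
  have h1 : ∀ x : C.domain, ‖InnerProductSpace.rankOne ℂ a b (C x)‖ₑ ^ 2 =
      ‖(inner ℂ (x : H) (C ⟨b, hb⟩) : ℂ)‖ₑ ^ 2 * ‖a‖ₑ ^ 2 := by
    intro x
    rw [InnerProductSpace.rankOne_apply, enorm_smul, mul_pow, ← hC.inner_map ⟨b, hb⟩ x,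
      enorm_inner_symm]
  simp only [h1]
  rw [← Finset.sum_mul]
  refine mul_le_mul_left ?_ _
  have h2 := Orthonormal.sum_enorm_inner_sq_le hs Finset.univ (C ⟨b, hb⟩)
  rwa [Finset.sum_coe_sort s fun x : C.domain =>
      ‖(inner ℂ (x : H) (C ⟨b, hb⟩) : ℂ)‖ₑ ^ 2] at h2

/-- The GNS map of the weight `Tr(C · C)`, in the coordinates given by a Hilbert basis. -/
def gnsMap (hC : IsPosSelfAdjoint C) (he : ∀ i, e i ∈ C.domain) :
    nIdeal C →ₗ[ℂ] lp (fun _ : ι => H) 2 where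
  toFun T := ⟨fun i => T.1 (C ⟨e i, he i⟩), memℓp_two_of_tsum_ne_top (by
    rw [← traceWeight_eq_tsum e hC he T.2]; exact ne_of_lt T.2)⟩
  map_add' S T := by ext i; rfl
  map_smul' c T := by ext i; rfl

@[simp]
lemma gnsMap_apply (hC : IsPosSelfAdjoint C) (he : ∀ i, e i ∈ C.domain) (T : nIdeal C) (i : ι) :
    gnsMap e hC he T i = T.1 (C ⟨e i, he i⟩) := rfl

lemma enorm_sq_gnsMap (hC : IsPosSelfAdjoint C) (he : ∀ i, e i ∈ C.domain) (T : nIdeal C) :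
    ‖gnsMap e hC he T‖ₑ ^ 2 = traceWeight C (star (T : H →L[ℂ] H) * (T : H →L[ℂ] H)) := by
  rw [enorm_sq_lp, traceWeight_eq_tsum e hC he T.2]
  rfl

/-- For density, suppose `k` is orthogonal to the images of all rank one operators. Then for each
`a` the vector with coordinates `⟪k i, a⟫` is orthogonal to the range of `C`, hence zero since `C`
is self-adjoint and injective. -/
lemma isGNS_gnsMap (hC : IsPosSelfAdjoint C) (h0 : ∀ x : C.domain, C x = 0 → (x : H) = 0)
    (he : ∀ i, e i ∈ C.domain) : IsGNS C (gnsMap e hC he) where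
  enorm_sq := enorm_sq_gnsMap e hC he
  denseRange := by
    have h1 : Dense (LinearMap.range (gnsMap e hC he) : Set (lp (fun _ : ι => H) 2)) := by
      rw [Submodule.dense_iff_topologicalClosure_eq_top, Submodule.topologicalClosure_eq_top_iff,
        Submodule.eq_bot_iff]
      intro k hk
      have h2 : ∀ (a : H) (b : C.domain),
          HasSum (fun i => inner ℂ (C b) (e i) * inner ℂ (k i) a) 0 := by
        intro a b
        have h3 := lp.hasSum_inner (𝕜 := ℂ) k
          (gnsMap e hC he ⟨_, rankOne_mem_nIdeal hC a b.2⟩)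
        rw [← inner_conj_symm, hk _ ⟨_, rfl⟩, map_zero] at h3
        refine h3.congr_fun ?_
        intro i
        rw [gnsMap_apply, InnerProductSpace.rankOne_apply, inner_smul_right,
          hC.inner_map b ⟨e i, he i⟩]
      ext i
      refine ext_inner_right ℂ fun a => ?_
      have hm : Memℓp (fun i => (inner ℂ (k i) a : ℂ)) 2 := by
        refine memℓp_two_of_tsum_ne_top (ne_of_lt (lt_of_le_of_lt (b := ‖k‖ₑ ^ 2 * ‖a‖ₑ ^ 2) ?_
          (ENNReal.mul_lt_top (by simp) (by simp))))
        rw [enorm_sq_lp, ← ENNReal.tsum_mul_right]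
        refine ENNReal.tsum_le_tsum fun i => ?_
        rw [← mul_pow]
        exact pow_le_pow_left' (enorm_inner_le _ _) 2
      set z := e.repr.symm ⟨_, hm⟩
      have hz : ∀ i, (inner ℂ (e i) z : ℂ) = inner ℂ (k i) a := fun i => by
        rw [← e.repr_apply_apply, LinearIsometryEquiv.apply_symm_apply]
      have hz0 : z = 0 := hC.eq_zero_of_forall_inner h0 fun b => by
        have h4 := e.hasSum_inner_mul_inner (C b) z
        simp only [hz] at h4
        rw [← inner_conj_symm, h4.unique (h2 a b), map_zero]
      rw [← hz, hz0, inner_zero_right]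
      exact (inner_zero_left _).symm
    exact h1

end Weights

/-! ### Polarization of norm identities -/

section Polarization

/-- A sesquilinear form vanishes if its quadratic form does. The factor `s` is `± i`, so that both
conventions for the conjugate linear variable are covered. -/
lemma sesquilin_eq_zero {E : Type*} [AddCommGroup E] [Module ℂ E] {B : E → E → ℂ} {s : ℂ}
    (hs : s ≠ 0) (add_left : ∀ x y z, B (x + y) z = B x z + B y z)
    (add_right : ∀ x y z, B x (y + z) = B x y + B x z)
    (smul_left : ∀ x y, B (Complex.I • x) y = -s * B x y)
    (smul_right : ∀ x y, B x (Complex.I • y) = s * B x y)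
    (h0 : ∀ x, B x x = 0) (x y : E) : B x y = 0 := by
  have h1 : ∀ x y, B x y + B y x = 0 := fun x y => by
    have h := h0 (x + y)
    rw [add_left, add_right, add_right, h0, h0] at h
    linear_combination h
  have h2 := h1 x (Complex.I • y)
  rw [smul_left, smul_right] at h2
  have h3 : B x y - B y x = 0 := by
    refine (mul_eq_zero.1 (?_ : s * (B x y - B y x) = 0)).resolve_left hs
    linear_combination h2
  linear_combination (1 / 2 : ℂ) * h1 x y + (1 / 2 : ℂ) * h3

/-- Polarize in the second variable with the first one fixed, then in the first. -/
lemma inner_eq_of_norm_eq {M N K₁ K₂ L : Type*} [AddCommGroup M] [Module ℂ M]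
    [AddCommGroup N] [Module ℂ N] [NormedAddCommGroup K₁] [InnerProductSpace ℂ K₁]
    [NormedAddCommGroup K₂] [InnerProductSpace ℂ K₂]
    [NormedAddCommGroup L] [InnerProductSpace ℂ L]
    (w : M →ₗ[ℂ] N →ₗ[ℂ] L) (u : M →ₗ[ℂ] K₁) (v : N →ₗ[ℂ] K₂)
    (h : ∀ x y, ‖w x y‖ = ‖u x‖ * ‖v y‖) (x x' : M) (y y' : N) :
    inner ℂ (w x y) (w x' y') = inner ℂ (u x) (u x') * inner ℂ (v y) (v y') := by
  have h1 : ∀ x y y', inner ℂ (w x y) (w x y') =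
      inner ℂ (u x) (u x) * inner ℂ (v y) (v y') := by
    intro x y y'
    rw [← sub_eq_zero]
    refine sesquilin_eq_zero
      (B := fun y y' => inner ℂ (w x y) (w x y') - inner ℂ (u x) (u x) * inner ℂ (v y) (v y'))
      Complex.I_ne_zero ?_ ?_ ?_ ?_ ?_ y y'
    · intro a b c; simp only [map_add, inner_add_left]; ring
    · intro a b c; simp only [map_add, inner_add_right]; ring
    · intro a b; simp only [map_smul, inner_smul_left, Complex.conj_I]; ring
    · intro a b; simp only [map_smul, inner_smul_right]; ring
    · intro a
      simp only [inner_self_eq_norm_sq_to_K, h, RCLike.ofReal_mul]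
      ring
  rw [← sub_eq_zero]
  refine sesquilin_eq_zero
    (B := fun x x' => inner ℂ (w x y) (w x' y') - inner ℂ (u x) (u x') * inner ℂ (v y) (v y'))
    Complex.I_ne_zero ?_ ?_ ?_ ?_ ?_ x x'
  · intro a b c; simp only [map_add, LinearMap.add_apply, inner_add_left]; ring
  · intro a b c; simp only [map_add, LinearMap.add_apply, inner_add_right]; ring
  · intro a b; simp only [map_smul, LinearMap.smul_apply, inner_smul_left, Complex.conj_I]; ring
  · intro a b; simp only [map_smul, LinearMap.smul_apply, inner_smul_right]; ring
  · intro a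
    simp only [h1, sub_self]

end Polarization

/-! ### Measurability of Hilbert space valued maps -/

section Measurability

variable {X : Type*} [MeasurableSpace X]

lemma stronglyMeasurable_of_hasSum {E ι : Type*} [NormedAddCommGroup E] [Countable ι]
    {f : ι → X → E} {g : X → E} (hf : ∀ i, StronglyMeasurable (f i))
    (h : ∀ x, HasSum (fun i => f i x) (g x)) : StronglyMeasurable g := by
  refine stronglyMeasurable_of_tendsto (f := fun (s : Finset ι) x => ∑ i ∈ s, f i x) Filter.atTop
    (fun s => Finset.stronglyMeasurable_fun_sum s fun i _ => hf i) ?_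
  rw [tendsto_pi_nhds]
  intro x
  have h1 := h x
  rwa [HasSum, SummationFilter.unconditional_filter] at h1

lemma stronglyMeasurable_of_inner {H ι : Type*} [NormedAddCommGroup H] [InnerProductSpace ℂ H]
    [Countable ι] (e : HilbertBasis ι ℂ H) {f : X → H}
    (h : ∀ i, Measurable fun x => (inner ℂ (e i) (f x) : ℂ)) : StronglyMeasurable f := by
  refine stronglyMeasurable_of_hasSum
    (f := fun i x => (inner ℂ (e i) (f x) : ℂ) • e i) (fun i => ?_) fun x => ?_
  · exact (h i).stronglyMeasurable.smul_const (e i)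
  · simpa only [e.repr_apply_apply] using e.hasSum_repr (f x)

end Measurability

/-! ### The Galois map in Hilbert–Schmidt coordinates -/

section Galois

variable {G : Type*} [Group G] [MeasurableSpace G] {μ : Measure G}
  {H : Type*} [NormedAddCommGroup H] [InnerProductSpace ℂ H] [CompleteSpace H]
  {π : G → H →L[ℂ] H} {D C : H →ₗ.[ℂ] H} {ι : Type*} [Countable ι] (e : HilbertBasis ι ℂ H)

lemma norm_star_apply (hπ : IsIrreducibleProjRep π) (g : G) (y : H) : ‖star (π g) y‖ = ‖y‖ :=
  norm_apply_of_mem_unitary (Unitary.star_mem (hπ.mem_unitary g)) y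

lemma norm_rep_apply (hπ : IsIrreducibleProjRep π) (g : G) (y : H) : ‖π g y‖ = ‖y‖ :=
  norm_apply_of_mem_unitary (hπ.mem_unitary g) y

lemma inner_star_apply (T : H →L[ℂ] H) (x y : H) :
    inner ℂ x (star T y) = inner ℂ (T x) y := by
  rw [ContinuousLinearMap.star_eq_adjoint, ContinuousLinearMap.adjoint_inner_right]

lemma stronglyMeasurable_star_apply (e : HilbertBasis ι ℂ H) (hπ : IsIrreducibleProjRep π) (y : H) :
    StronglyMeasurable fun g => star (π g) y := by
  refine stronglyMeasurable_of_inner e fun i => ?_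
  simp only [inner_star_apply]
  have h := Complex.continuous_conj.measurable.comp (hπ.measurable_coeff y (e i))
  simpa only [Function.comp_def, inner_conj_symm] using h

lemma stronglyMeasurable_rep_apply (e : HilbertBasis ι ℂ H) (hπ : IsIrreducibleProjRep π) {u : G → H}
    (hu : StronglyMeasurable u) : StronglyMeasurable fun g => π g (u g) := by
  refine stronglyMeasurable_of_inner e fun i => ?_
  have h := ((stronglyMeasurable_star_apply e hπ (e i)).inner (𝕜 := ℂ) hu).measurable
  simpa only [ContinuousLinearMap.star_eq_adjoint, ContinuousLinearMap.adjoint_inner_left] using h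

/-- The action of an operator on the Hilbert-Schmidt space `ℓ²(ι; H)`. -/
def lmul (ι : Type*) (R : H →L[ℂ] H) : lp (fun _ : ι => H) 2 →L[ℂ] lp (fun _ : ι => H) 2 :=
  lp.mapCLM 2 (fun _ => R) (norm_nonneg R) fun _ => le_rfl

/-- The function `g ↦ π(g) S π(g)* k` in coordinates. -/
def galoisFun (π : G → H →L[ℂ] H) (S : H →L[ℂ] H) (k : lp (fun _ : ι => H) 2) (g : G) :
    lp (fun _ : ι => H) 2 :=
  lmul ι (π g * S * star (π g)) k

lemma galoisFun_apply (S : H →L[ℂ] H) (k : lp (fun _ : ι => H) 2) (g : G) (i : ι) :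
    galoisFun π S k g i = π g (S (star (π g) (k i))) := rfl

lemma stronglyMeasurable_galoisFun (e : HilbertBasis ι ℂ H) (hπ : IsIrreducibleProjRep π) (S : H →L[ℂ] H)
    (k : lp (fun _ : ι => H) 2) : StronglyMeasurable (galoisFun π S k) := by
  classical
  refine stronglyMeasurable_of_hasSum
    (f := fun i g => lp.single 2 i (galoisFun π S k g i)) (fun i => ?_) fun g =>
      lp.hasSum_single ENNReal.ofNat_ne_top _
  refine (lp.isometry_single i).continuous.comp_stronglyMeasurable ?_
  simp only [galoisFun_apply]
  exact stronglyMeasurable_rep_apply e hπ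
    (S.continuous.comp_stronglyMeasurable (stronglyMeasurable_star_apply e hπ (k i)))

/-- In the basis, `‖S π(g)* y‖²` is the sum of `|⟪y, π(g) S* e j⟫|²`, and the orthogonality relation
integrates each term to `‖y‖² ‖C S* e j‖²`. -/
lemma lintegral_apply_star (e : HilbertBasis ι ℂ H) (hπ : IsIrreducibleProjRep π) (hD : IsDufloMoore μ π D C)
    (he : ∀ i, e i ∈ C.domain) {S : H →L[ℂ] H} (hS : S ∈ nIdeal C) (y : H) :
    ∫⁻ g, ‖S (star (π g) y)‖ₑ ^ 2 ∂μ = traceWeight C (star S * S) * ‖y‖ₑ ^ 2 := by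
  have h1 : ∀ g, ‖S (star (π g) y)‖ₑ ^ 2 =
      ∑' j, ‖(inner ℂ y (π g (star S (e j))) : ℂ)‖ₑ ^ 2 := by
    intro g
    rw [← HilbertBasis.tsum_enorm_inner_sq e]
    refine tsum_congr fun j => ?_
    rw [← ContinuousLinearMap.adjoint_inner_left, inner_star_apply,
      ← ContinuousLinearMap.star_eq_adjoint, enorm_inner_symm]
  simp only [h1]
  rw [lintegral_tsum fun j => ((hπ.measurable_coeff y _).enorm.pow_const 2).aemeasurable]
  simp only [hD.lintegral_coeff]
  rw [ENNReal.tsum_mul_left, mul_comm,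
    traceWeight_eq_tsum_formNormSq e hD.isPosSqrt.isPosSelfAdjoint he hS]

lemma lintegral_galoisFun (e : HilbertBasis ι ℂ H) (hπ : IsIrreducibleProjRep π) (hD : IsDufloMoore μ π D C)
    (he : ∀ i, e i ∈ C.domain) {S : H →L[ℂ] H} (hS : S ∈ nIdeal C)
    (k : lp (fun _ : ι => H) 2) :
    ∫⁻ g, ‖galoisFun π S k g‖ₑ ^ 2 ∂μ = traceWeight C (star S * S) * ‖k‖ₑ ^ 2 := by
  simp only [enorm_sq_lp, galoisFun_apply]
  have h1 : ∀ g i, ‖π g (S (star (π g) (k i)))‖ₑ = ‖S (star (π g) (k i))‖ₑ := fun g i => by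
    rw [← ofReal_norm, norm_rep_apply hπ, ofReal_norm]
  simp only [h1]
  rw [lintegral_tsum fun i => ((S.continuous.comp_stronglyMeasurable
    (stronglyMeasurable_star_apply e hπ (k i))).enorm.pow_const 2).aemeasurable]
  simp only [lintegral_apply_star e hπ hD he hS]
  rw [ENNReal.tsum_mul_left]

lemma memLp_galoisFun (e : HilbertBasis ι ℂ H) (hπ : IsIrreducibleProjRep π) (hD : IsDufloMoore μ π D C)
    (he : ∀ i, e i ∈ C.domain) (S : nIdeal C) (k : lp (fun _ : ι => H) 2) :
    MemLp (galoisFun π S.1 k) 2 μ := by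
  rw [← lintegral_enorm_sq_lt_top_iff
    (stronglyMeasurable_galoisFun e hπ S.1 k).aestronglyMeasurable,
    lintegral_galoisFun e hπ hD he S.2]
  exact ENNReal.mul_lt_top S.2 (by simp)

/-- The Galois map as a bilinear map. -/
def galoisBilin (hπ : IsIrreducibleProjRep π) (hD : IsDufloMoore μ π D C)
    (he : ∀ i, e i ∈ C.domain) :
    nIdeal C →ₗ[ℂ] lp (fun _ : ι => H) 2 →ₗ[ℂ] Lp (lp (fun _ : ι => H) 2) 2 μ :=
  LinearMap.mk₂ ℂ (fun S k => (memLp_galoisFun e hπ hD he S k).toLp _)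
    (fun S S' k => by
      rw [← MemLp.toLp_add]
      refine MemLp.toLp_congr _ _ (Filter.Eventually.of_forall fun g => ?_)
      ext i
      simp [galoisFun_apply])
    (fun c S k => by
      rw [← MemLp.toLp_const_smul]
      refine MemLp.toLp_congr _ _ (Filter.Eventually.of_forall fun g => ?_)
      ext i
      simp [galoisFun_apply])
    (fun S k k' => by
      rw [← MemLp.toLp_add]
      refine MemLp.toLp_congr _ _ (Filter.Eventually.of_forall fun g => ?_)
      ext i
      simp [galoisFun_apply])
    (fun c S k => by
      rw [← MemLp.toLp_const_smul]
      refine MemLp.toLp_congr _ _ (Filter.Eventually.of_forall fun g => ?_)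
      ext i
      simp [galoisFun_apply])

lemma galoisBilin_ae (hπ : IsIrreducibleProjRep π) (hD : IsDufloMoore μ π D C)
    (he : ∀ i, e i ∈ C.domain) (S : nIdeal C) (k : lp (fun _ : ι => H) 2) :
    galoisBilin e hπ hD he S k =ᵐ[μ] galoisFun π S.1 k :=
  (memLp_galoisFun e hπ hD he S k).coeFn_toLp

lemma norm_galoisBilin (hπ : IsIrreducibleProjRep π) (hD : IsDufloMoore μ π D C)
    (he : ∀ i, e i ∈ C.domain) (S : nIdeal C) (k : lp (fun _ : ι => H) 2) :
    ‖galoisBilin e hπ hD he S k‖ = ‖gnsMap e hD.isPosSqrt.isPosSelfAdjoint he S‖ * ‖k‖ := by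
  have h1 : ‖galoisBilin e hπ hD he S k‖ₑ ^ 2 =
      (‖gnsMap e hD.isPosSqrt.isPosSelfAdjoint he S‖ₑ * ‖k‖ₑ) ^ 2 := by
    rw [mul_pow, enorm_sq_gnsMap, ← lintegral_galoisFun e hπ hD he S.2]
    exact enorm_sq_toLp (memLp_galoisFun e hπ hD he S k)
  have h2 := (ENNReal.pow_right_strictMono two_ne_zero).injective h1
  rw [← toReal_enorm, h2, ENNReal.toReal_mul, toReal_enorm, toReal_enorm]

/-- For `S` the rank one operator of `a`, `b` and `k` equal to `c` at one index, the Galois function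
at `g` is `⟪π g b, c⟫ π g a` in that coordinate. If `z` is orthogonal to all of these, totality of
the coefficients makes `⟪π g a, z g i⟫` vanish almost everywhere. -/
lemma dense_range_galoisBilin (hπ : IsIrreducibleProjRep π) (hD : IsDufloMoore μ π D C)
    (he : ∀ i, e i ∈ C.domain)
    (htot : ∀ h : G → ℂ, MemLp h 2 μ →
      (∀ x y, y ∈ C.domain → ∫ g, inner ℂ x (π g y) * h g ∂μ = 0) → h =ᵐ[μ] 0) :
    DenseRange (TensorProduct.lift (galoisBilin e hπ hD he)) := by
  classical
  have hC := hD.isPosSqrt.isPosSelfAdjoint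
  have h1 : Dense (LinearMap.range (TensorProduct.lift (galoisBilin e hπ hD he)) :
      Set (Lp (lp (fun _ : ι => H) 2) 2 μ)) := by
    rw [Submodule.dense_iff_topologicalClosure_eq_top, Submodule.topologicalClosure_eq_top_iff,
      Submodule.eq_bot_iff]
    intro z hz
    have hzm : ∀ i, AEStronglyMeasurable (fun g => z g i) μ := fun i =>
      (lp.evalCLM ℂ (fun _ : ι => H) 2 i).continuous.comp_aestronglyMeasurable
        (Lp.aestronglyMeasurable z)
    have h2 : ∀ (i : ι) (a : H), ∀ᵐ g ∂μ, (inner ℂ (π g a) (z g i) : ℂ) = 0 := by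
      intro i a
      refine htot _ ?_ fun c b hb => ?_
      · refine ((Lp.memLp z).norm.const_mul ‖a‖).of_le ?_ (Filter.Eventually.of_forall fun g => ?_)
        · exact (stronglyMeasurable_rep_apply e hπ
            stronglyMeasurable_const).aestronglyMeasurable.inner (hzm i)
        · refine (norm_inner_le_norm _ _).trans ?_
          rw [norm_rep_apply hπ, norm_mul, norm_norm, norm_norm]
          exact mul_le_mul_of_nonneg_left (lp.norm_apply_le_norm two_ne_zero _ _) (norm_nonneg _)
      · have h3 := hz _ ⟨(⟨_, rankOne_mem_nIdeal hC a hb⟩ : nIdeal C) ⊗ₜ[ℂ]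
          lp.single (E := fun _ : ι => H) 2 i c, rfl⟩
        rw [TensorProduct.lift.tmul, L2.inner_def] at h3
        rw [← h3]
        refine integral_congr_ae ?_
        filter_upwards [galoisBilin_ae e hπ hD he ⟨_, rankOne_mem_nIdeal hC a hb⟩
          (lp.single (E := fun _ : ι => H) 2 i c)] with g hg
        rw [hg]
        have h4 : galoisFun π (InnerProductSpace.rankOne ℂ a b)
            (lp.single (E := fun _ : ι => H) 2 i c) g =
            lp.single (E := fun _ : ι => H) 2 i ((inner ℂ (π g b) c : ℂ) • π g a) := by
          ext j
          rw [galoisFun_apply]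
          rcases eq_or_ne j i with rfl | hj
          · rw [lp.single_apply_self, lp.single_apply_self, InnerProductSpace.rankOne_apply,
              map_smul, inner_star_apply]
          · rw [lp.single_apply_ne _ _ _ hj, lp.single_apply_ne _ _ _ hj]
            simp
        rw [h4, lp.inner_single_left, inner_smul_left, inner_conj_symm]
    have h3 : ∀ᵐ g ∂μ, ∀ i j, (inner ℂ (π g (e j)) (z g i) : ℂ) = 0 :=
      ae_all_iff.2 fun i => ae_all_iff.2 fun j => h2 i (e j)
    refine Lp.ext ?_
    filter_upwards [h3, Lp.coeFn_zero (lp (fun _ : ι => H) 2) 2 μ] with g hg h0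
    rw [h0]
    ext i
    have h4 : star (π g) (z g i) = 0 := by
      have h5 := HilbertBasis.tsum_enorm_inner_sq e (star (π g) (z g i))
      simp only [inner_star_apply, hg] at h5
      simpa using h5.symm
    have h6 := norm_star_apply hπ g (z g i)
    rw [h4, norm_zero] at h6
    exact norm_eq_zero.1 h6.symm
  exact h1

end Galois

/-! ### Extension to the Hilbert space tensor product -/

section Extension

variable {M K L : Type*} [AddCommGroup M] [Module ℂ M]
  [NormedAddCommGroup K] [InnerProductSpace ℂ K]
  [NormedAddCommGroup L] [InnerProductSpace ℂ L]

/-- The map `M ⊗ K → K ⊗ K` induced by `Λ`, into the Hilbert space tensor product. -/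
def coeRTensor (Λ : M →ₗ[ℂ] K) : M ⊗[ℂ] K →ₗ[ℂ] UniformSpace.Completion (K ⊗[ℂ] K) :=
  (UniformSpace.Completion.toComplL (𝕜 := ℂ) (E := K ⊗[ℂ] K)).toLinearMap ∘ₗ
    LinearMap.rTensor K Λ

lemma coeRTensor_apply (Λ : M →ₗ[ℂ] K) (x : M ⊗[ℂ] K) :
    coeRTensor Λ x = ((LinearMap.rTensor K Λ x : K ⊗[ℂ] K) : UniformSpace.Completion (K ⊗[ℂ] K)) :=
  rfl

/-- As `x ↦ x ⊗ₜ y` is continuous, the closure of the range contains all elementary tensors, and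
these span. -/
lemma denseRange_coeRTensor (Λ : M →ₗ[ℂ] K) (hΛ : DenseRange Λ) : DenseRange (coeRTensor Λ) := by
  have h1 : DenseRange (LinearMap.rTensor K Λ) := by
    have h2 : Dense (LinearMap.range (LinearMap.rTensor K Λ) : Set (K ⊗[ℂ] K)) := by
      rw [Submodule.dense_iff_topologicalClosure_eq_top, eq_top_iff]
      rintro t -
      induction t using TensorProduct.induction_on with
      | zero => exact Submodule.zero_mem _
      | add x y hx hy => exact Submodule.add_mem _ hx hy
      | tmul x y =>
        have h3 : Continuous fun x : K => x ⊗ₜ[ℂ] y :=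
          AddMonoidHomClass.continuous_of_bound ((TensorProduct.mk ℂ K K).flip y) ‖y‖ fun x => by
            rw [LinearMap.flip_apply, TensorProduct.mk_apply, TensorProduct.norm_tmul, mul_comm]
        refine hΛ.induction_on (p := fun x => x ⊗ₜ[ℂ] y ∈
          (LinearMap.range (LinearMap.rTensor K Λ)).topologicalClosure) x ?_ ?_
        · exact (Submodule.isClosed_topologicalClosure _).preimage h3
        · intro m
          exact Submodule.le_topologicalClosure _ ⟨m ⊗ₜ[ℂ] y, LinearMap.rTensor_tmul _ _ _ _⟩
    exact h2
  exact UniformSpace.Completion.denseRange_coe.comp h1 (UniformSpace.Completion.continuous_coe _)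

/-- A bilinear map which is compatible with the norms extends to the Hilbert space tensor
product. -/
lemma exists_tensor_isometryEquiv [CompleteSpace L] (w : M →ₗ[ℂ] K →ₗ[ℂ] L) (Λ : M →ₗ[ℂ] K)
    (hΛ : DenseRange Λ) (hw : ∀ x y, ‖w x y‖ = ‖Λ x‖ * ‖y‖)
    (hd : DenseRange (TensorProduct.lift w)) :
    ∃ 𝒢 : UniformSpace.Completion (K ⊗[ℂ] K) ≃ₗᵢ[ℂ] L, ∀ x y,
      𝒢 ((Λ x ⊗ₜ[ℂ] y : K ⊗[ℂ] K) : UniformSpace.Completion (K ⊗[ℂ] K)) = w x y := by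
  -- Polarizing the norm identity gives equality of inner products on elementary tensors, and
  -- additivity extends it to all of `M ⊗ K`.
  have hin : ∀ x y, (inner ℂ (TensorProduct.lift w x) (TensorProduct.lift w y) : ℂ) =
      inner ℂ (coeRTensor Λ x) (coeRTensor Λ y) := by
    intro x y
    rw [coeRTensor_apply, coeRTensor_apply, UniformSpace.Completion.inner_coe]
    induction x using TensorProduct.induction_on with
    | zero => simp
    | add x x' hx hx' => simp only [map_add, inner_add_left, hx, hx']
    | tmul S k =>
      induction y using TensorProduct.induction_on with
      | zero => simp
      | add y y' hy hy' => simp only [map_add, inner_add_right, hy, hy']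
      | tmul S' k' =>
        rw [TensorProduct.lift.tmul, TensorProduct.lift.tmul, LinearMap.rTensor_tmul,
          LinearMap.rTensor_tmul, TensorProduct.inner_tmul]
        exact inner_eq_of_norm_eq w Λ LinearMap.id hw S S' k k'
  have hnorm : ∀ x, ‖TensorProduct.lift w (LinearEquiv.refl ℂ (M ⊗[ℂ] K) x)‖ =
      ‖coeRTensor Λ x‖ := by
    intro x
    rw [LinearEquiv.refl_apply, @norm_eq_sqrt_re_inner ℂ, hin, ← @norm_eq_sqrt_re_inner ℂ]
  refine ⟨(LinearEquiv.refl ℂ (M ⊗[ℂ] K)).extendOfIsometry (coeRTensor Λ) (TensorProduct.lift w)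
    (denseRange_coeRTensor Λ hΛ) hd hnorm, fun x y => ?_⟩
  have h1 : ((Λ x ⊗ₜ[ℂ] y : K ⊗[ℂ] K) : UniformSpace.Completion (K ⊗[ℂ] K)) =
      coeRTensor Λ (x ⊗ₜ[ℂ] y) := rfl
  rw [h1, LinearEquiv.extendOfIsometry_eq, LinearEquiv.refl_apply, TensorProduct.lift.tmul]

end Extension

/-- A square integrable irreducible projective representation on a separable Hilbert space, whose
coefficients are total in `L²(G)`, defines a Galois object. -/
theorem isGaloisObject_of_total {G : Type*} [Group G] [MeasurableSpace G] {μ : Measure G}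
    {H : Type u} [NormedAddCommGroup H] [InnerProductSpace ℂ H] [CompleteSpace H]
    [SecondCountableTopology H] {π : G → H →L[ℂ] H} {D C : H →ₗ.[ℂ] H}
    (hπ : IsIrreducibleProjRep π) (hD : IsDufloMoore μ π D C)
    (htot : ∀ h : G → ℂ, MemLp h 2 μ →
      (∀ x y, y ∈ C.domain → ∫ g, inner ℂ x (π g y) * h g ∂μ = 0) → h =ᵐ[μ] 0) :
    IsGaloisObject μ π := by
  have hC := hD.isPosSqrt.isPosSelfAdjoint
  obtain ⟨s, e, hs, he⟩ := exists_hilbertBasis_mem C.domain hC.dense_domain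
  have : Countable s := hs
  have hΛ := isGNS_gnsMap e hC (hD.isPosSqrt.eq_zero hD.nonsingular) he
  obtain ⟨𝒢, h𝒢⟩ := exists_tensor_isometryEquiv (galoisBilin e hπ hD he) (gnsMap e hC he)
    hΛ.denseRange (norm_galoisBilin e hπ hD he) (dense_range_galoisBilin e hπ hD he htot)
  refine ⟨hπ, D, C, hD, lp (fun _ : s => H) 2, inferInstance, inferInstance, inferInstance,
    gnsMap e hC he, hΛ, 𝒢, fun S T => ?_⟩
  rw [h𝒢]
  exact galoisBilin_ae e hπ hD he S (gnsMap e hC he T)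

/-! ### Irreducibility from the orthogonality relations -/

section Commutant

variable {G H : Type*} [Group G] [MeasurableSpace G] {μ : Measure G}
  [NormedAddCommGroup H] [InnerProductSpace ℂ H] [CompleteSpace H]

/-- The cases `a = 0, 1, I` determine the real and imaginary parts of `⟪R x, x⟫` as fixed multiples
of `‖x‖²`, and over `ℂ` the quadratic form determines the operator. -/
lemma eq_smul_one_of_norm_sq_eq {R : H →L[ℂ] H}
    (h : ∀ a : ℂ, ∃ l : ℝ, ∀ x, ‖R x + a • x‖ ^ 2 = l * ‖x‖ ^ 2) : ∃ c : ℂ, R = c • 1 := by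
  obtain ⟨l₀, h₀⟩ := h 0
  obtain ⟨l₁, h₁⟩ := h 1
  obtain ⟨l₂, h₂⟩ := h Complex.I
  have key : ∀ (a : ℂ) (x : H), ‖R x + a • x‖ ^ 2 =
      ‖R x‖ ^ 2 + 2 * (a * inner ℂ (R x) x).re + ‖a‖ ^ 2 * ‖x‖ ^ 2 := by
    intro a x
    rw [@norm_add_sq ℂ, inner_smul_right, norm_smul, mul_pow]
    rfl
  simp only [key] at h₀ h₁ h₂
  simp only [zero_mul, Complex.zero_re, mul_zero, norm_zero, one_mul, norm_one, one_pow, add_zero,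
    ne_eq, OfNat.ofNat_ne_zero, not_false_eq_true, zero_pow, Complex.norm_I, Complex.mul_re,
    Complex.I_re, Complex.I_im, zero_sub] at h₀ h₁ h₂
  refine ⟨starRingEnd ℂ (((l₁ - l₀ - 1) / 2 : ℝ) + ((l₀ + 1 - l₂) / 2 : ℝ) * Complex.I), ?_⟩
  set c : ℂ := ((l₁ - l₀ - 1) / 2 : ℝ) + ((l₀ + 1 - l₂) / 2 : ℝ) * Complex.I
  have h3 : ∀ x, inner ℂ (R x) x = c * (‖x‖ ^ 2 : ℝ) := by
    intro x
    apply Complex.ext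
    · rw [Complex.re_mul_ofReal]
      simp only [c, Complex.add_re, Complex.ofReal_re, Complex.re_ofReal_mul, Complex.I_re]
      linarith [h₀ x, h₁ x]
    · rw [Complex.im_mul_ofReal]
      simp only [c, Complex.add_im, Complex.ofReal_im, Complex.im_ofReal_mul, Complex.I_im]
      linarith [h₀ x, h₂ x]
  have h4 : (R - starRingEnd ℂ c • 1 : H →L[ℂ] H).toLinearMap = 0 := by
    rw [← inner_map_self_eq_zero]
    intro x
    change inner ℂ (R x - starRingEnd ℂ c • x) x = 0
    rw [inner_sub_left, inner_smul_left, h3, Complex.conj_conj, inner_self_eq_norm_sq_to_K]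
    push_cast
    simp
  rw [← sub_eq_zero]
  ext x
  exact LinearMap.congr_fun h4 x

/-- The orthogonality relations imply irreducibility. -/
lemma exists_eq_smul_one_of_commute {π : G → H →L[ℂ] H} {C : H →ₗ.[ℂ] H}
    (hC : IsPosSelfAdjoint C) (h0 : ∀ x : C.domain, C x = 0 → (x : H) = 0)
    (h : ∀ x y : H, ∫⁻ g, ‖(inner ℂ x (π g y) : ℂ)‖ₑ ^ 2 ∂μ = ‖x‖ₑ ^ 2 * formNormSq C y)
    (T : H →L[ℂ] H) (hT : ∀ g, T * π g = π g * T) : ∃ c : ℂ, T = c • 1 := by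
  by_cases hd : ∃ y : C.domain, (y : H) ≠ 0
  swap
  · push Not at hd
    have h1 : ∀ x : H, x = 0 := fun x => by
      refine hC.dense_domain.eq_zero_of_inner_left (𝕜 := ℂ) fun y hy => ?_
      have h2 : y = 0 := hd ⟨y, hy⟩
      rw [h2, inner_zero_right]
    exact ⟨0, by ext x; rw [h1 (T x)]; exact (h1 _).symm⟩
  obtain ⟨y, hy⟩ := hd
  have hN0 : formNormSq C y ≠ 0 := by
    rw [formNormSq_of_mem y.2]
    simpa using fun h1 => hy (h0 y h1)
  have hNt : formNormSq C y ≠ ∞ := by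
    rw [formNormSq_of_mem y.2]
    exact ENNReal.pow_ne_top (by simp)
  -- For `T'` in the commutant, moving `T'` across the inner product compares the orthogonality
  -- relations for `y` and `T' y`, so `‖star T' x‖` is a fixed multiple of `‖x‖`. This is then
  -- applied to `T` plus arbitrary scalars.
  have key : ∀ T' : H →L[ℂ] H, (∀ g, T' * π g = π g * T') →
      ∃ l : ℝ, ∀ x, ‖star T' x‖ ^ 2 = l * ‖x‖ ^ 2 := by
    intro T' hT'
    have h1 : ∀ x, ‖x‖ₑ ^ 2 * formNormSq C (T' y) = ‖star T' x‖ₑ ^ 2 * formNormSq C y := by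
      intro x
      rw [← h, ← h]
      refine lintegral_congr fun g => ?_
      have h2 : π g (T' y) = T' (π g y) := (congrArg (fun R => R (y : H)) (hT' g)).symm
      rw [h2, ContinuousLinearMap.star_eq_adjoint, ContinuousLinearMap.adjoint_inner_left]
    refine ⟨(formNormSq C (T' y) / formNormSq C y).toReal, fun x => ?_⟩
    have h2 : ‖star T' x‖ₑ ^ 2 = formNormSq C (T' y) / formNormSq C y * ‖x‖ₑ ^ 2 := by
      rw [← ENNReal.mul_div_right_comm, ENNReal.eq_div_iff hN0 hNt, mul_comm (formNormSq C (y : H)),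
        ← h1, mul_comm]
    have h3 := congrArg ENNReal.toReal h2
    simpa only [ENNReal.toReal_mul, ENNReal.toReal_pow, toReal_enorm] using h3
  obtain ⟨c, hc⟩ := eq_smul_one_of_norm_sq_eq (R := star T) fun a => by
    obtain ⟨l, hl⟩ := key (T + starRingEnd ℂ a • 1) fun g => by
      rw [add_mul, mul_add, hT g, smul_mul_assoc, mul_smul_comm, one_mul, mul_one]
    refine ⟨l, fun x => ?_⟩
    rw [← hl, star_add, star_smul, star_one]
    congr 2
    simp
  refine ⟨starRingEnd ℂ c, ?_⟩
  rw [← star_star T, hc, star_smul, star_one]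
  rfl

end Commutant

/-! ### Projectivity and orthogonality relations of π -/

section Rep

variable {Q V G : Type*} [Group Q] [TopologicalSpace Q] [IsTopologicalGroup Q]
  [LocallyCompactSpace Q] [T2Space Q]
  [SecondCountableTopology Q] [MeasurableSpace Q] [BorelSpace Q]
  [CommGroup V] [TopologicalSpace V] [IsTopologicalGroup V]
  [LocallyCompactSpace V] [T2Space V] [SecondCountableTopology V]
  [MeasurableSpace V] [BorelSpace V] [MulDistribMulAction Q V] [ContinuousSMul Q V]
  [MeasurableSpace (PontryaginDual V)] [BorelSpace (PontryaginDual V)]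
  [Group G] [TopologicalSpace G] [IsTopologicalGroup G] [LocallyCompactSpace G] [T2Space G]
  [SecondCountableTopology G] [MeasurableSpace G] [BorelSpace G]
  {S : GroupExtension V G Q} {σ : S.Section} {β : Q → Q → V}
  {μQ : Measure Q} [μQ.IsHaarMeasure]
  {η : Q → PontryaginDual V} {b : Q → Q → Circle}

/-- The cocycle identity factors the character at `q₁⁻¹ * q`, and `ψ = ∂b` at `(q⁻¹, q₁, q₂)`
rewrites the product of two values of `b`. The correction `η q (β q₁ q₂)` is what the `V`-component
of a product in `G` requires; the factors free of `q` form the multiplier. -/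
lemma piFun_piFun (hη : IsOneCocycle η) (hb : IsTrivialization η β b) (q₁ q₂ : Q) (v₁ v₂ : V)
    (φ : Q → ℂ) (q : Q) :
    piFun η b q₁ v₁ (piFun η b q₂ v₂ φ) q =
      (((η q₁⁻¹ v₂)⁻¹ * b q₁ q₂ : Circle) : ℂ) *
        piFun η b (q₁ * q₂) (v₁ * (q₁ • v₂) * β q₁ q₂) φ q := by
  have h1 : η (q₁⁻¹ * q) v₂ = η q₁⁻¹ v₂ * η q (q₁ • v₂) := by
    rw [hη.map_mul]
    change η q₁⁻¹ v₂ * dualAct q₁⁻¹ (η q) v₂ = _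
    rw [dualAct_apply, inv_inv]
  have h2 := hb.eq_coboundary q⁻¹ q₁ q₂
  rw [psi, coboundary, inv_inv, eq_div_iff_mul_eq'] at h2
  have h3 : b q⁻¹ q₁ * b (q⁻¹ * q₁) q₂ =
      b q₁ q₂ * b q⁻¹ (q₁ * q₂) * (η q (β q₁ q₂))⁻¹ := by
    rw [eq_mul_inv_iff_mul_eq, ← h2, mul_comm]
  have h4 := congrArg (fun z : Circle => (z : ℂ)) h3
  simp only [Circle.coe_mul] at h4
  simp only [piFun, ← Circle.coe_inv_eq_conj, h1, map_mul, mul_inv_rev, inv_inv, Circle.coe_mul]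
  rw [show q₂⁻¹ * (q₁⁻¹ * q) = q₂⁻¹ * q₁⁻¹ * q from (mul_assoc _ _ _).symm]
  linear_combination (((η q v₁)⁻¹ : Circle) : ℂ) * (((η q (q₁ • v₂))⁻¹ : Circle) : ℂ) *
    (((η q₁⁻¹ v₂)⁻¹ : Circle) : ℂ) * φ (q₂⁻¹ * q₁⁻¹ * q) * h4

lemma piFun_congr_ae {φ ψ : Q → ℂ} (h : φ =ᵐ[μQ] ψ) (q : Q) (v : V) :
    piFun η b q v φ =ᵐ[μQ] piFun η b q v ψ := by
  filter_upwards [(measurePreserving_mul_left μQ q⁻¹).quasiMeasurePreserving.ae h] with x hx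
  simp only [piFun, hx]

lemma piOp_mul (hη : IsOneCocycle η) (hb : IsTrivialization η β b) (q₁ q₂ : Q) (v₁ v₂ : V) :
    piOp μQ hη.continuous hb.measurable q₁ v₁ * piOp μQ hη.continuous hb.measurable q₂ v₂ =
      (((η q₁⁻¹ v₂)⁻¹ * b q₁ q₂ : Circle) : ℂ) •
        piOp μQ hη.continuous hb.measurable (q₁ * q₂) (v₁ * (q₁ • v₂) * β q₁ q₂) := by
  ext1 φ
  set z : ℂ := (((η q₁⁻¹ v₂)⁻¹ * b q₁ q₂ : Circle) : ℂ)
  have h1 := piOp_apply_ae μQ hη.continuous hb.measurable q₁ v₁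
    (piOp μQ hη.continuous hb.measurable q₂ v₂ φ)
  have h2 := piFun_congr_ae (η := η) (b := b)
    (piOp_apply_ae μQ hη.continuous hb.measurable q₂ v₂ φ) q₁ v₁
  have h3 := piOp_apply_ae μQ hη.continuous hb.measurable (q₁ * q₂) (v₁ * (q₁ • v₂) * β q₁ q₂) φ
  have h4 := Lp.coeFn_smul z
    (piOp μQ hη.continuous hb.measurable (q₁ * q₂) (v₁ * (q₁ • v₂) * β q₁ q₂) φ)
  refine Lp.ext ((h1.trans h2).trans (Filter.EventuallyEq.trans ?_ h4.symm))
  filter_upwards [h3] with q hq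
  rw [piFun_piFun hη hb, Pi.smul_apply, smul_eq_mul, hq]

lemma norm_piOp (hη : Continuous η) (hb : Measurable fun p : Q × Q => (b p.1 p.2 : ℂ))
    (q : Q) (v : V) (φ : Lp ℂ 2 μQ) : ‖piOp μQ hη hb q v φ‖ = ‖φ‖ := by
  have h : eLpNorm (piOp μQ hη hb q v φ) 2 μQ = eLpNorm φ 2 μQ := by
    rw [eLpNorm_congr_ae (piOp_apply_ae μQ hη hb q v φ),
      ← eLpNorm_comp_measurePreserving (Lp.aestronglyMeasurable φ)
        (measurePreserving_mul_left μQ q⁻¹)]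
    exact eLpNorm_congr_norm_ae
      (Filter.Eventually.of_forall fun q₀ => norm_piFun η b q v φ q₀)
  rw [Lp.norm_def, Lp.norm_def, h]

lemma vPart_mul (hS : IsTopExtension S) (hβ : IsRepresentative S σ β) (g h : G) :
    vPart S σ (g * h) = vPart S σ g * (S.rightHom g • vPart S σ h) *
      β (S.rightHom g) (S.rightHom h) := by
  have h1 := extension_mul hS hβ (S.rightHom g) (S.rightHom h) (vPart S σ g) (vPart S σ h)
  rw [inl_vPart_mul, inl_vPart_mul] at h1
  rw [h1, vPart_inl_mul]

lemma piRep_mul (hS : IsTopExtension S) (hβ : IsRepresentative S σ β) (hη : IsOneCocycle η)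
    (hb : IsTrivialization η β b) (g h : G) :
    ∃ z : Circle, piRep S σ μQ hη.continuous hb.measurable g *
      piRep S σ μQ hη.continuous hb.measurable h =
        (z : ℂ) • piRep S σ μQ hη.continuous hb.measurable (g * h) := by
  refine ⟨(η (S.rightHom g)⁻¹ (vPart S σ h))⁻¹ * b (S.rightHom g) (S.rightHom h), ?_⟩
  simp only [piRep]
  rw [vPart_mul hS hβ, map_mul]
  exact piOp_mul hη hb (S.rightHom g) (S.rightHom h) (vPart S σ g) (vPart S σ h)

/-- An isometry only needs a right inverse. `π 1` is a scalar because `π 1 * π 1` is a multiple of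
the injective `π 1`; then `π g⁻¹` inverts `π g` up to a scalar. -/
lemma mem_unitary_of_projective {H : Type*} [NormedAddCommGroup H] [InnerProductSpace ℂ H]
    [CompleteSpace H] {π : G → H →L[ℂ] H} (hn : ∀ g x, ‖π g x‖ = ‖x‖)
    (hm : ∀ g h, ∃ z : Circle, π g * π h = (z : ℂ) • π (g * h)) (g : G) :
    π g ∈ unitary (H →L[ℂ] H) := by
  obtain ⟨z, hz⟩ := hm 1 1
  rw [mul_one] at hz
  have h1 : π 1 = (z : ℂ) • 1 := by
    ext x
    have h2 : π 1 (π 1 x - (z : ℂ) • x) = 0 := by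
      rw [map_sub, map_smul, sub_eq_zero]
      exact congrArg (fun R => R x) hz
    have h3 := hn 1 (π 1 x - (z : ℂ) • x)
    rw [h2, norm_zero] at h3
    exact sub_eq_zero.1 (norm_eq_zero.1 h3.symm)
  obtain ⟨w, hw⟩ := hm g g⁻¹
  rw [mul_inv_cancel, h1, smul_smul] at hw
  refine mem_unitary_of_norm_map (hn g) (R := ((w : ℂ) * z)⁻¹ • π g⁻¹) ?_
  rw [mul_smul_comm, hw, smul_smul, inv_mul_cancel₀ (mul_ne_zero (Circle.coe_ne_zero w)
    (Circle.coe_ne_zero z)), one_smul]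

/-- The integrand of a matrix coefficient of `π`, up to the character of `V`. -/
def coeffIntegrand (b : Q → Q → Circle) (x y : Q → ℂ) (q q₀ : Q) : ℂ :=
  starRingEnd ℂ (x q₀) * b q₀⁻¹ q * y (q⁻¹ * q₀)

lemma measurable_coeffIntegrand (hb : Measurable fun p : Q × Q => (b p.1 p.2 : ℂ)) {x y : Q → ℂ}
    (hx : Measurable x) (hy : Measurable y) :
    Measurable fun p : Q × Q => coeffIntegrand b x y p.1 p.2 := by
  refine ((Complex.continuous_conj.measurable.comp (hx.comp measurable_snd)).mul
    (hb.comp (measurable_snd.inv.prodMk measurable_fst))).mul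
    (hy.comp (measurable_fst.inv.mul measurable_snd))

lemma norm_coeffIntegrand (x y : Q → ℂ) (q q₀ : Q) :
    ‖coeffIntegrand b x y q q₀‖ = ‖x q₀‖ * ‖y (q⁻¹ * q₀)‖ := by
  simp only [coeffIntegrand, norm_mul, RCLike.norm_conj, Circle.norm_coe, mul_one]

lemma enorm_coeffIntegrand (x y : Q → ℂ) (q q₀ : Q) :
    ‖coeffIntegrand b x y q q₀‖ₑ = ‖x q₀‖ₑ * ‖y (q⁻¹ * q₀)‖ₑ := by
  rw [← ofReal_norm, norm_coeffIntegrand, ENNReal.ofReal_mul (norm_nonneg _), ofReal_norm,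
    ofReal_norm]

lemma integrable_coeffIntegrand (hb : Measurable fun p : Q × Q => (b p.1 p.2 : ℂ))
    (x y : Lp ℂ 2 μQ) (q : Q) : Integrable (coeffIntegrand b x y q) μQ := by
  have h1 : MemLp (fun q₀ => y (q⁻¹ * q₀)) 2 μQ :=
    (Lp.memLp y).comp_measurePreserving (measurePreserving_mul_left μQ q⁻¹)
  refine ((Lp.memLp x).norm.integrable_mul h1.norm).mono' ?_
    (Filter.Eventually.of_forall fun q₀ => (norm_coeffIntegrand _ _ _ _).le)
  exact ((measurable_coeffIntegrand hb (Lp.stronglyMeasurable x).measurable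
    (Lp.stronglyMeasurable y).measurable).comp measurable_prodMk_left).aestronglyMeasurable

/-- For fixed `q` a matrix coefficient is a Fourier transform along `η`, which brings in the
Plancherel formula. -/
lemma inner_piOp (hη : Continuous η) (hb : Measurable fun p : Q × Q => (b p.1 p.2 : ℂ))
    (x y : Lp ℂ 2 μQ) (q : Q) (v : V) :
    inner ℂ x (piOp μQ hη hb q v y) = cofourier μQ η (coeffIntegrand b x y q) v := by
  rw [L2.inner_def]
  refine integral_congr_ae ?_
  filter_upwards [piOp_apply_ae μQ hη hb q v y] with q₀ h₀
  rw [h₀]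
  simp only [RCLike.inner_apply, piFun, coeffIntegrand]
  ring

lemma measurable_cofourier_coeffIntegrand (hη : IsOneCocycle η)
    (hb : Measurable fun p : Q × Q => (b p.1 p.2 : ℂ)) {x y : Q → ℂ}
    (hx : Measurable x) (hy : Measurable y) :
    Measurable fun p : Q × V => cofourier μQ η (coeffIntegrand b x y p.1) p.2 := by
  have h1 : Measurable fun p : (Q × V) × Q =>
      coeffIntegrand b x y p.1.1 p.2 * starRingEnd ℂ (η p.2 p.1.2 : ℂ) := by
    refine ((measurable_coeffIntegrand hb hx hy).comp
      ((measurable_fst.comp measurable_fst).prodMk measurable_snd)).mul ?_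
    exact (Complex.continuous_conj.comp ((continuous_eval_cocycle hη).comp
      (continuous_snd.prodMk (continuous_snd.comp continuous_fst)))).measurable
  exact (StronglyMeasurable.integral_prod_right' (ν := μQ)
    (f := fun p : (Q × V) × Q =>
      coeffIntegrand b x y p.1.1 p.2 * starRingEnd ℂ (η p.2 p.1.2 : ℂ))
    h1.stronglyMeasurable).measurable

lemma measurable_piRep (hS : IsTopExtension S) (hσ : Measurable σ) (hη : IsOneCocycle η)
    (hb : Measurable fun p : Q × Q => (b p.1 p.2 : ℂ)) (x y : Lp ℂ 2 μQ) :
    Measurable fun g => (inner ℂ x (piRep S σ μQ hη.continuous hb g y) : ℂ) := by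
  have h := measurable_cofourier_coeffIntegrand (μQ := μQ) hη hb
    (Lp.stronglyMeasurable x).measurable (Lp.stronglyMeasurable y).measurable
  have h2 : Measurable fun g => (S.rightHom g, vPart S σ g) :=
    hS.continuous_rightHom.measurable.prodMk (measurable_vPart hS hσ)
  have h3 : (fun g => (inner ℂ x (piRep S σ μQ hη.continuous hb g y) : ℂ)) =
      (fun p : Q × V => cofourier μQ η (coeffIntegrand b x y p.1) p.2) ∘
        fun g => (S.rightHom g, vPart S σ g) := by
    funext g
    exact inner_piOp hη.continuous hb x y _ _
  rw [h3]
  exact h.comp h2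

/-- `d` is the density of the inversion with respect to the measure `μ`. -/
structure IsInvDensity (μ : Measure Q) (d : Q → ℝ≥0) : Prop where
  measurable : Measurable d
  ne_zero : ∀ q, d q ≠ 0
  lintegral_inv : ∀ F : Q → ℝ≥0∞, Measurable F → ∫⁻ q, F q⁻¹ ∂μ = ∫⁻ q, d q * F q ∂μ

lemma IsInvDensity.lintegral_inv_mul {d : Q → ℝ≥0} (hd : IsInvDensity μQ d)
    {F : Q → ℝ≥0∞} (hF : Measurable F) (q₀ : Q) :
    ∫⁻ q, F (q⁻¹ * q₀) ∂μQ = ∫⁻ q, d q * F q ∂μQ := by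
  rw [← hd.lintegral_inv F hF, ← lintegral_mul_left_eq_self _ q₀]
  refine lintegral_congr fun q => ?_
  rw [mul_inv_rev, inv_mul_cancel_right]

/-- The square root of the function by which the Duflo-Moore operator multiplies. -/
def dufloMooreRoot (V : Type*) [CommGroup V] [TopologicalSpace V] [IsTopologicalGroup V]
    [LocallyCompactSpace V] [MeasurableSpace V] [BorelSpace V] [MulDistribMulAction Q V]
    [ContinuousSMul Q V] (κ c : ℝ≥0∞) (d : Q → ℝ≥0) (q : Q) : ℝ :=
  √((κ * c⁻¹).toReal * (modulus V q * d q : ℝ≥0))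

lemma measurable_dufloMooreRoot (κ c : ℝ≥0∞) {d : Q → ℝ≥0} (hd : Measurable d) :
    Measurable (dufloMooreRoot V κ c d) :=
  (((measurable_modulus.mul hd).coe_nnreal_real).const_mul _).sqrt

lemma dufloMooreRoot_pos {κ c : ℝ≥0∞} (hκ0 : κ ≠ 0) (hκt : κ ≠ ∞) (hc0 : c ≠ 0) (hct : c ≠ ∞)
    {d : Q → ℝ≥0} (hd : ∀ q, d q ≠ 0) (q : Q) : 0 < dufloMooreRoot V κ c d q := by
  refine Real.sqrt_pos.2 (mul_pos (ENNReal.toReal_pos (mul_ne_zero hκ0 (ENNReal.inv_ne_zero.2 hct))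
    (ENNReal.mul_ne_top hκt (ENNReal.inv_ne_top.2 hc0))) ?_)
  exact NNReal.coe_pos.2 (pos_iff_ne_zero.2 (mul_ne_zero (modulus_ne_zero q) (hd q)))

lemma enorm_dufloMooreRoot_sq {κ c : ℝ≥0∞} (hκt : κ ≠ ∞) (hc0 : c ≠ 0)
    (d : Q → ℝ≥0) (q : Q) :
    ‖dufloMooreRoot V κ c d q‖ₑ ^ 2 = κ * c⁻¹ * (modulus V q * d q) := by
  rw [dufloMooreRoot, ← ofReal_norm, Real.norm_of_nonneg (Real.sqrt_nonneg _),
    ← ENNReal.ofReal_pow (Real.sqrt_nonneg _), Real.sq_sqrt (by positivity),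
    ENNReal.ofReal_mul ENNReal.toReal_nonneg,
    ENNReal.ofReal_toReal (ENNReal.mul_ne_top hκt (ENNReal.inv_ne_top.2 hc0)),
    ENNReal.ofReal_coe_nnreal, ENNReal.coe_mul]

/-- Let `δ` be the modulus. Plancherel for fixed `q` turns the integral over `v` into `c⁻¹ ∫
|x(q₀)|² |y(q⁻¹ q₀)|² δ(q₀) dq₀`. Together with the weight `δ(q)⁻¹` of Haar measure the modulus
becomes `δ(q⁻¹ q₀)`, and the substitution `q ↦ q⁻¹ q₀` decouples `x` from `y` at the cost of the
inversion density `d`. -/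
lemma lintegral_coeff_piRep {μV : Measure V} [μV.IsHaarMeasure]
    {μV' : Measure (PontryaginDual V)} [μV'.IsHaarMeasure] {μG : Measure G}
    (hS : IsTopExtension S) (hσ : Measurable σ) (hη : IsOneCocycle η)
    (hiso : IsMeasureClassIso μQ μV' η)
    (hb : Measurable fun p : Q × Q => (b p.1 p.2 : ℂ))
    {κ c : ℝ≥0∞} (hκt : κ ≠ ∞) (hc : IsPlancherelConst μQ μV η c) {d : Q → ℝ≥0}
    (hd : IsInvDensity μQ d)
    (hμG : μG = κ • ((μQ.withDensity fun q => (modulus V q : ℝ≥0∞)⁻¹).prod μV).map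
        (extensionEquiv hS hσ)) (x y : Lp ℂ 2 μQ) :
    ∫⁻ g, ‖(inner ℂ x (piRep S σ μQ hη.continuous hb g y) : ℂ)‖ₑ ^ 2 ∂μG =
      ‖x‖ₑ ^ 2 * formNormSq (mulOp μQ (dufloMooreRoot V κ c d)) y := by
  have hδ : Measurable fun q : Q => (modulus V q : ℝ≥0∞) := measurable_modulus.coe_nnreal_ennreal
  have hδ0 : ∀ q : Q, (modulus V q : ℝ≥0∞) ≠ 0 := fun q => by exact_mod_cast modulus_ne_zero q
  have hxm := (Lp.stronglyMeasurable x).measurable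
  have hym := (Lp.stronglyMeasurable y).measurable
  have hm := (measurable_cofourier_coeffIntegrand (μQ := μQ) hη hb hxm hym).enorm.pow_const 2
  rw [hμG, lintegral_smul_measure, lintegral_map_equiv]
  have h1 : ∀ p : Q × V, (inner ℂ x (piRep S σ μQ hη.continuous hb
      (extensionEquiv hS hσ p) y) : ℂ) = cofourier μQ η (coeffIntegrand b x y p.1) p.2 := by
    intro p
    rw [piRep, inner_piOp]
    change cofourier μQ η (coeffIntegrand b x y (S.rightHom (S.inl p.2 * σ p.1)))
      (vPart S σ (S.inl p.2 * σ p.1)) = _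
    rw [rightHom_inl_mul, vPart_inl_mul, GroupExtension.Section.rightHom_section]
  simp only [h1]
  have hσ' : SigmaFinite (μQ.withDensity fun q : Q => (modulus V q : ℝ≥0∞)⁻¹) := by
    simp only [← ENNReal.coe_inv (modulus_ne_zero _)]
    exact SigmaFinite.withDensity _
  rw [lintegral_prod _ hm.aemeasurable, show ∫⁻ q, ∫⁻ v,
      ‖cofourier μQ η (coeffIntegrand b x y q) v‖ₑ ^ 2 ∂μV
        ∂(μQ.withDensity fun q : Q => (modulus V q : ℝ≥0∞)⁻¹) =
      ∫⁻ q, (modulus V q : ℝ≥0∞)⁻¹ * ∫⁻ v,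
        ‖cofourier μQ η (coeffIntegrand b x y q) v‖ₑ ^ 2 ∂μV ∂μQ from
    lintegral_withDensity_eq_lintegral_mul _ hδ.inv hm.lintegral_prod_right']
  simp only [lintegral_cofourier hη hiso hc (integrable_coeffIntegrand hb x y _),
    enorm_coeffIntegrand]
  have hF : Measurable fun q : Q => (modulus V q : ℝ≥0∞) * ‖y q‖ₑ ^ 2 :=
    hδ.mul (hym.enorm.pow_const 2)
  calc κ • ∫⁻ q, (modulus V q : ℝ≥0∞)⁻¹ * (c⁻¹ * ∫⁻ q₀, (‖x q₀‖ₑ * ‖y (q⁻¹ * q₀)‖ₑ) ^ 2 *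
          modulus V q₀ ∂μQ) ∂μQ
      = κ * ∫⁻ q, ∫⁻ q₀, c⁻¹ * (‖x q₀‖ₑ ^ 2 * (modulus V (q⁻¹ * q₀) *
          ‖y (q⁻¹ * q₀)‖ₑ ^ 2)) ∂μQ ∂μQ := by
        rw [smul_eq_mul]
        congr 1
        refine lintegral_congr fun q => ?_
        rw [← lintegral_const_mul' _ _ (ENNReal.inv_ne_top.2 hc.1),
          ← lintegral_const_mul' _ _ (ENNReal.inv_ne_top.2 (hδ0 q))]
        refine lintegral_congr fun q₀ => ?_
        rw [modulus_mul, modulus_inv, ENNReal.coe_mul, ENNReal.coe_inv (modulus_ne_zero q)]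
        ring
    _ = κ * ∫⁻ q₀, c⁻¹ * (‖x q₀‖ₑ ^ 2 * ∫⁻ q, (modulus V (q⁻¹ * q₀) *
          ‖y (q⁻¹ * q₀)‖ₑ ^ 2) ∂μQ) ∂μQ := by
        rw [lintegral_lintegral_swap]
        · congr 1
          refine lintegral_congr fun q₀ => ?_
          rw [lintegral_const_mul' _ _ (ENNReal.inv_ne_top.2 hc.1),
            lintegral_const_mul' _ _ (ENNReal.pow_ne_top (by simp))]
        · refine (Measurable.const_mul ?_ _).aemeasurable
          exact ((hxm.comp measurable_snd).enorm.pow_const 2).mul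
            (hF.comp (measurable_fst.inv.mul measurable_snd))
    _ = κ * ∫⁻ q₀, ‖x q₀‖ₑ ^ 2 * (c⁻¹ * ∫⁻ q, d q * (modulus V q * ‖y q‖ₑ ^ 2) ∂μQ) ∂μQ := by
        congr 1
        refine lintegral_congr fun q₀ => ?_
        rw [hd.lintegral_inv_mul hF]
        ring
    _ = _ := by
        rw [lintegral_mul_const _ (hxm.enorm.pow_const 2), ← enorm_sq_Lp,
          formNormSq_mulOp (measurable_dufloMooreRoot κ c hd.measurable)]
        simp only [enorm_dufloMooreRoot_sq hκt hc.1]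
        rw [mul_left_comm, ← mul_assoc κ, ← lintegral_const_mul' _ _
          (ENNReal.mul_ne_top hκt (ENNReal.inv_ne_top.2 hc.1))]
        congr 1
        refine lintegral_congr fun q => ?_
        ring

end Rep

/-! ### Parseval criteria in Hilbert space and on product spaces -/

section Hilbert

/-- A vector satisfying Parseval's identity with respect to an orthonormal system is orthogonal to
the orthogonal complement of the system. -/
lemma inner_eq_zero_of_parseval {L ι : Type*} [NormedAddCommGroup L] [InnerProductSpace ℂ L]
    [CompleteSpace L] {w : ι → L} (hw : Orthonormal ℂ w) {F z : L}
    (hF : ‖F‖ₑ ^ 2 ≤ ∑' i, ‖(inner ℂ (w i) F : ℂ)‖ₑ ^ 2) (hz : ∀ i, (inner ℂ (w i) z : ℂ) = 0) :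
    (inner ℂ z F : ℂ) = 0 := by
  rcases eq_or_ne z 0 with rfl | hz0
  · exact inner_zero_left _
  have hzz : (inner ℂ z z : ℂ) ≠ 0 := inner_self_ne_zero.2 hz0
  -- Removing from `F` its component along `z` keeps the coefficients with respect to `w`. Bessel
  -- for `u` and the hypothesis on `F` give `‖F‖ ≤ ‖u‖`, so by Pythagoras that component vanishes.
  set a : ℂ := inner ℂ z F / inner ℂ z z
  set u := F - a • z
  have h1 : ∀ i, (inner ℂ (w i) F : ℂ) = inner ℂ (w i) u := fun i => by
    rw [inner_sub_right, inner_smul_right, hz, mul_zero, sub_zero]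
  simp only [h1] at hF
  have h2 : ‖F‖ₑ ^ 2 ≤ ‖u‖ₑ ^ 2 := by
    refine hF.trans ?_
    rw [ENNReal.tsum_eq_iSup_sum]
    exact iSup_le fun s => Orthonormal.sum_enorm_inner_sq_le hw s u
  have h3 : ‖F‖ ^ 2 ≤ ‖u‖ ^ 2 := by
    have := ENNReal.toReal_mono (ENNReal.pow_ne_top (by simp)) h2
    simpa only [ENNReal.toReal_pow, toReal_enorm] using this
  have h4 : (inner ℂ z u : ℂ) = 0 := by
    rw [inner_sub_right, inner_smul_right, div_mul_cancel₀ _ hzz, sub_self]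
  have h5 : ‖u + a • z‖ ^ 2 = ‖u‖ ^ 2 + ‖a • z‖ ^ 2 := by
    have h6 := norm_add_sq_eq_norm_sq_add_norm_sq_of_inner_eq_zero (𝕜 := ℂ) u (a • z) (by
      rw [inner_smul_right, ← inner_conj_symm, h4, map_zero, mul_zero])
    simpa only [sq] using h6
  rw [sub_add_cancel] at h5
  have h6 : ‖a • z‖ = 0 := by
    have := sq_nonneg ‖a • z‖
    exact pow_eq_zero_iff two_ne_zero |>.1 (by linarith)
  have h7 : F = u := by
    rw [norm_eq_zero] at h6
    simp only [u, h6, sub_zero]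
  rw [h7, h4]

lemma tsum_enorm_inner_sq' {H ι : Type*} [NormedAddCommGroup H] [InnerProductSpace ℂ H]
    [CompleteSpace H] (e : HilbertBasis ι ℂ H) (x : H) :
    ∑' i, ‖(inner ℂ x (e i) : ℂ)‖ₑ ^ 2 = ‖x‖ₑ ^ 2 := by
  simp only [enorm_inner_symm x]
  exact HilbertBasis.tsum_enorm_inner_sq e x

/-- Bounded integrable functions contain a countable Hilbert basis of `L²`. -/
lemma exists_hilbertBasis_bddIntegrable {X : Type*} [MeasurableSpace X] (μ : Measure X)
    [SecondCountableTopology (Lp ℂ 2 μ)] :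
    ∃ (s : Set (Lp ℂ 2 μ)) (e : HilbertBasis s ℂ (Lp ℂ 2 μ)) (h : s → X → ℂ), s.Countable ∧
      ∀ i, IsBddIntegrable μ (h i) ∧ e i =ᵐ[μ] h i := by
  obtain ⟨s, e, hs, he⟩ := exists_hilbertBasis_mem
    (LinearMap.range (bddIntegrableToLp μ)) (denseRange_bddIntegrableToLp μ)
  choose h hh using he
  refine ⟨s, e, fun i => (h i).1, hs, fun i => ⟨(h i).2, ?_⟩⟩
  rw [← hh]
  exact (IsBddIntegrable.memLp (h i).2).coeFn_toLp

/-- A square integrable function on a product which is orthogonal to all product functions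
vanishes. -/
lemma ae_eq_zero_of_forall_integral_prod {X Y : Type*} [MeasurableSpace X] [MeasurableSpace Y]
    {μ : Measure X} {ν : Measure Y} [SigmaFinite μ] [SigmaFinite ν]
    [SecondCountableTopology (Lp ℂ 2 ν)] {z : X × Y → ℂ} (hz : MemLp z 2 (μ.prod ν))
    (h0 : ∀ (θ : X → ℂ) (h : Y → ℂ), IsBddIntegrable μ θ → IsBddIntegrable ν h →
      ∫ p, z p * (θ p.1 * h p.2) ∂(μ.prod ν) = 0) : z =ᵐ[μ.prod ν] 0 := by
  obtain ⟨s, e, h, hs, he⟩ := exists_hilbertBasis_bddIntegrable ν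
  have : Countable s := hs
  have hsec : ∀ᵐ x ∂μ, MemLp (fun y => z (x, y)) 2 ν := by
    have h1 := (lintegral_enorm_sq_lt_top_iff hz.1).2 hz
    rw [lintegral_prod _ (hz.1.enorm.pow_const 2)] at h1
    filter_upwards [ae_lt_top' (hz.1.enorm.pow_const 2).lintegral_prod_right' h1.ne,
      hz.1.prodMk_left] with x h2 h3
    exact (lintegral_enorm_sq_lt_top_iff h3).1 h2
  -- Taking for `θ` the indicators of sets of finite measure shows that the partial integral against
  -- each basis function has zero integral over all such sets.
  have hk : ∀ i, ∀ᵐ x ∂μ, ∫ y, z (x, y) * h i y ∂ν = 0 := by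
    intro i
    have hint : ∀ A, MeasurableSet A → μ A < ∞ →
        Integrable (fun p : X × Y => z p * (A.indicator (fun _ => (1 : ℂ)) p.1 * h i p.2))
          (μ.prod ν) := by
      intro A hA hAt
      suffices h : MemLp (fun p : X × Y => A.indicator (fun _ => (1 : ℂ)) p.1 * h i p.2) 2
          (μ.prod ν) from hz.integrable_mul h
      have h1 : MemLp (A.indicator fun _ => (1 : ℂ)) 2 μ := memLp_indicator_const 2 hA 1
        (Or.inr hAt.ne)
      rw [← lintegral_enorm_sq_lt_top_iff]
      · have h2 : ∀ p : X × Y, ‖A.indicator (fun _ => (1 : ℂ)) p.1 * h i p.2‖ₑ ^ 2 =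
            ‖A.indicator (fun _ => (1 : ℂ)) p.1‖ₑ ^ 2 * ‖h i p.2‖ₑ ^ 2 := fun p => by
          rw [enorm_mul, mul_pow]
        simp only [h2]
        rw [lintegral_prod_mul (h1.1.enorm.pow_const 2)
          ((he i).1.measurable.enorm.pow_const 2).aemeasurable]
        exact ENNReal.mul_lt_top ((lintegral_enorm_sq_lt_top_iff h1.1).2 h1)
          ((lintegral_enorm_sq_lt_top_iff (he i).1.memLp.1).2 (he i).1.memLp)
      · exact (((measurable_const.indicator hA).comp measurable_fst).mul
          ((he i).1.measurable.comp measurable_snd)).aestronglyMeasurable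
    have hfub : ∀ A : Set X, (fun x => ∫ y, z (x, y) * (A.indicator (fun _ => (1 : ℂ)) x * h i y) ∂ν) =
        A.indicator fun x => ∫ y, z (x, y) * h i y ∂ν := by
      intro A
      funext x
      by_cases hx : x ∈ A <;> simp [hx]
    refine ae_eq_zero_of_forall_setIntegral_eq_of_sigmaFinite (fun A hA hAt => ?_)
      fun A hA hAt => ?_
    · have h1 := (hint A hA hAt).integral_prod_left
      simp only [hfub] at h1
      exact (integrable_indicator_iff hA).1 h1
    · have h1 := h0 (A.indicator fun _ => (1 : ℂ)) (h i) ⟨measurable_const.indicator hA, ⟨1, fun x =>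
        (norm_indicator_le_norm_self _ _).trans (by simp)⟩,
        (integrable_indicator_iff hA).2 (integrableOn_const hAt.ne)⟩ (he i).1
      rw [integral_prod _ (hint A hA hAt)] at h1
      simp only [hfub] at h1
      rwa [integral_indicator hA] at h1
  have hsec0 : ∀ᵐ x ∂μ, ∫⁻ y, ‖z (x, y)‖ₑ ^ 2 ∂ν = 0 := by
    filter_upwards [hsec, ae_all_iff.2 hk] with x hx hx0
    -- The pairing in the hypothesis is bilinear, so orthogonality in `L²` concerns the conjugate of
    -- the section.
    have h1 : MemLp (fun y => starRingEnd ℂ (z (x, y))) 2 ν := hx.star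
    have h2 := tsum_enorm_inner_sq' e (h1.toLp _)
    have h3 : ∀ i, (inner ℂ (h1.toLp _) (e i) : ℂ) = 0 := by
      intro i
      rw [← hx0 i, L2.inner_def]
      refine integral_congr_ae ?_
      filter_upwards [h1.coeFn_toLp, (he i).2] with y h4 h5
      rw [h4, h5]
      simp only [RCLike.inner_apply, Complex.conj_conj]
      ring
    simp only [h3, enorm_zero, ne_eq, OfNat.ofNat_ne_zero, not_false_eq_true, zero_pow,
      tsum_zero] at h2
    rw [enorm_sq_toLp] at h2
    simp only [RCLike.enorm_conj] at h2
    exact h2.symm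
  have h1 : ∫⁻ p, ‖z p‖ₑ ^ 2 ∂(μ.prod ν) = 0 := by
    rw [lintegral_prod _ (hz.1.enorm.pow_const 2), lintegral_congr_ae hsec0, lintegral_zero]
  rw [lintegral_eq_zero_iff' (hz.1.enorm.pow_const 2)] at h1
  filter_upwards [h1] with p hp
  simpa using hp

end Hilbert

/-! ### Orthogonality relations between matrix coefficients -/

section Coefficients

variable {G H : Type*} [Group G] [MeasurableSpace G] {μ : Measure G}
  [NormedAddCommGroup H] [InnerProductSpace ℂ H] [CompleteSpace H]
  {π : G → H →L[ℂ] H} {D C : H →ₗ.[ℂ] H}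

lemma memLp_coeff (hπ : IsIrreducibleProjRep π) (hD : IsDufloMoore μ π D C) (x : H)
    (y : C.domain) : MemLp (fun g => (inner ℂ x (π g y) : ℂ)) 2 μ := by
  rw [← lintegral_enorm_sq_lt_top_iff (hπ.measurable_coeff x y).aestronglyMeasurable,
    hD.lintegral_coeff, formNormSq_of_mem y.2]
  exact ENNReal.mul_lt_top (by simp) (by simp)

/-- A square integrable matrix coefficient as an element of `L²(G)`. -/
def coeffLp (hπ : IsIrreducibleProjRep π) (hD : IsDufloMoore μ π D C) (x : H) (y : C.domain) :
    Lp ℂ 2 μ :=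
  (memLp_coeff hπ hD x y).toLp _

lemma coeffLp_ae (hπ : IsIrreducibleProjRep π) (hD : IsDufloMoore μ π D C) (x : H)
    (y : C.domain) : coeffLp hπ hD x y =ᵐ[μ] fun g => (inner ℂ x (π g y) : ℂ) :=
  (memLp_coeff hπ hD x y).coeFn_toLp

lemma coeffLp_add_left (hπ : IsIrreducibleProjRep π) (hD : IsDufloMoore μ π D C) (x x' : H)
    (y : C.domain) : coeffLp hπ hD (x + x') y = coeffLp hπ hD x y + coeffLp hπ hD x' y := by
  unfold coeffLp
  rw [← MemLp.toLp_add]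
  exact MemLp.toLp_congr _ _ (Filter.Eventually.of_forall fun g => inner_add_left _ _ _)

lemma coeffLp_add_right (hπ : IsIrreducibleProjRep π) (hD : IsDufloMoore μ π D C) (x : H)
    (y y' : C.domain) : coeffLp hπ hD x (y + y') = coeffLp hπ hD x y + coeffLp hπ hD x y' := by
  unfold coeffLp
  rw [← MemLp.toLp_add]
  refine MemLp.toLp_congr _ _ (Filter.Eventually.of_forall fun g => ?_)
  simp only [Submodule.coe_add, map_add, inner_add_right, Pi.add_apply]

lemma coeffLp_smul_left (hπ : IsIrreducibleProjRep π) (hD : IsDufloMoore μ π D C) (c : ℂ) (x : H)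
    (y : C.domain) : coeffLp hπ hD (c • x) y = starRingEnd ℂ c • coeffLp hπ hD x y := by
  unfold coeffLp
  rw [← MemLp.toLp_const_smul]
  exact MemLp.toLp_congr _ _ (Filter.Eventually.of_forall fun g => inner_smul_left _ _ _)

lemma coeffLp_smul_right (hπ : IsIrreducibleProjRep π) (hD : IsDufloMoore μ π D C) (c : ℂ) (x : H)
    (y : C.domain) : coeffLp hπ hD x (c • y) = c • coeffLp hπ hD x y := by
  unfold coeffLp
  rw [← MemLp.toLp_const_smul]
  refine MemLp.toLp_congr _ _ (Filter.Eventually.of_forall fun g => ?_)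
  simp only [Submodule.coe_smul, map_smul, inner_smul_right, Pi.smul_apply, smul_eq_mul]

lemma norm_sq_coeffLp (hπ : IsIrreducibleProjRep π) (hD : IsDufloMoore μ π D C) (x : H)
    (y : C.domain) : ‖coeffLp hπ hD x y‖ ^ 2 = ‖x‖ ^ 2 * ‖C y‖ ^ 2 := by
  have h1 : ‖coeffLp hπ hD x y‖ₑ ^ 2 = ‖x‖ₑ ^ 2 * ‖C y‖ₑ ^ 2 := by
    rw [← formNormSq_of_mem y.2, ← hD.lintegral_coeff]
    exact enorm_sq_toLp (memLp_coeff hπ hD x y)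
  have h2 := congrArg ENNReal.toReal h1
  simpa only [ENNReal.toReal_mul, ENNReal.toReal_pow, toReal_enorm] using h2

/-- The orthogonality relations. -/
lemma inner_coeffLp (hπ : IsIrreducibleProjRep π) (hD : IsDufloMoore μ π D C) (x x' : H)
    (y y' : C.domain) :
    inner ℂ (coeffLp hπ hD x y) (coeffLp hπ hD x' y') = inner ℂ x' x * inner ℂ (C y) (C y') := by
  have h1 : ∀ x y y', inner ℂ (coeffLp hπ hD x y) (coeffLp hπ hD x y') =
      inner ℂ x x * inner ℂ (C y) (C y') := by
    intro x y y'
    rw [← sub_eq_zero]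
    refine sesquilin_eq_zero (B := fun y y' =>
      inner ℂ (coeffLp hπ hD x y) (coeffLp hπ hD x y') - inner ℂ x x * inner ℂ (C y) (C y'))
      Complex.I_ne_zero ?_ ?_ ?_ ?_ ?_ y y'
    · intro a b c; simp only [coeffLp_add_right, LinearPMap.map_add, inner_add_left]; ring
    · intro a b c; simp only [coeffLp_add_right, LinearPMap.map_add, inner_add_right]; ring
    · intro a b
      simp only [coeffLp_smul_right, LinearPMap.map_smul, inner_smul_left, Complex.conj_I]; ring
    · intro a b; simp only [coeffLp_smul_right, LinearPMap.map_smul, inner_smul_right]; ring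
    · intro a
      simp only [inner_self_eq_norm_sq_to_K, ← RCLike.ofReal_pow, norm_sq_coeffLp]
      push_cast
      ring
  rw [← sub_eq_zero]
  -- Coefficients are conjugate linear in the first vector, so the polarization factor is `-I` here.
  refine sesquilin_eq_zero (B := fun x x' =>
    inner ℂ (coeffLp hπ hD x y) (coeffLp hπ hD x' y') - inner ℂ x' x * inner ℂ (C y) (C y'))
    (neg_ne_zero.2 Complex.I_ne_zero) ?_ ?_ ?_ ?_ ?_ x x'
  · intro a b c; simp only [coeffLp_add_left, inner_add_left, inner_add_right]; ring
  · intro a b c; simp only [coeffLp_add_left, inner_add_left, inner_add_right]; ring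
  · intro a b
    simp only [coeffLp_smul_left, inner_smul_left, inner_smul_right, Complex.conj_conj]; ring
  · intro a b
    simp only [coeffLp_smul_left, inner_smul_left, inner_smul_right, Complex.conj_I]; ring
  · intro a
    simp only [h1, sub_self]

lemma orthonormal_coeffLp (hπ : IsIrreducibleProjRep π) (hD : IsDufloMoore μ π D C)
    {ι ι' : Type*} {e : ι → H} (he : Orthonormal ℂ e) {y : ι' → C.domain}
    (hy : Orthonormal ℂ fun j => C (y j)) :
    Orthonormal ℂ fun p : ι × ι' => coeffLp hπ hD (e p.1) (y p.2) := by
  classical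
  rw [orthonormal_iff_ite]
  rintro ⟨i, j⟩ ⟨i', j'⟩
  rw [inner_coeffLp, orthonormal_iff_ite.1 he, orthonormal_iff_ite.1 hy]
  by_cases h1 : i = i' <;> by_cases h2 : j = j' <;> simp [h1, h2, eq_comm]

end Coefficients

/-! ### The kernel that pairs functions on Q with coefficients -/

section Rep

variable {Q V G : Type*} [Group Q] [TopologicalSpace Q] [IsTopologicalGroup Q]
  [LocallyCompactSpace Q] [T2Space Q]
  [SecondCountableTopology Q] [MeasurableSpace Q] [BorelSpace Q]
  [CommGroup V] [TopologicalSpace V] [IsTopologicalGroup V]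
  [LocallyCompactSpace V] [T2Space V] [SecondCountableTopology V]
  [MeasurableSpace V] [BorelSpace V] [MulDistribMulAction Q V] [ContinuousSMul Q V]
  [MeasurableSpace (PontryaginDual V)] [BorelSpace (PontryaginDual V)]
  [Group G] [TopologicalSpace G] [IsTopologicalGroup G] [LocallyCompactSpace G] [T2Space G]
  [SecondCountableTopology G] [MeasurableSpace G] [BorelSpace G]
  {S : GroupExtension V G Q} {σ : S.Section} {β : Q → Q → V}
  {μQ : Measure Q} [μQ.IsHaarMeasure]
  {η : Q → PontryaginDual V} {b : Q → Q → Circle}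

/-- The measure on `Q` whose product with the Haar measure of `V` is a Haar measure of the
extension. -/
abbrev extensionBase (V : Type*) [CommGroup V] [TopologicalSpace V] [IsTopologicalGroup V]
    [LocallyCompactSpace V] [MeasurableSpace V] [BorelSpace V] [MulDistribMulAction Q V]
    [ContinuousSMul Q V] (μQ : Measure Q) : Measure Q :=
  μQ.withDensity fun q => (modulus V q : ℝ≥0∞)⁻¹

lemma extensionBase_eq : extensionBase V μQ =
    μQ.withDensity fun q => (((modulus V q)⁻¹ : ℝ≥0) : ℝ≥0∞) := by
  simp only [extensionBase, ← ENNReal.coe_inv (modulus_ne_zero _)]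

instance sigmaFinite_extensionBase : SigmaFinite (extensionBase V μQ) := by
  rw [extensionBase_eq]
  exact SigmaFinite.withDensity _

lemma lintegral_extensionBase {F : Q → ℝ≥0∞} (hF : Measurable F) :
    ∫⁻ q, F q ∂(extensionBase V μQ) = ∫⁻ q, (modulus V q : ℝ≥0∞)⁻¹ * F q ∂μQ :=
  lintegral_withDensity_eq_lintegral_mul _ measurable_modulus.coe_nnreal_ennreal.inv hF

lemma integral_extensionBase (F : Q → ℂ) :
    ∫ q, F q ∂(extensionBase V μQ) = ∫ q, (modulus V q)⁻¹ • F q ∂μQ := by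
  rw [extensionBase_eq, integral_withDensity_eq_integral_smul
    (f := fun q : Q => (modulus V q)⁻¹) measurable_modulus.inv]

lemma IsInvDensity.integral_inv_mul {d : Q → ℝ≥0} (hd : IsInvDensity μQ d)
    (F : Q → ℂ) (q₀ : Q) :
    ∫ q, F (q⁻¹ * q₀) ∂μQ = ∫ q, d q • F q ∂μQ := by
  have h1 : μQ.map (MeasurableEquiv.inv Q) = μQ.withDensity fun q => (d q : ℝ≥0∞) := by
    refine Measure.ext_of_lintegral _ fun f hf => ?_
    rw [lintegral_map_equiv, lintegral_withDensity_eq_lintegral_mul _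
      hd.measurable.coe_nnreal_ennreal hf]
    exact hd.lintegral_inv f hf
  rw [← integral_withDensity_eq_integral_smul hd.measurable, ← h1, integral_map_equiv,
    ← integral_mul_left_eq_self _ q₀]
  refine integral_congr_ae (Filter.Eventually.of_forall fun q => ?_)
  simp only [mul_inv_rev, inv_mul_cancel_right]
  rfl

/-- The kernel which computes the pairing of `θ` with the matrix coefficients of `π`. -/
def coeffKernel (V : Type*) [CommGroup V] [TopologicalSpace V] [IsTopologicalGroup V]
    [LocallyCompactSpace V] [MeasurableSpace V] [BorelSpace V] [MulDistribMulAction Q V]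
    [ContinuousSMul Q V] (κ c : ℝ≥0∞) (d : Q → ℝ≥0) (b : Q → Q → Circle) (θ : Q → ℂ)
    (q₀ p : Q) : ℂ :=
  ((d p * (modulus V (q₀ * p⁻¹))⁻¹ : ℝ≥0) : ℝ) * ((dufloMooreRoot V κ c d p)⁻¹ : ℝ) *
    (θ (q₀ * p⁻¹) * starRingEnd ℂ (b q₀⁻¹ (q₀ * p⁻¹) : ℂ))

lemma measurable_coeffKernel (hb : Measurable fun p : Q × Q => (b p.1 p.2 : ℂ)) (κ c : ℝ≥0∞)
    {d : Q → ℝ≥0} (hd : Measurable d) {θ : Q → ℂ} (hθ : Measurable θ) :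
    Measurable (Function.uncurry (coeffKernel V κ c d b θ)) := by
  have h1 : Measurable fun p : Q × Q => p.1 * p.2⁻¹ := measurable_fst.mul measurable_snd.inv
  refine Measurable.mul (Measurable.mul ?_ ?_) ((hθ.comp h1).mul
    (Complex.continuous_conj.measurable.comp (hb.comp (measurable_fst.inv.prodMk h1))))
  · exact Complex.measurable_ofReal.comp
      ((hd.comp measurable_snd).mul (measurable_modulus.comp h1).inv).coe_nnreal_real
  · exact Complex.measurable_ofReal.comp ((measurable_dufloMooreRoot κ c hd).inv.comp measurable_snd)

/-- The inverse root cancels one factor `d p` and contributes the inverse modulus of `p`. Under `p =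
q⁻¹ * q₀` the moduli split into the weight of `extensionBase` in `q` and the inverse modulus of
`q₀`, which is the weight in the Plancherel formula along `η`. -/
lemma lintegral_enorm_coeffKernel_sq {κ c : ℝ≥0∞} (hκ0 : κ ≠ 0) (hκt : κ ≠ ∞) (hc0 : c ≠ 0)
    (hct : c ≠ ∞) {d : Q → ℝ≥0} (hd : IsInvDensity μQ d) {θ : Q → ℂ} (hθ : Measurable θ) (q₀ : Q) :
    ∫⁻ p, ‖coeffKernel V κ c d b θ q₀ p‖ₑ ^ 2 ∂μQ =
      κ⁻¹ * c * (modulus V q₀ : ℝ≥0∞)⁻¹ * ∫⁻ q, ‖θ q‖ₑ ^ 2 ∂(extensionBase V μQ) := by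
  have hδ : Measurable fun q : Q => (modulus V q : ℝ≥0∞) := measurable_modulus.coe_nnreal_ennreal
  have hδ0 : ∀ q : Q, (modulus V q : ℝ≥0∞) ≠ 0 := fun q => by exact_mod_cast modulus_ne_zero q
  have h0 : κ⁻¹ * c ≠ ∞ := ENNReal.mul_ne_top (ENNReal.inv_ne_top.2 hκ0) hct
  set Ψ : Q → ℝ≥0∞ := fun p => (modulus V p : ℝ≥0∞)⁻¹ * ((modulus V (q₀ * p⁻¹) : ℝ≥0∞)⁻¹ ^ 2 *
    ‖θ (q₀ * p⁻¹)‖ₑ ^ 2)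
  have hΨ : Measurable Ψ := by
    have h1 : Measurable fun p => q₀ * p⁻¹ := measurable_inv.const_mul q₀
    exact hδ.inv.mul (((hδ.comp h1).inv.pow_const 2).mul ((hθ.comp h1).enorm.pow_const 2))
  have h1 : ∀ p, ‖coeffKernel V κ c d b θ q₀ p‖ₑ ^ 2 = κ⁻¹ * c * (d p * Ψ p) := by
    intro p
    have hr : ‖(((dufloMooreRoot V κ c d p)⁻¹ : ℝ) : ℂ)‖ₑ ^ 2 =
        (κ * c⁻¹ * (modulus V p * d p))⁻¹ := by
      rw [← enorm_dufloMooreRoot_sq hκt hc0 d p, ENNReal.inv_pow,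
        ← enorm_inv (dufloMooreRoot_pos hκ0 hκt hc0 hct hd.ne_zero p).ne']
      congr 1
      rw [← ofReal_norm, ← ofReal_norm, Complex.norm_real]
    have hn : ∀ a : ℝ≥0, ‖((a : ℝ) : ℂ)‖ₑ = a := by
      intro a
      rw [← ofReal_norm, Complex.norm_real,
        Real.norm_of_nonneg a.coe_nonneg, ENNReal.ofReal_coe_nnreal]
    have hb1 : ‖starRingEnd ℂ (b q₀⁻¹ (q₀ * p⁻¹) : ℂ)‖ₑ = 1 := by
      rw [RCLike.enorm_conj, ← ofReal_norm, Circle.norm_coe, ENNReal.ofReal_one]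
    have hd0 : (d p : ℝ≥0∞) ≠ 0 := by exact_mod_cast hd.ne_zero p
    rw [coeffKernel, enorm_mul, enorm_mul, enorm_mul, hb1, mul_one, mul_pow, mul_pow, hr, hn,
      ENNReal.coe_mul, ENNReal.coe_inv (modulus_ne_zero _),
      ENNReal.mul_inv (Or.inr (ENNReal.mul_ne_top (by simp) (by simp)))
        (Or.inr (mul_ne_zero (hδ0 p) hd0)), ENNReal.mul_inv (Or.inl hκ0) (Or.inl hκt), inv_inv,
      ENNReal.mul_inv (Or.inl (hδ0 p)) (Or.inl (by simp))]
    calc _ = κ⁻¹ * c * (d p * (d p * (d p : ℝ≥0∞)⁻¹) * Ψ p) := by simp only [Ψ]; ring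
      _ = _ := by rw [ENNReal.mul_inv_cancel hd0 (by simp), mul_one]
  simp only [h1]
  rw [lintegral_const_mul' _ _ h0, ← hd.lintegral_inv_mul hΨ q₀, mul_assoc (κ⁻¹ * c)]
  congr 1
  rw [lintegral_extensionBase (hθ.enorm.pow_const 2),
    ← lintegral_const_mul' _ _ (ENNReal.inv_ne_top.2 (hδ0 _))]
  refine lintegral_congr fun q => ?_
  simp only [Ψ]
  rw [mul_inv_rev, inv_inv, mul_inv_cancel_left, modulus_mul, modulus_inv, ENNReal.coe_mul,
    ENNReal.coe_inv (modulus_ne_zero q),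
    ENNReal.mul_inv (Or.inr (by simp)) (Or.inr (hδ0 _)), inv_inv]
  calc _ = (modulus V q * (modulus V q : ℝ≥0∞)⁻¹) * ((modulus V q₀ : ℝ≥0∞)⁻¹ *
        ((modulus V q : ℝ≥0∞)⁻¹ * ‖θ q‖ₑ ^ 2)) := by ring
    _ = _ := by rw [ENNReal.mul_inv_cancel (hδ0 q) (by simp), one_mul]

lemma memLp_coeffKernel (hb : Measurable fun p : Q × Q => (b p.1 p.2 : ℂ))
    {κ c : ℝ≥0∞} (hκ0 : κ ≠ 0) (hκt : κ ≠ ∞) (hc0 : c ≠ 0)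
    (hct : c ≠ ∞) {d : Q → ℝ≥0} (hd : IsInvDensity μQ d) {θ : Q → ℂ}
    (hθ : IsBddIntegrable (extensionBase V μQ) θ) (q₀ : Q) :
    MemLp (coeffKernel V κ c d b θ q₀) 2 μQ := by
  have h1 : Measurable (coeffKernel V κ c d b θ q₀) :=
    Measurable.of_uncurry_left (f := coeffKernel V κ c d b θ)
      (measurable_coeffKernel hb κ c hd.measurable hθ.measurable)
  rw [← lintegral_enorm_sq_lt_top_iff h1.aestronglyMeasurable,
    lintegral_enorm_coeffKernel_sq hκ0 hκt hc0 hct hd hθ.1]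
  refine ENNReal.mul_lt_top (ENNReal.mul_lt_top (ENNReal.mul_lt_top ?_ hct.lt_top) ?_)
    ((lintegral_enorm_sq_lt_top_iff hθ.memLp.1).2 hθ.memLp)
  · exact ENNReal.inv_lt_top.2 (pos_iff_ne_zero.2 hκ0)
  · exact ENNReal.inv_lt_top.2 (pos_iff_ne_zero.2 (by exact_mod_cast modulus_ne_zero q₀))

/-- Substitute `p = q⁻¹ * q₀`. Writing `y` as the inverse Duflo–Moore root times `f` turns the
pairing into one between the kernel and the `f` that will run through a basis. -/
lemma integral_conj_mul_translate {κ c : ℝ≥0∞} {d : Q → ℝ≥0} (hd : IsInvDensity μQ d)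
    (θ : Q → ℂ) {y f : Q → ℂ}
    (hy : y =ᵐ[μQ] fun p => ((dufloMooreRoot V κ c d p)⁻¹ : ℝ) * f p) (q₀ : Q) :
    ∫ q, starRingEnd ℂ (θ q) * (b q₀⁻¹ q * y (q⁻¹ * q₀)) ∂(extensionBase V μQ) =
      ∫ p, f p * starRingEnd ℂ (coeffKernel V κ c d b θ q₀ p) ∂μQ := by
  have h1 := hd.integral_inv_mul (fun p => (modulus V (q₀ * p⁻¹))⁻¹ •
    (starRingEnd ℂ (θ (q₀ * p⁻¹)) * (b q₀⁻¹ (q₀ * p⁻¹) * y p))) q₀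
  simp only [mul_inv_rev, inv_inv, mul_inv_cancel_left] at h1
  rw [integral_extensionBase, h1]
  refine integral_congr_ae ?_
  filter_upwards [hy] with p hp
  rw [hp, coeffKernel]
  simp only [map_mul, Complex.conj_conj, Complex.conj_ofReal, NNReal.smul_def,
    Complex.real_smul, NNReal.coe_mul, NNReal.coe_inv]
  push_cast
  ring

end Rep

/-! ### Totality of the matrix coefficients in L²(G) -/

section Rep

variable {Q V G : Type*} [Group Q] [TopologicalSpace Q] [IsTopologicalGroup Q]
  [LocallyCompactSpace Q] [T2Space Q]
  [SecondCountableTopology Q] [MeasurableSpace Q] [BorelSpace Q]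
  [CommGroup V] [TopologicalSpace V] [IsTopologicalGroup V]
  [LocallyCompactSpace V] [T2Space V] [SecondCountableTopology V]
  [MeasurableSpace V] [BorelSpace V] [MulDistribMulAction Q V] [ContinuousSMul Q V]
  [MeasurableSpace (PontryaginDual V)] [BorelSpace (PontryaginDual V)]
  [Group G] [TopologicalSpace G] [IsTopologicalGroup G] [LocallyCompactSpace G] [T2Space G]
  [SecondCountableTopology G] [MeasurableSpace G] [BorelSpace G]
  {S : GroupExtension V G Q} {σ : S.Section} {β : Q → Q → V}
  {μQ : Measure Q} [μQ.IsHaarMeasure]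
  {η : Q → PontryaginDual V} {b : Q → Q → Circle}

lemma secondCountableTopology_Lp {X : Type*} [TopologicalSpace X] [SecondCountableTopology X]
    [MeasurableSpace X] [BorelSpace X] (μ : Measure X) [SigmaFinite μ] :
    SecondCountableTopology (Lp ℂ 2 μ) := by
  have : Fact ((2 : ℝ≥0∞) ≠ ∞) := ⟨ENNReal.ofNat_ne_top⟩
  infer_instance

/-- The adjoint formula for `cofourier` moves the integral over `v` onto `h`; then the integrals
over `q` and `q₀` are exchanged. -/
lemma integral_cofourier_coeffIntegrand_mul_conj {μV : Measure V} [μV.IsHaarMeasure]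
    (hη : IsOneCocycle η) (hb : Measurable fun p : Q × Q => (b p.1 p.2 : ℂ)) (x y : Lp ℂ 2 μQ)
    {θ : Q → ℂ} {h : V → ℂ} (hθ : IsBddIntegrable (extensionBase V μQ) θ)
    (hh : IsBddIntegrable μV h)
    (hint : Integrable (fun p : Q × V => cofourier μQ η (coeffIntegrand b x y p.1) p.2 *
      starRingEnd ℂ (θ p.1 * h p.2)) ((extensionBase V μQ).prod μV)) :
    ∫ p : Q × V, cofourier μQ η (coeffIntegrand b x y p.1) p.2 * starRingEnd ℂ (θ p.1 * h p.2)
        ∂((extensionBase V μQ).prod μV) =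
      ∫ q₀, starRingEnd ℂ (x q₀) * (starRingEnd ℂ (fourier μV h (η q₀)) *
        ∫ q, starRingEnd ℂ (θ q) * (b q₀⁻¹ q * y (q⁻¹ * q₀)) ∂(extensionBase V μQ)) ∂μQ := by
  have hxm := (Lp.stronglyMeasurable x).measurable
  have hym := (Lp.stronglyMeasurable y).measurable
  have hFm : Continuous fun q₀ => starRingEnd ℂ (fourier μV h (η q₀)) :=
    Complex.continuous_conj.comp ((continuous_fourier hh.integrable).comp hη.continuous)
  have hFb : ∀ q₀, ‖starRingEnd ℂ (fourier μV h (η q₀))‖ ≤ ∫ v, ‖h v‖ ∂μV := fun q₀ => by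
    rw [RCLike.norm_conj]; exact norm_fourier_le _ _ _
  rw [integral_prod _ hint]
  have h1 : ∀ q, ∫ v, cofourier μQ η (coeffIntegrand b x y q) v * starRingEnd ℂ (θ q * h v) ∂μV =
      ∫ q₀, starRingEnd ℂ (θ q) * (coeffIntegrand b x y q q₀ *
        starRingEnd ℂ (fourier μV h (η q₀))) ∂μQ := by
    intro q
    rw [integral_const_mul, ← integral_cofourier_mul_conj hη (integrable_coeffIntegrand hb x y q)
      hh.integrable, ← integral_const_mul]
    refine integral_congr_ae (Filter.Eventually.of_forall fun v => ?_)
    simp only [map_mul]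
    ring
  simp only [h1]
  rw [integral_integral_swap]
  · refine integral_congr_ae (Filter.Eventually.of_forall fun q₀ => ?_)
    simp only
    rw [← integral_const_mul, ← integral_const_mul]
    refine integral_congr_ae (Filter.Eventually.of_forall fun q => ?_)
    simp only [coeffIntegrand]
    ring
  · have hm : Measurable fun p : Q × Q => starRingEnd ℂ (θ p.1) * (coeffIntegrand b x y p.1 p.2 *
        starRingEnd ℂ (fourier μV h (η p.2))) :=
      (Complex.continuous_conj.measurable.comp (hθ.1.comp measurable_fst)).mul
        ((measurable_coeffIntegrand hb hxm hym).mul (hFm.measurable.comp measurable_snd))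
    refine ⟨hm.aestronglyMeasurable, ?_⟩
    simp only [hasFiniteIntegral_iff_enorm, Function.uncurry]
    rw [lintegral_prod _ hm.enorm.aemeasurable]
    set M : ℝ≥0∞ := ENNReal.ofReal (∫ v, ‖h v‖ ∂μV)
    -- Cauchy–Schwarz and left invariance bound the inner integral by `‖x‖ ‖y‖` uniformly in `q`,
    -- with `M` bounding the transform of `h`; only the integrable `θ` remains.
    refine lt_of_le_of_lt (lintegral_mono (g := fun q => ‖θ q‖ₑ * (‖x‖ₑ * ‖y‖ₑ * M)) fun q => ?_) ?_
    · have h2 : ∀ q₀, ‖starRingEnd ℂ (θ q) * (coeffIntegrand b x y q q₀ *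
          starRingEnd ℂ (fourier μV h (η q₀)))‖ₑ ≤
            ‖θ q‖ₑ * M * (‖x q₀‖ₑ * ‖y (q⁻¹ * q₀)‖ₑ) := by
        intro q₀
        rw [enorm_mul, enorm_mul, RCLike.enorm_conj, enorm_coeffIntegrand]
        have h3 : ‖starRingEnd ℂ (fourier μV h (η q₀))‖ₑ ≤ M := by
          rw [← ofReal_norm]; exact ENNReal.ofReal_le_ofReal (hFb q₀)
        calc _ ≤ ‖θ q‖ₑ * (‖x q₀‖ₑ * ‖y (q⁻¹ * q₀)‖ₑ * M) := by gcongr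
          _ = _ := by ring
      refine (lintegral_mono h2).trans ?_
      rw [lintegral_const_mul' _ _ (ENNReal.mul_ne_top enorm_ne_top ENNReal.ofReal_ne_top)]
      have h3 : ∫⁻ q₀, ‖x q₀‖ₑ * ‖y (q⁻¹ * q₀)‖ₑ ∂μQ ≤ ‖x‖ₑ * ‖y‖ₑ := by
        rw [← ENNReal.pow_le_pow_left_iff two_ne_zero, mul_pow, enorm_sq_Lp, enorm_sq_Lp,
          ← lintegral_mul_left_eq_self (fun q₀ => ‖y q₀‖ₑ ^ 2) q⁻¹]
        exact lintegral_enorm_mul_sq_le hxm.enorm.aemeasurable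
          (hym.comp (measurable_const_mul q⁻¹)).enorm.aemeasurable
      calc _ ≤ ‖θ q‖ₑ * M * (‖x‖ₑ * ‖y‖ₑ) := by gcongr
        _ = _ := by ring
    · rw [lintegral_mul_const _ hθ.1.enorm]
      exact ENNReal.mul_lt_top hθ.integrable.2
        (ENNReal.mul_lt_top (ENNReal.mul_lt_top enorm_lt_top enorm_lt_top) ENNReal.ofReal_lt_top)

lemma tsum_enorm_integral_mul_conj {ι X : Type*} [MeasurableSpace X] {μ : Measure X}
    (f : HilbertBasis ι ℂ (Lp ℂ 2 μ)) {s : X → ℂ} (hs : MemLp s 2 μ) :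
    ∑' j, ‖∫ p, f j p * starRingEnd ℂ (s p) ∂μ‖ₑ ^ 2 = ∫⁻ p, ‖s p‖ₑ ^ 2 ∂μ := by
  rw [← enorm_sq_toLp hs, ← tsum_enorm_inner_sq' f]
  refine tsum_congr fun j => ?_
  rw [L2.inner_def]
  congr 2
  refine integral_congr_ae ?_
  filter_upwards [hs.coeFn_toLp] with p hp
  rw [hp, RCLike.inner_apply]

/-- Parseval's identity for the pairings of a product function with the coefficients of `π`. -/
lemma tsum_enorm_integral_coeff {μV : Measure V} [μV.IsHaarMeasure]
    (hη : IsOneCocycle η) (hb : Measurable fun p : Q × Q => (b p.1 p.2 : ℂ))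
    {κ c : ℝ≥0∞} (hκ0 : κ ≠ 0) (hκt : κ ≠ ∞) (hc : IsPlancherelConst μQ μV η c)
    {d : Q → ℝ≥0} (hd : IsInvDensity μQ d) {θ : Q → ℂ} {h : V → ℂ}
    (hθ : IsBddIntegrable (extensionBase V μQ) θ) (hh : IsBddIntegrable μV h)
    {ι ι' : Type*} [Countable ι'] (e : HilbertBasis ι ℂ (Lp ℂ 2 μQ))
    (f : HilbertBasis ι' ℂ (Lp ℂ 2 μQ)) :
    ∑' j, ∑' i, ‖∫ q₀, starRingEnd ℂ (e i q₀) * (starRingEnd ℂ (fourier μV h (η q₀)) *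
        ∫ p, f j p * starRingEnd ℂ (coeffKernel V κ c d b θ q₀ p) ∂μQ) ∂μQ‖ₑ ^ 2 =
      κ⁻¹ * ((∫⁻ q, ‖θ q‖ₑ ^ 2 ∂(extensionBase V μQ)) * ∫⁻ v, ‖h v‖ₑ ^ 2 ∂μV) := by
  obtain ⟨hc0, hct, hc⟩ := hc
  have hF : Measurable fun q₀ => starRingEnd ℂ (fourier μV h (η q₀)) :=
    (Complex.continuous_conj.comp
      ((continuous_fourier hh.integrable).comp hη.continuous)).measurable
  -- Parseval is used twice: for fixed `j` the sum over `i` is the square norm of `A j`, and for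
  -- fixed `q₀` the sum over `j` is the square norm of the kernel.
  set A : ι' → Q → ℂ := fun j q₀ => starRingEnd ℂ (fourier μV h (η q₀)) *
    ∫ p, f j p * starRingEnd ℂ (coeffKernel V κ c d b θ q₀ p) ∂μQ
  have hA : ∀ j, Measurable (A j) := by
    intro j
    have h1 : Measurable fun p : Q × Q =>
        f j p.2 * starRingEnd ℂ (coeffKernel V κ c d b θ p.1 p.2) :=
      ((Lp.stronglyMeasurable (f j)).measurable.comp measurable_snd).mul
        (Complex.continuous_conj.measurable.comp
          (measurable_coeffKernel hb κ c hd.measurable hθ.1))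
    exact hF.mul (StronglyMeasurable.integral_prod_right' (ν := μQ)
      h1.stronglyMeasurable).measurable
  have hsum : ∑' j, ∫⁻ q₀, ‖A j q₀‖ₑ ^ 2 ∂μQ =
      κ⁻¹ * ((∫⁻ q, ‖θ q‖ₑ ^ 2 ∂(extensionBase V μQ)) * ∫⁻ v, ‖h v‖ₑ ^ 2 ∂μV) := by
    rw [← lintegral_tsum fun j => ((hA j).enorm.pow_const 2).aemeasurable]
    simp only [A, enorm_mul, mul_pow, ENNReal.tsum_mul_left,
      tsum_enorm_integral_mul_conj f (memLp_coeffKernel hb hκ0 hκt hc0 hct hd hθ _),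
      lintegral_enorm_coeffKernel_sq hκ0 hκt hc0 hct hd hθ.1, RCLike.enorm_conj]
    rw [← hc h hh]
    have hN : κ⁻¹ * (∫⁻ q, ‖θ q‖ₑ ^ 2 ∂(extensionBase V μQ)) * c ≠ ∞ :=
      ENNReal.mul_ne_top (ENNReal.mul_ne_top (ENNReal.inv_ne_top.2 hκ0)
        ((lintegral_enorm_sq_lt_top_iff hθ.memLp.1).2 hθ.memLp).ne) hct
    rw [← mul_assoc, ← mul_assoc, ← lintegral_const_mul' _ _ hN]
    refine lintegral_congr fun q₀ => ?_
    ring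
  rw [← hsum]
  refine tsum_congr fun j => ?_
  -- Square integrability of each `A j` comes from finiteness of the sum of all their square norms.
  have hAL : MemLp (A j) 2 μQ := by
    rw [← lintegral_enorm_sq_lt_top_iff (hA j).aestronglyMeasurable]
    refine lt_of_le_of_lt (ENNReal.le_tsum (f := fun j => ∫⁻ q₀, ‖A j q₀‖ₑ ^ 2 ∂μQ) j) ?_
    rw [hsum]
    exact ENNReal.mul_lt_top (ENNReal.inv_lt_top.2 (pos_iff_ne_zero.2 hκ0))
      (ENNReal.mul_lt_top ((lintegral_enorm_sq_lt_top_iff hθ.memLp.1).2 hθ.memLp)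
        ((lintegral_enorm_sq_lt_top_iff hh.memLp.1).2 hh.memLp))
  rw [← tsum_enorm_integral_mul_conj e hAL]
  refine tsum_congr fun i => ?_
  rw [← RCLike.enorm_conj, ← integral_conj]
  congr 2
  refine integral_congr_ae (Filter.Eventually.of_forall fun q₀ => ?_)
  simp only [map_mul, Complex.conj_conj, A]

section Extension

variable {μV : Measure V} [μV.IsHaarMeasure] {μG : Measure G} {κ : ℝ≥0∞}

lemma integrable_comp_extensionEquiv (hS : IsTopExtension S) (hσ : Measurable σ) (hκ0 : κ ≠ 0)
    (hκt : κ ≠ ∞)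
    (hμG : μG = κ • ((extensionBase V μQ).prod μV).map (extensionEquiv hS hσ)) {F : G → ℂ}
    (hF : Integrable F μG) :
    Integrable (fun p => F (extensionEquiv hS hσ p)) ((extensionBase V μQ).prod μV) := by
  rw [hμG, integrable_smul_measure hκ0 hκt, integrable_map_equiv] at hF
  exact hF

lemma integral_extension (hS : IsTopExtension S) (hσ : Measurable σ)
    (hμG : μG = κ • ((extensionBase V μQ).prod μV).map (extensionEquiv hS hσ)) (F : G → ℂ) :
    ∫ g, F g ∂μG = κ.toReal • ∫ p, F (extensionEquiv hS hσ p) ∂((extensionBase V μQ).prod μV) := by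
  rw [hμG, integral_smul_measure, integral_map_equiv]

lemma lintegral_extension (hS : IsTopExtension S) (hσ : Measurable σ)
    (hμG : μG = κ • ((extensionBase V μQ).prod μV).map (extensionEquiv hS hσ)) (F : G → ℝ≥0∞) :
    ∫⁻ g, F g ∂μG = κ * ∫⁻ p, F (extensionEquiv hS hσ p) ∂((extensionBase V μQ).prod μV) := by
  rw [hμG, lintegral_smul_measure, lintegral_map_equiv, smul_eq_mul]

lemma rightHom_extensionEquiv (hS : IsTopExtension S) (hσ : Measurable σ) (p : Q × V) :
    S.rightHom (extensionEquiv hS hσ p) = p.1 := by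
  change S.rightHom (S.inl p.2 * σ p.1) = _
  rw [rightHom_inl_mul, GroupExtension.Section.rightHom_section]

lemma vPart_extensionEquiv (hS : IsTopExtension S) (hσ : Measurable σ) (p : Q × V) :
    vPart S σ (extensionEquiv hS hσ p) = p.2 := by
  change vPart S σ (S.inl p.2 * σ p.1) = _
  rw [vPart_inl_mul]

/-- The matrix coefficients of `π` are total in `L²(G)`. -/
theorem ae_eq_zero_of_forall_integral_coeff (hS : IsTopExtension S) (hσ : Measurable σ)
    (hη : IsOneCocycle η) (hb : Measurable fun p : Q × Q => (b p.1 p.2 : ℂ)) {c : ℝ≥0∞}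
    (hκ0 : κ ≠ 0) (hκt : κ ≠ ∞) (hc : IsPlancherelConst μQ μV η c)
    {d : Q → ℝ≥0} (hd : IsInvDensity μQ d)
    (hμG : μG = κ • ((extensionBase V μQ).prod μV).map (extensionEquiv hS hσ))
    (hπ : IsIrreducibleProjRep (piRep S σ μQ hη.continuous hb)) {D : Lp ℂ 2 μQ →ₗ.[ℂ] Lp ℂ 2 μQ}
    (hD : IsDufloMoore μG (piRep S σ μQ hη.continuous hb) D
      (mulOp μQ (dufloMooreRoot V κ c d))) {k : G → ℂ} (hk : MemLp k 2 μG)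
    (h0 : ∀ x y, y ∈ (mulOp μQ (dufloMooreRoot V κ c d)).domain →
      ∫ g, inner ℂ x (piRep S σ μQ hη.continuous hb g y) * k g ∂μG = 0) : k =ᵐ[μG] 0 := by
  have : SecondCountableTopology (Lp ℂ 2 μQ) := secondCountableTopology_Lp μQ
  have : SecondCountableTopology (Lp ℂ 2 μV) := secondCountableTopology_Lp μV
  set ρ := dufloMooreRoot V κ c d
  have hρm : Measurable ρ := measurable_dufloMooreRoot κ c hd.measurable
  have hρ0 : ∀ q, (ρ q : ℂ) ≠ 0 := fun q =>
    Complex.ofReal_ne_zero.2 (dufloMooreRoot_pos hκ0 hκt hc.1 hc.2.1 hd.ne_zero q).ne'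
  set π := piRep S σ μQ hη.continuous hb
  obtain ⟨s, e, hs, -⟩ := exists_hilbertBasis_mem (H := Lp ℂ 2 μQ) ⊤ dense_univ
  -- With `f` chosen in the domain of multiplication by `ρ⁻¹`, each `f j` is `ρ * y j` for `y j =
  -- ρ⁻¹ * f j`. The orthogonality relations then make the coefficients of `e i` and `y j`
  -- orthonormal.
  obtain ⟨s', f, hs', hf⟩ := exists_hilbertBasis_mem _
    (dense_domain_mulOp (μ := μQ) (r := fun q => (ρ q)⁻¹) hρm.inv)
  have : Countable s' := hs'
  have hy : ∀ j, ∃ y : (mulOp μQ ρ).domain, mulOp μQ ρ y = f j ∧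
      (y : Lp ℂ 2 μQ) =ᵐ[μQ] fun q => (((ρ q)⁻¹ : ℝ) : ℂ) * f j q := by
    intro j
    have h1 := mulOp_apply_ae (⟨f j, hf j⟩ : (mulOp μQ fun q => (ρ q)⁻¹).domain)
    have h2 : (mulOp μQ (fun q => (ρ q)⁻¹) ⟨f j, hf j⟩, f j) ∈ (mulOp μQ ρ).graph := by
      rw [mem_graph_mulOp]
      filter_upwards [h1] with q hq
      rw [hq, Complex.ofReal_inv, mul_inv_cancel_left₀ (hρ0 q)]
    obtain ⟨y, hy1, hy2⟩ := (LinearPMap.mem_graph_iff _).1 h2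
    exact ⟨y, hy2, by rw [hy1]; exact h1⟩
  choose y hy1 hy2 using hy
  have hw := orthonormal_coeffLp hπ hD e.orthonormal (y := y) (by simpa only [hy1] using f.orthonormal)
  -- Product functions satisfy Parseval's identity for these coefficients, hence are orthogonal to
  -- whatever the coefficients annihilate.
  have hkey : ∀ θ h, IsBddIntegrable (extensionBase V μQ) θ → IsBddIntegrable μV h →
      ∫ g, k g * (θ (S.rightHom g) * h (vPart S σ g)) ∂μG = 0 := by
    intro θ h hθ hh
    set F : G → ℂ := fun g => θ (S.rightHom g) * h (vPart S σ g)
    have hFe : ∀ p, F (extensionEquiv hS hσ p) = θ p.1 * h p.2 := fun p => by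
      simp only [F, rightHom_extensionEquiv, vPart_extensionEquiv]
    have hFm : Measurable F := (hθ.1.comp hS.continuous_rightHom.measurable).mul
      (hh.1.comp (measurable_vPart hS hσ))
    have hF2 : ∫⁻ g, ‖F g‖ₑ ^ 2 ∂μG =
        κ * ((∫⁻ q, ‖θ q‖ₑ ^ 2 ∂(extensionBase V μQ)) * ∫⁻ v, ‖h v‖ₑ ^ 2 ∂μV) := by
      rw [lintegral_extension hS hσ hμG, ← lintegral_prod_mul
        (hθ.1.enorm.pow_const 2).aemeasurable (hh.1.enorm.pow_const 2).aemeasurable]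
      simp only [hFe, enorm_mul, mul_pow]
    have hFL : MemLp F 2 μG := by
      rw [← lintegral_enorm_sq_lt_top_iff hFm.aestronglyMeasurable, hF2]
      exact ENNReal.mul_lt_top hκt.lt_top
        (ENNReal.mul_lt_top ((lintegral_enorm_sq_lt_top_iff hθ.memLp.1).2 hθ.memLp)
          ((lintegral_enorm_sq_lt_top_iff hh.memLp.1).2 hh.memLp))
    have hWF : ∀ i j, (inner ℂ (hFL.toLp F) (coeffLp hπ hD (e i) (y j)) : ℂ) =
        κ.toReal • ∫ q₀, starRingEnd ℂ (e i q₀) * (starRingEnd ℂ (fourier μV h (η q₀)) *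
          ∫ p, f j p * starRingEnd ℂ (coeffKernel V κ c d b θ q₀ p) ∂μQ) ∂μQ := by
      intro i j
      have h1 : (fun g => (inner ℂ (hFL.toLp F g) (coeffLp hπ hD (e i) (y j) g) : ℂ)) =ᵐ[μG]
          fun g => inner ℂ (e i) (π g (y j)) * starRingEnd ℂ (F g) := by
        filter_upwards [hFL.coeFn_toLp, coeffLp_ae hπ hD (e i) (y j)] with g h2 h3
        rw [h2, h3, RCLike.inner_apply]
      have h2 : ∀ p : Q × V, (inner ℂ (e i) (π (extensionEquiv hS hσ p) (y j)) : ℂ) *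
          starRingEnd ℂ (F (extensionEquiv hS hσ p)) =
            cofourier μQ η (coeffIntegrand b (e i) (y j : Lp ℂ 2 μQ) p.1) p.2 *
              starRingEnd ℂ (θ p.1 * h p.2) := by
        intro p
        rw [hFe]
        simp only [π, piRep]
        rw [inner_piOp, rightHom_extensionEquiv, vPart_extensionEquiv]
      have h3 := integrable_comp_extensionEquiv hS hσ hκ0 hκt hμG
        ((L2.integrable_inner (𝕜 := ℂ) (hFL.toLp F) (coeffLp hπ hD (e i) (y j))).congr h1)
      rw [L2.inner_def, integral_congr_ae h1, integral_extension hS hσ hμG]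
      simp only [h2] at h3 ⊢
      rw [integral_cofourier_coeffIntegrand_mul_conj hη hb _ _ hθ hh h3]
      simp only [integral_conj_mul_translate hd θ (hy2 j)]
    have hpars : ‖hFL.toLp F‖ₑ ^ 2 ≤
        ∑' p : s × s', ‖(inner ℂ (coeffLp hπ hD (e p.1) (y p.2)) (hFL.toLp F) : ℂ)‖ₑ ^ 2 := by
      have h1 : ∀ z : ℂ, ‖κ.toReal • z‖ₑ ^ 2 = κ ^ 2 * ‖z‖ₑ ^ 2 := fun z => by
        rw [enorm_smul, mul_pow, Real.enorm_of_nonneg ENNReal.toReal_nonneg,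
          ENNReal.ofReal_toReal hκt]
      simp only [enorm_inner_symm _ (hFL.toLp F), hWF, h1]
      -- Each pairing carries a factor `κ`, squared in the sum; the `κ⁻¹` coming from the
      -- Duflo–Moore root leaves the single `κ` in the square norm of `F`.
      rw [ENNReal.tsum_mul_left, ENNReal.tsum_prod', ENNReal.tsum_comm,
        tsum_enorm_integral_coeff hη hb hκ0 hκt hc hd hθ hh e f, enorm_sq_toLp, hF2, sq, mul_assoc,
        ← mul_assoc κ κ⁻¹, ENNReal.mul_inv_cancel hκ0 hκt, one_mul]
    -- The hypothesis pairs `k` bilinearly with the coefficients, so the vector orthogonal to them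
    -- is the conjugate of `k`.
    have hz := inner_eq_zero_of_parseval hw hpars (z := hk.star.toLp _) fun p => by
      rw [← inner_conj_symm, ← map_zero (starRingEnd ℂ), ← h0 (e p.1) (y p.2) (y p.2).2,
        L2.inner_def]
      congr 1
      refine integral_congr_ae ?_
      filter_upwards [hk.star.coeFn_toLp, coeffLp_ae hπ hD (e p.1) (y p.2)] with g h2 h3
      rw [h2, h3, RCLike.inner_apply, Pi.star_apply]
      exact congrArg _ (Complex.conj_conj _)
    rw [← hz, L2.inner_def]
    refine integral_congr_ae ?_
    filter_upwards [hk.star.coeFn_toLp, hFL.coeFn_toLp] with g h2 h3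
    rw [h2, h3, RCLike.inner_apply, Pi.star_apply, mul_comm]
    exact congrArg _ (Complex.conj_conj _).symm
  have hkL : MemLp (fun p => k (extensionEquiv hS hσ p)) 2 ((extensionBase V μQ).prod μV) := by
    have h1 : ((extensionBase V μQ).prod μV).map (extensionEquiv hS hσ) ≪ μG := by
      rw [hμG]; exact Measure.absolutelyContinuous_smul hκ0
    have h2 := (hk.1.mono_ac h1).comp_measurable (extensionEquiv hS hσ).measurable
    refine (lintegral_enorm_sq_lt_top_iff h2).1 ?_
    have h3 := (lintegral_enorm_sq_lt_top_iff hk.1).2 hk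
    rw [lintegral_extension hS hσ hμG] at h3
    exact ENNReal.lt_top_of_mul_ne_top_right h3.ne hκ0
  have hk0 := ae_eq_zero_of_forall_integral_prod hkL fun θ h hθ hh => by
    have h1 := hkey θ h hθ hh
    rw [integral_extension hS hσ hμG, smul_eq_zero] at h1
    have h2 := h1.resolve_left (ENNReal.toReal_ne_zero.2 ⟨hκ0, hκt⟩)
    simpa only [rightHom_extensionEquiv, vPart_extensionEquiv] using h2
  have h1 := (extensionEquiv hS hσ).symm.measurable
  rw [hμG]
  refine Measure.ae_smul_measure ?_ κ
  have h2 : ∀ᵐ g ∂(((extensionBase V μQ).prod μV).map (extensionEquiv hS hσ)), k g = 0 := by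
    rw [(extensionEquiv hS hσ).measurableEmbedding.ae_map_iff]
    exact hk0
  exact h2

end Extension

end Rep

end GaloisObj

end

end Library

theorem theorem2p2
    {Q V G : Type*}
    [Group Q] [TopologicalSpace Q] [IsTopologicalGroup Q] [LocallyCompactSpace Q] [T2Space Q]
    [SecondCountableTopology Q] [MeasurableSpace Q] [BorelSpace Q]
    [CommGroup V] [TopologicalSpace V] [IsTopologicalGroup V] [LocallyCompactSpace V] [T2Space V]
    [SecondCountableTopology V] [MeasurableSpace V] [BorelSpace V]
    [MulDistribMulAction Q V] [ContinuousSMul Q V]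
    [MeasurableSpace (PontryaginDual V)] [BorelSpace (PontryaginDual V)]
    [Group G] [TopologicalSpace G] [IsTopologicalGroup G] [LocallyCompactSpace G] [T2Space G]
    [SecondCountableTopology G] [MeasurableSpace G] [BorelSpace G]
    (S : GroupExtension V G Q) (hS : GaloisObj.IsTopExtension S)
    (σ : S.Section) (β : Q → Q → V) (hβ : GaloisObj.IsRepresentative S σ β)
    (μQ : Measure Q) [μQ.IsHaarMeasure]
    (μV' : Measure (PontryaginDual V)) [μV'.IsHaarMeasure]
    (μG : Measure G) [μG.IsHaarMeasure]
    (η : Q → PontryaginDual V) (hη : GaloisObj.IsOneCocycle η)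
    (hη_bij : GaloisObj.IsMeasureClassIso μQ μV' η)
    (hcomp : GaloisObj.Compatible η β)
    (b : Q → Q → Circle) (hb : GaloisObj.IsTrivialization η β b) :
    GaloisObj.IsGaloisObject μG
      (GaloisObj.piRep S σ μQ hη.continuous hb.measurable) := by
  have hσ := hβ.measurable_section
  obtain ⟨d, hdm, hd0, hd⟩ := GaloisObj.exists_inv_density μQ
  have hd : GaloisObj.IsInvDensity μQ d := ⟨hdm, hd0, hd⟩
  -- No Haar measure on `V` is prescribed; any choice serves, and its normalization enters only
  -- through `c` and `κ`.
  obtain ⟨c, hc⟩ := GaloisObj.exists_plancherel_cocycle Measure.haar hη hη_bij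
  obtain ⟨κ, hκ0, hκt, hμG⟩ := GaloisObj.exists_lintegral_extension hS hβ μQ Measure.haar μG
  have hρ : Measurable (GaloisObj.dufloMooreRoot V κ c d) :=
    GaloisObj.measurable_dufloMooreRoot κ c hd.measurable
  have hρ0 := GaloisObj.dufloMooreRoot_pos (V := V) hκ0 hκt hc.1 hc.2.1 hd.ne_zero
  have hcoeff := GaloisObj.lintegral_coeff_piRep hS hσ hη hη_bij hb.measurable hκt hc hd hμG
  have hC := GaloisObj.isPosSelfAdjoint_mulOp (μ := μQ) hρ fun q => (hρ0 q).le
  have hπ : GaloisObj.IsIrreducibleProjRep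
      (GaloisObj.piRep S σ μQ hη.continuous hb.measurable) :=
    { mem_unitary := GaloisObj.mem_unitary_of_projective
        (fun g x => GaloisObj.norm_piOp hη.continuous hb.measurable _ _ x)
        (GaloisObj.piRep_mul hS hβ hη hb)
      measurable_coeff := GaloisObj.measurable_piRep hS hσ hη hb.measurable
      mul := GaloisObj.piRep_mul hS hβ hη hb
      irreducible := GaloisObj.exists_eq_smul_one_of_commute hC
        (fun f hf => congrArg Subtype.val
          (GaloisObj.mulOp_injective (fun q => (hρ0 q).ne') f hf)) hcoeff }
  have hD : GaloisObj.IsDufloMoore μG (GaloisObj.piRep S σ μQ hη.continuous hb.measurable)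
      (GaloisObj.mulOp μQ fun q => GaloisObj.dufloMooreRoot V κ c d q ^ 2)
      (GaloisObj.mulOp μQ (GaloisObj.dufloMooreRoot V κ c d)) :=
    { isPosSelfAdjoint := GaloisObj.isPosSelfAdjoint_mulOp (hρ.pow_const 2) fun q => sq_nonneg _
      nonsingular := fun f hf =>
        GaloisObj.mulOp_injective (fun q => pow_ne_zero 2 (hρ0 q).ne') f hf
      isPosSqrt := GaloisObj.isPosSqrt_mulOp hρ fun q => (hρ0 q).le
      lintegral_coeff := hcoeff }
  have : SecondCountableTopology (Lp ℂ 2 μQ) := GaloisObj.secondCountableTopology_Lp μQ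
  exact GaloisObj.isGaloisObject_of_total hπ hD fun k hk h0 =>
    GaloisObj.ae_eq_zero_of_forall_integral_coeff hS hσ hη hb.measurable hκ0 hκt hc hd hμG hπ hD
      hk h0
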